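/- Let $\mathbb T$ be the unit square with opposite sides identified (edge effects are ignored), with its Euclidean distance and uniform probability measure. For $n$ nodes at positions $x_1,\dots,x_n\in\mathbb T$ and transmission range $r>0$, two distinct nodes $i,j$ are neighbours if $|x_i-x_j|<r$; let $N_i$ be the set of neighbours of $i$, and let $P_{ij}=1/|N_i|$ if $j\in N_i$ and $P_{ij}=0$ otherwise. Let $r=r(n)>0$ satisfy $r=\Theta(\sqrt{\log n/n})$ and be such that, with probability tending to one as $n\to\infty$, the random geometric graph of range $r$ on $n$ independent uniformly distributed points of $\mathbb T$ is connected. In the two-dimensional area-constrained mobility model with mobility capacity $r_c=r_c(n)>0$, each node $i$ has a home point, the home points are independent and uniformly distributed in $\mathbb T$, and in each time slot the nodes move, independently of each other and of their previous positions, to new positions $X_i(t+1)$, uniformly distributed in the disks of radius $r_c$ around their home points. Given the home points, the mobile conductance is $$\Phi_m=\min_{\emptyset\ne S\subset\{1,\dots,n\},\ |S|\le n/2}\ \mathbb E\Big[\frac{1}{|S|}\sum_{i\in S,\,j\notin S}P_{ij}(t+1)\Big],$$ where $P_{ij}(t+1)$ is evaluated at the positions $X(t+1)$ after the move and the expectation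 is over the move. Then, as $n\to\infty$: 1. if $r_c=\omega(r)$ and $r_c$ is bounded, then $\Phi_m=\Theta(r_c)$; 2. if $r_c=o(r)$, then $\Phi_m=\Theta(r)$; 3. if $r_c=\Theta(r)$, then $\Phi_m=\Theta(r_c)$ and $\Phi_m=\Theta(r)$. Here $\Phi_m=\Theta(f)$ means that there are constants $c,C>0$ such that $c f(n)\le\Phi_m\le C f(n)$ with probability (over the home points) tending to one as $n\to\infty$. -/

import Mathlib

open MeasureTheory ProbabilityTheory Filter Topology Asymptotics

/-- The unit square with opposite sides identified (edge effects are ignored). As a product of two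
circles of length one it carries the uniform probability measure `volume`. -/
abbrev Torus : Type := Fin 2 → UnitAddCircle

/-- The flat (Euclidean) distance on the torus; `‖·‖` on `UnitAddCircle` is the distance to the
nearest integer. -/
noncomputable def torusDist (x y : Torus) : ℝ :=
  Real.sqrt (‖x 0 - y 0‖ ^ 2 + ‖x 1 - y 1‖ ^ 2)

/-- The geometric graph with transmission range `r` on the node positions `x`: two distinct nodes
are neighbours when their distance is less than `r`. -/
def geomGraph {n : ℕ} (r : ℝ) (x : Fin n → Torus) : SimpleGraph (Fin n) where
  Adj i j := i ≠ j ∧ torusDist (x i) (x j) < r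
  symm := ⟨fun i j h => ⟨h.1.symm, by
    have h2 := h.2
    unfold torusDist at h2 ⊢
    rwa [norm_sub_rev (x j 0), norm_sub_rev (x j 1)]⟩⟩
  loopless := ⟨fun _ h => h.1 rfl⟩

open Classical in
/-- The probability `P i j` that node `i` contacts node `j` in the gossip step, when the nodes are
at the positions `x`: one over the number of neighbours of `i` if `j` is one of them, else zero. -/
noncomputable def contactProb {n : ℕ} (r : ℝ) (x : Fin n → Torus) (i j : Fin n) : ℝ :=
  if (geomGraph r x).Adj i j then 1 / (((geomGraph r x).neighborSet i).ncard : ℝ) else 0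

/-- The mobile conductance, where `ν` is the conditional law of the positions of the `n` nodes after
the move, given the state of the network before the move: the minimum over the nonempty sets `S` of
at most `n / 2` nodes of the expected value of `(∑ i ∈ S, ∑ j ∉ S, P i j) / |S|` after the move.
(For `n ≥ 2` this is a minimum over a finite nonempty family.) -/
noncomputable def mobileConductance {n : ℕ} (r : ℝ) (ν : Measure (Fin n → Torus)) : ℝ :=
  ⨅ S : {S : Finset (Fin n) // S.Nonempty ∧ 2 * S.card ≤ n},
    ∫ x, (∑ i ∈ S.1, ∑ j ∈ S.1ᶜ, contactProb r x i j) / (S.1.card : ℝ) ∂ν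

/-- The uniform distribution on the disk of radius `ρ` around the point `p`. -/
noncomputable def diskLaw (ρ : ℝ) (p : Torus) : Measure Torus :=
  (volume : Measure Torus)[|{y | torusDist p y ≤ ρ}]

/-- The law of a move in the two-dimensional area-constrained model with mobility capacity `ρ` and
home points `h`: whatever the present positions, the new positions are independent and the one of
node `i` is uniform in the disk of radius `ρ` around its home point `h i`. -/
noncomputable def areaConstrainedMove {n : ℕ} (ρ : ℝ) (h : Fin n → Torus) :
    Measure (Fin n → Torus) :=
  Measure.pi fun i => diskLaw ρ (h i)

/-- `Φ n h`, a quantity that depends on `n` independent uniformly distributed points `h`, is of the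
order `Θ (f n)` with probability tending to one as `n → ∞`. -/
def ThetaWHP (Φ : (n : ℕ) → (Fin n → Torus) → ℝ) (f : ℕ → ℝ) : Prop :=
  ∃ c C : ℝ, 0 < c ∧ 0 < C ∧
    Tendsto
      (fun n => (volume : Measure (Fin n → Torus)) {h | ¬ (c * f n ≤ Φ n h ∧ Φ n h ≤ C * f n)})
      atTop (𝓝 0)

/-! Three estimates, each valid with high probability, are combined: `Φ_m ≤ 128 (r + 2 r_c)` always,
`Φ_m ≥ c r` always, and `Φ_m ≥ c r_c` when `r_c` is bounded and dominates `r`. The three regimes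
follow by comparing `r` with `r_c`.

Upper bound (`LogRange.mobileConductance_le`). Let `S` consist of the nodes with home in a strip
occupying a quarter of the torus. A node of `S` can contact the complement only if its home is
within `r + 2 r_c` of one of the two border lines, and only `O(n (r + r_c))` homes are.

Lower bound `r` (`LogRange.exists_le_mobileConductance`). With uniform homes the positions after the
move are again uniform, so it suffices that a static connected geometric graph has conductance at
least of order `r` with high probability; Fubini and Markov transfer this to the move. Cut the torus
into about `r⁻²` cells, so that neighbouring cells are completely joined. The constant in `r =
Θ(√(log n / n))` may be so small that some cells are sparse or empty, but a bounded window contains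
only boundedly many sparse ones. Hence every cell is framed by well filled rows and columns, and a
crossing of such lines serves as its representative. Connectivity forces the nodes of a cell to
leave the frame, so without cut edges nearby they lie on the side of the representative
(`GridGraph.cellFrac_corner`). An `L¹` Poincaré inequality on the discrete torus
(`sum_mul_compl_le_grid`), applied to the fraction of `S` in the representatives, then bounds the
cut from below (`GridGraph.card_le_or_card_mul_le`).

Lower bound `r_c` (`LogRange.exists_mul_capacity_le`). On a grid of mesh about `r_c` all cells
contain comparably many homes, so the same inequality yields order `|S| n r_c³` separated pairs of
nodes with close homes (`card_mul_le_of_uniform_grid`). Each pair meets with probability at least of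
order `(r / r_c)²` (`le_move_real_adj`), and degrees are `O(log n) = O(n r²)`. The quotient is of
order `r_c`. -/

/-! ### Equal cells on the circle and the torus -/

/-- The index of the arc containing a point when the circle is cut into `m` arcs of equal length. -/
noncomputable def circleCell (m : ℕ) : UnitAddCircle → ZMod m :=
  Function.Periodic.lift (f := fun s : ℝ => ((⌊(m : ℝ) * s⌋ : ℤ) : ZMod m)) (c := 1) (by
    intro s
    have h : (m : ℝ) * (s + 1) = (m : ℝ) * s + (m : ℤ) := by push_cast; ring
    simp only [h, Int.floor_add_intCast]
    simp)

lemma circleCell_coe (m : ℕ) (s : ℝ) :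
    circleCell m (s : UnitAddCircle) = ((⌊(m : ℝ) * s⌋ : ℤ) : ZMod m) := rfl

/-- Moving one representative by the integer nearest to the difference turns the circle distance
into a distance on the line, where arcs can be compared through floors. -/
lemma exists_rep_sub (x y : UnitAddCircle) :
    ∃ s t : ℝ, (s : UnitAddCircle) = x ∧ (t : UnitAddCircle) = y ∧ |s - t| = ‖x - y‖ := by
  induction x using QuotientAddGroup.induction_on with
  | H s =>
  induction y using QuotientAddGroup.induction_on with
  | H t =>
  refine ⟨s, t + round (s - t), rfl, ?_, ?_⟩
  · have h : ((round (s - t) : ℝ) : UnitAddCircle) = 0 := by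
      rw [AddCircle.coe_eq_zero_iff]; exact ⟨round (s - t), by simp⟩
    change ((t + (round (s - t) : ℝ) : ℝ) : UnitAddCircle) = (t : UnitAddCircle)
    rw [AddCircle.coe_add, h, add_zero]
  · change _ = ‖((s - t : ℝ) : UnitAddCircle)‖
    rw [UnitAddCircle.norm_eq]
    congr 1; ring

lemma norm_coe_le_abs (s : ℝ) : ‖(s : UnitAddCircle)‖ ≤ |s| := by
  rw [UnitAddCircle.norm_eq]
  simpa using round_le s 0

lemma norm_sub_le_of_circleCell {m : ℕ} (hm : 0 < m) {x y : UnitAddCircle} {d : ℤ}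
    (h : circleCell m y = circleCell m x + d) : ‖x - y‖ ≤ (|d| + 1) / m := by
  induction x using QuotientAddGroup.induction_on with
  | H s =>
  induction y using QuotientAddGroup.induction_on with
  | H t =>
  change ((⌊(m : ℝ) * t⌋ : ℤ) : ZMod m) = ((⌊(m : ℝ) * s⌋ : ℤ) : ZMod m) + d at h
  rw [← Int.cast_add, ZMod.intCast_eq_intCast_iff_dvd_sub] at h
  obtain ⟨k, hk⟩ := h
  have hk' : ((⌊(m : ℝ) * s⌋ : ℤ) : ℝ) + d - (⌊(m : ℝ) * t⌋ : ℤ) = m * k := by exact_mod_cast hk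
  have e : (s : UnitAddCircle) - (t : UnitAddCircle) = ((s - t - k : ℝ) : UnitAddCircle) := by
    have h : ((k : ℝ) : UnitAddCircle) = 0 := by
      rw [AddCircle.coe_eq_zero_iff]; exact ⟨k, by simp⟩
    rw [AddCircle.coe_sub, AddCircle.coe_sub, h, sub_zero]
  change ‖(s : UnitAddCircle) - (t : UnitAddCircle)‖ ≤ _
  rw [e]
  refine (norm_coe_le_abs _).trans ?_
  have hm' : (0 : ℝ) < m := by exact_mod_cast hm
  rw [le_div_iff₀ hm']
  have e2 : |s - t - k| * m = |(m * s - ⌊(m : ℝ) * s⌋) - (m * t - ⌊(m : ℝ) * t⌋) - d| := by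
    rw [← abs_of_pos hm', ← abs_mul, abs_of_pos hm']
    congr 1
    linear_combination hk'
  rw [e2]
  have h1 := Int.floor_le ((m : ℝ) * s)
  have h2 := Int.lt_floor_add_one ((m : ℝ) * s)
  have h3 := Int.floor_le ((m : ℝ) * t)
  have h4 := Int.lt_floor_add_one ((m : ℝ) * t)
  push_cast
  rw [abs_le]
  constructor
  · have := le_abs_self (d : ℝ); linarith
  · have := neg_abs_le (d : ℝ); linarith

lemma exists_circleCell_eq_add {m : ℕ} (hm : 0 < m) {x y : UnitAddCircle} {k : ℕ}
    (h : ‖x - y‖ < k / m) : ∃ d : ℤ, |d| ≤ k ∧ circleCell m y = circleCell m x + d := by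
  obtain ⟨s, t, rfl, rfl, hst⟩ := exists_rep_sub x y
  rw [← hst] at h
  have hm' : (0 : ℝ) < m := by exact_mod_cast hm
  rw [lt_div_iff₀ hm', ← abs_of_pos hm', ← abs_mul] at h
  refine ⟨⌊(m : ℝ) * t⌋ - ⌊(m : ℝ) * s⌋, ?_, ?_⟩
  · rw [abs_lt] at h
    have h1 := Int.floor_le ((m : ℝ) * s)
    have h2 := Int.lt_floor_add_one ((m : ℝ) * s)
    have h3 := Int.floor_le ((m : ℝ) * t)
    have h4 := Int.lt_floor_add_one ((m : ℝ) * t)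
    have a1 : ((⌊(m : ℝ) * t⌋ - ⌊(m : ℝ) * s⌋ : ℤ) : ℝ) < ((k + 1 : ℤ) : ℝ) := by
      push_cast; linarith
    have a2 : ((-(k + 1) : ℤ) : ℝ) < ((⌊(m : ℝ) * t⌋ - ⌊(m : ℝ) * s⌋ : ℤ) : ℝ) := by
      push_cast; linarith
    have a3 := Int.cast_lt.1 a1
    have a4 := Int.cast_lt.1 a2
    rw [abs_le]; constructor <;> omega
  · rw [circleCell_coe, circleCell_coe]; push_cast; ring

lemma measurable_circleCell (m : ℕ) : @Measurable _ _ _ ⊤ (circleCell m) := by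
  have e : circleCell m = fun x =>
      (fun z : ℤ => (z : ZMod m)) ⌊(m : ℝ) * (AddCircle.measurableEquivIco (1 : ℝ) 0 x : ℝ)⌋ := by
    funext x
    conv_lhs => rw [← (AddCircle.measurableEquivIco (1 : ℝ) 0).symm_apply_apply x]
    rfl
  rw [e]
  refine @Measurable.comp _ _ _ _ _ ⊤ _ _ measurable_from_top ?_
  refine Measurable.comp (g := fun s : ℝ => ⌊(m : ℝ) * s⌋)
    (Int.measurable_floor.comp (measurable_const.mul measurable_id)) ?_
  exact measurable_subtype_coe.comp (AddCircle.measurableEquivIco (1 : ℝ) 0).measurable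

lemma measurableSet_circleCell (m : ℕ) (a : ZMod m) : MeasurableSet {x | circleCell m x = a} :=
  measurable_circleCell m (t := {a}) trivial

lemma circleCell_add_inv (m : ℕ) [NeZero m] (x : UnitAddCircle) (k : ℤ) :
    circleCell m (x + ((k / m : ℝ) : UnitAddCircle)) = circleCell m x + k := by
  induction x using QuotientAddGroup.induction_on with
  | H s =>
  change circleCell m ((s + k / m : ℝ) : UnitAddCircle) = circleCell m (s : UnitAddCircle) + k
  have h0 : (m : ℝ) ≠ 0 := NeZero.ne _
  have : (m : ℝ) * (s + k / m) = m * s + k := by field_simp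
  rw [circleCell_coe, circleCell_coe, this, Int.floor_add_intCast, Int.cast_add]

/-- Translations by multiples of `1 / m` permute the arcs, so by invariance they all have the same
measure, and the `m` measures add up to 1. -/
lemma volume_circleCell (m : ℕ) [NeZero m] (a : ZMod m) :
    (volume : Measure UnitAddCircle) {x | circleCell m x = a} = (m : ENNReal)⁻¹ := by
  have key : ∀ b : ZMod m, (volume : Measure UnitAddCircle) {x | circleCell m x = b} =
      volume {x | circleCell m x = a} := by
    intro b
    rw [← measure_preimage_add_right volume ((((a - b).valMinAbs : ℝ) / m : ℝ) : UnitAddCircle)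
      {x | circleCell m x = a}]
    congr 1
    ext x
    have : circleCell m (x + ((((a - b).valMinAbs : ℤ) / m : ℝ) : UnitAddCircle)) =
      circleCell m x + (a - b) := by
      rw [circleCell_add_inv]; simp
    simp only [Set.mem_ofPred_eq, Set.mem_preimage, this]
    constructor
    · intro h; rw [h]; ring
    · intro h; linear_combination h
  have hsum : ∑ b : ZMod m, (volume : Measure UnitAddCircle) {x | circleCell m x = b} = 1 := by
    rw [← measure_biUnion_finset]
    · rw [← UnitAddCircle.measure_univ]
      congr 1; ext x; simp
    · intro b _ c _ hbc
      refine Set.disjoint_left.2 fun x hx hx' => hbc (hx.symm.trans hx')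
    · intro b _; exact measurableSet_circleCell m b
  simp only [key, Finset.sum_const, Finset.card_univ, ZMod.card, nsmul_eq_mul] at hsum
  exact ENNReal.eq_inv_of_mul_eq_one_left (by rw [mul_comm]; exact hsum)

/-- The index of the square containing a point when the torus is cut into `m * m` squares. -/
noncomputable def torusCell (m : ℕ) (x : Torus) : ZMod m × ZMod m :=
  (circleCell m (x 0), circleCell m (x 1))

lemma measurableSet_torusCell (m : ℕ) (c : ZMod m × ZMod m) :
    MeasurableSet {x | torusCell m x = c} := by
  have : {x | torusCell m x = c} =
      (fun x : Torus => x 0) ⁻¹' {y | circleCell m y = c.1} ∩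
        (fun x : Torus => x 1) ⁻¹' {y | circleCell m y = c.2} := by
    ext x; simp [torusCell, Prod.ext_iff]
  rw [this]
  exact ((measurable_pi_apply 0) (measurableSet_circleCell m _)).inter
    ((measurable_pi_apply 1) (measurableSet_circleCell m _))

lemma volume_pair (A B : Set UnitAddCircle) :
    (volume : Measure Torus) {x | x 0 ∈ A ∧ x 1 ∈ B} = volume A * volume B := by
  have : {x : Torus | x 0 ∈ A ∧ x 1 ∈ B} = Set.pi Set.univ ![A, B] := by
    ext x; simp [Set.mem_pi, Fin.forall_fin_two]
  rw [this, volume_pi_pi]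
  simp

lemma volume_torusCell (m : ℕ) [NeZero m] (c : ZMod m × ZMod m) :
    (volume : Measure Torus) {x | torusCell m x = c} = ((m : ENNReal) ^ 2)⁻¹ := by
  have : {x | torusCell m x = c} =
      {x | x 0 ∈ {y | circleCell m y = c.1} ∧ x 1 ∈ {y | circleCell m y = c.2}} := by
    ext x; simp [torusCell, Prod.ext_iff]
  rw [this, volume_pair, volume_circleCell, volume_circleCell, ENNReal.inv_pow, sq]

lemma volume_real_biUnion_torusCell (m : ℕ) [NeZero m] (T : Finset (ZMod m × ZMod m)) :
    (volume : Measure Torus).real {x | torusCell m x ∈ T} = T.card / (m : ℝ) ^ 2 := by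
  have : {x | torusCell m x ∈ T} = ⋃ c ∈ T, {x | torusCell m x = c} := by ext; simp
  rw [Measure.real, this, measure_biUnion_finset]
  · simp [volume_torusCell, div_eq_mul_inv]
  · intro b _ c _ hbc
    exact Set.disjoint_left.2 fun x hx hx' => hbc (hx.symm.trans hx')
  · intro b _; exact measurableSet_torusCell m b

lemma measurableSet_torusCell_mem (m : ℕ) (T : Finset (ZMod m × ZMod m)) :
    MeasurableSet {x | torusCell m x ∈ T} := by
  have : {x | torusCell m x ∈ T} = ⋃ c ∈ T, {x | torusCell m x = c} := by ext; simp
  rw [this]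
  exact Finset.measurableSet_biUnion _ fun c _ => measurableSet_torusCell m c

lemma norm_le_torusDist_zero (x y : Torus) : ‖x 0 - y 0‖ ≤ torusDist x y :=
  Real.le_sqrt_of_sq_le (by nlinarith [sq_nonneg ‖x 1 - y 1‖])

lemma norm_le_torusDist_one (x y : Torus) : ‖x 1 - y 1‖ ≤ torusDist x y :=
  Real.le_sqrt_of_sq_le (by nlinarith [sq_nonneg ‖x 0 - y 0‖])

lemma torusDist_le {x y : Torus} {a b : ℝ} (h0 : ‖x 0 - y 0‖ ≤ a) (h1 : ‖x 1 - y 1‖ ≤ b) :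
    torusDist x y ≤ Real.sqrt (a ^ 2 + b ^ 2) := by
  unfold torusDist
  gcongr

lemma continuous_torusDist : Continuous fun p : Torus × Torus => torusDist p.1 p.2 := by
  unfold torusDist
  fun_prop

/-! ### Chernoff bounds for the number of points in a set -/

open Classical in
/-- The number of entries of `x` that lie in `A`. -/
noncomputable def countIn {Ω : Type*} {n : ℕ} (x : Fin n → Ω) (A : Set Ω) : ℕ :=
  (Finset.univ.filter fun i => x i ∈ A).card

lemma countIn_eq_sum {Ω : Type*} {n : ℕ} (A : Set Ω) (x : Fin n → Ω) :
    (countIn x A : ℝ) = ∑ i, A.indicator (fun _ => (1 : ℝ)) (x i) := by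
  classical
  unfold countIn
  simp [Set.indicator_apply, Finset.sum_boole]

section Chernoff

variable {Ω : Type*} [MeasurableSpace Ω] (μ : Measure Ω) [IsProbabilityMeasure μ] (n : ℕ)
  {A : Set Ω}

lemma measurable_countIn (hA : MeasurableSet A) : Measurable fun x : Fin n → Ω => (countIn x A : ℝ) := by
  simp only [countIn_eq_sum]
  exact Finset.measurable_sum _ fun i _ =>
    (measurable_const.indicator hA).comp (measurable_pi_apply i)

lemma integrable_exp_countIn (hA : MeasurableSet A) (t : ℝ) :
    Integrable (fun x : Fin n → Ω => Real.exp (t * (countIn x A : ℝ))) (Measure.pi fun _ => μ) := by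
  refine Integrable.of_bound
    ((Real.measurable_exp.comp ((measurable_countIn n hA).const_mul t)).aestronglyMeasurable)
    (Real.exp (|t| * n)) (Eventually.of_forall fun x => ?_)
  rw [Real.norm_eq_abs, Real.abs_exp]
  gcongr
  · exact le_abs_self t
  · exact_mod_cast (Finset.card_le_univ _).trans (by simp)

/-- The exponential of the count is a product over independent coordinates, so the generating
function equals `(1 + μ(A) (e^t - 1))^n`; then `1 + x ≤ e^x`. -/
lemma mgf_countIn_le (hA : MeasurableSet A) (t : ℝ) :
    mgf (fun x : Fin n → Ω => (countIn x A : ℝ)) (Measure.pi fun _ => μ) t ≤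
      Real.exp (n * μ.real A * (Real.exp t - 1)) := by
  have h1 : mgf (fun x : Fin n → Ω => (countIn x A : ℝ)) (Measure.pi fun _ => μ) t =
      (1 + μ.real A * (Real.exp t - 1)) ^ n := by
    have e : ∀ x : Fin n → Ω, Real.exp (t * (countIn x A : ℝ)) =
        ∏ i, (1 + A.indicator (fun _ => Real.exp t - 1) (x i)) := by
      intro x
      rw [countIn_eq_sum, Finset.mul_sum, Real.exp_sum]
      refine Finset.prod_congr rfl fun i _ => ?_
      by_cases h : x i ∈ A <;> simp [h]
    rw [mgf]
    simp only [e]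
    rw [integral_fintype_prod_eq_pow (fun y => 1 + A.indicator (fun _ => Real.exp t - 1) y),
      integral_add (integrable_const _) ((integrable_const _).indicator hA), integral_indicator hA]
    simp
  rw [h1, mul_assoc, Real.exp_nat_mul]
  have h2 : 0 ≤ 1 + μ.real A * (Real.exp t - 1) := by
    have := measureReal_le_one (μ := μ) (s := A)
    have := measureReal_nonneg (μ := μ) (s := A)
    have := Real.exp_pos t
    nlinarith
  refine pow_le_pow_left₀ h2 ?_ n
  rw [add_comm]
  exact Real.add_one_le_exp _

/-- Chernoff bound for the upper tail. -/
lemma measure_le_countIn (hA : MeasurableSet A) {p : ℝ} (hp : μ.real A ≤ p) (a : ℝ) :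
    (Measure.pi fun _ : Fin n => μ) {x | a ≤ countIn x A} ≤
      ENNReal.ofReal (Real.exp (7 / 4 * (n * p) - a)) := by
  rw [← ofReal_measureReal]
  refine ENNReal.ofReal_le_ofReal ?_
  refine (measure_ge_le_exp_mul_mgf a zero_le_one (integrable_exp_countIn μ n hA 1)).trans ?_
  refine (mul_le_mul_of_nonneg_left (mgf_countIn_le μ n hA 1) (Real.exp_pos _).le).trans ?_
  rw [← Real.exp_add, Real.exp_le_exp]
  -- The parameter is fixed at `t = 1`; `7 / 4` is a rational upper bound for `e - 1`.
  have := Real.exp_one_lt_d9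
  have h1 : (n : ℝ) * μ.real A ≤ n * p := by gcongr
  have h2 : 0 ≤ (n : ℝ) * μ.real A := by positivity
  nlinarith

/-- Chernoff bound for the lower tail. -/
lemma measure_countIn_le (hA : MeasurableSet A) {p : ℝ} (hp : p ≤ μ.real A) (a : ℝ) :
    (Measure.pi fun _ : Fin n => μ) {x | countIn x A ≤ a} ≤
      ENNReal.ofReal (Real.exp (a - 3 / 5 * (n * p))) := by
  rw [← ofReal_measureReal]
  refine ENNReal.ofReal_le_ofReal ?_
  refine (measure_le_le_exp_mul_mgf a (by norm_num : (-1 : ℝ) ≤ 0)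
    (integrable_exp_countIn μ n hA (-1))).trans ?_
  refine (mul_le_mul_of_nonneg_left (mgf_countIn_le μ n hA (-1)) (Real.exp_pos _).le).trans ?_
  rw [← Real.exp_add, Real.exp_le_exp]
  -- Here `t = -1`; `3 / 5` is a rational lower bound for `1 - 1 / e`.
  have h0 : Real.exp (-1) ≤ 2 / 5 := by
    rw [Real.exp_neg, inv_le_comm₀ (Real.exp_pos _) (by norm_num)]
    have := Real.exp_one_gt_d9
    norm_num; linarith
  have h1 : (n : ℝ) * p ≤ n * μ.real A := by gcongr
  have h2 : 0 ≤ (n : ℝ) * μ.real A := by positivity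
  nlinarith

end Chernoff

/-! ### A Poincaré inequality on the discrete torus -/

section GridPoincare

variable {m : ℕ} [NeZero m]

lemma abs_sub_le_sum_cyclic (g : ZMod m → ℝ) (a b : ZMod m) :
    |g a - g b| ≤ ∑ x, |g (x + 1) - g x| := by
  have key : ∀ t : ℕ, t ≤ m → |g a - g (a + t)| ≤ ∑ x, |g (x + 1) - g x| := by
    intro t ht
    have h1 : |g a - g (a + t)| ≤ ∑ s ∈ Finset.range t, |g (a + s + 1) - g (a + s)| := by
      clear ht
      induction t with
      | zero => simp
      | succ t ih =>
        rw [Finset.sum_range_succ, Nat.cast_succ, ← add_assoc]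
        have := abs_sub_le (g a) (g (a + t)) (g (a + t + 1))
        rw [abs_sub_comm (g (a + t))] at this
        linarith
    refine h1.trans ?_
    have hinj : Set.InjOn (fun s : ℕ => a + (s : ZMod m)) (Finset.range t : Set ℕ) := by
      intro x hx y hy hxy
      simp only [Finset.coe_range, Set.mem_Iio] at hx hy
      have := add_left_cancel hxy
      rw [ZMod.natCast_eq_natCast_iff'] at this
      rwa [Nat.mod_eq_of_lt (by omega), Nat.mod_eq_of_lt (by omega)] at this
    rw [← Finset.sum_image (f := fun x => |g (x + 1) - g x|) hinj]
    exact Finset.sum_le_univ_sum_of_nonneg fun x => abs_nonneg _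
  have h := key (b - a).val (ZMod.val_lt _).le
  simpa using h

/-- An `L¹` Poincaré inequality on the discrete torus, in the form of an isoperimetric
inequality for `[0, 1]`-valued functions. -/
lemma sum_mul_compl_le_grid (f : ZMod m × ZMod m → ℝ) (h0 : ∀ c, 0 ≤ f c) (h1 : ∀ c, f c ≤ 1) :
    (∑ c, f c) * ((m : ℝ) ^ 2 - ∑ c, f c) ≤ (m : ℝ) ^ 2 * ∑ c, f c * (1 - f c) +
      (m : ℝ) ^ 3 * ∑ c, (|f (c + (1, 0)) - f c| + |f (c + (0, 1)) - f c|) := by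
  have hcard : ((Fintype.card (ZMod m × ZMod m) : ℕ) : ℝ) = (m : ℝ) ^ 2 := by
    simp [ZMod.card, sq]
  have e1 : (∑ c, f c) * ((m : ℝ) ^ 2 - ∑ c, f c) = ∑ c, ∑ c', f c * (1 - f c') := by
    rw [Finset.sum_mul]
    refine Finset.sum_congr rfl fun c _ => ?_
    rw [← Finset.mul_sum, Finset.sum_sub_distrib]
    simp [ZMod.card, sq]
  -- Split `1 - f c'` as `(1 - f c) + (f c - f c')`.
  have e2 : ∀ c c', f c * (1 - f c') ≤ f c * (1 - f c) + |f c - f c'| := by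
    intro c c'
    have a1 := le_abs_self (f c - f c')
    have a2 := abs_nonneg (f c - f c')
    have : f c * (f c - f c') ≤ |f c - f c'| := by nlinarith [h0 c, h1 c]
    nlinarith
  -- Walk along the row of `c`, then along the column of `c'`. Bounding each leg by the variation of
  -- the whole circle leaves three free coordinates in the double sum, whence the factor `m³`.
  have e3 : ∀ c c' : ZMod m × ZMod m, |f c - f c'| ≤
      (∑ x, |f (x + 1, c.2) - f (x, c.2)|) + ∑ y, |f (c'.1, y + 1) - f (c'.1, y)| := by
    intro c c'
    refine (abs_sub_le _ (f (c'.1, c.2)) _).trans (add_le_add ?_ ?_)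
    · exact abs_sub_le_sum_cyclic (fun x => f (x, c.2)) c.1 c'.1
    · exact abs_sub_le_sum_cyclic (fun y => f (c'.1, y)) c.2 c'.2
  rw [e1]
  calc ∑ c, ∑ c', f c * (1 - f c')
      ≤ ∑ c, ∑ c', (f c * (1 - f c) + ((∑ x, |f (x + 1, c.2) - f (x, c.2)|) +
          ∑ y, |f (c'.1, y + 1) - f (c'.1, y)|)) :=
        Finset.sum_le_sum fun c _ => Finset.sum_le_sum fun c' _ =>
          (e2 c c').trans (by gcongr; exact e3 c c')
    _ = _ := by
        simp only [Finset.sum_add_distrib, Finset.sum_const, Finset.card_univ, nsmul_eq_mul, hcard,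
          ← Finset.mul_sum]
        simp only [Fintype.sum_prod_type, Finset.sum_const, Finset.card_univ, nsmul_eq_mul,
          ZMod.card, Prod.mk_add_mk, add_zero, ← Finset.mul_sum]
        rw [Finset.sum_comm (f := fun x y => |f (x, y + 1) - f (x, y)|),
          Finset.sum_comm (f := fun x y => |f (x + 1, y) - f (x, y)|),
          Finset.sum_comm (f := fun y x => |f (x, y + 1) - f (x, y)|)]
        ring

end GridPoincare

/-! ### Cut pairs between cells -/

section Cells

variable {m : ℕ} {V : Type*} [Fintype V] (κ : V → ZMod m × ZMod m)

open Classical in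
/-- The number of nodes in a cell. -/
noncomputable def cellCount (c : ZMod m × ZMod m) : ℝ :=
  ((Finset.univ.filter fun v => κ v = c).card : ℝ)

open Classical in
/-- The proportion of the nodes of a cell that belong to `S`. -/
noncomputable def cellFrac (S : Finset V) (c : ZMod m × ZMod m) : ℝ :=
  ((Finset.univ.filter fun v => v ∈ S ∧ κ v = c).card : ℝ) / cellCount κ c

open Classical in
/-- The number of pairs in `S × Sᶜ` that satisfy `R` and whose first node satisfies `P`. -/
noncomputable def cutCount (R : V → V → Prop) (S : Finset V) (P : V → Prop) : ℝ :=
  ((Finset.univ.filter fun p : V × V => p.1 ∈ S ∧ p.2 ∉ S ∧ R p.1 p.2 ∧ P p.1).card : ℝ)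

lemma cutCount_nonneg (R : V → V → Prop) (S : Finset V) (P : V → Prop) :
    0 ≤ cutCount R S P := Nat.cast_nonneg _

lemma cellCount_nonneg (c : ZMod m × ZMod m) : 0 ≤ cellCount κ c := Nat.cast_nonneg _

lemma cellFrac_nonneg (S : Finset V) (c : ZMod m × ZMod m) : 0 ≤ cellFrac κ S c :=
  div_nonneg (Nat.cast_nonneg _) (cellCount_nonneg κ c)

lemma cellFrac_le_one (S : Finset V) (c : ZMod m × ZMod m) : cellFrac κ S c ≤ 1 := by
  classical
  refine div_le_one_of_le₀ ?_ (cellCount_nonneg κ c)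
  unfold cellCount
  gcongr with v
  exact fun h => h.2

lemma cellFrac_mul_count (S : Finset V) (c : ZMod m × ZMod m) [DecidablePred fun v => v ∈ S ∧ κ v = c] :
    cellFrac κ S c * cellCount κ c = ((Finset.univ.filter fun v => v ∈ S ∧ κ v = c).card : ℝ) := by
  classical
  have e : cellFrac κ S c =
    ((Finset.univ.filter fun v => v ∈ S ∧ κ v = c).card : ℝ) / cellCount κ c := by
    unfold cellFrac; congr
  rw [e]
  -- In an empty cell `cellFrac` is `0 / 0 = 0`, and the identity survives because both sides
  -- vanish.
  by_cases h : cellCount κ c = 0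
  · rw [h, mul_zero]
    unfold cellCount at h
    have h' := Nat.cast_eq_zero.1 h
    rw [Finset.card_eq_zero, Finset.filter_eq_empty_iff] at h'
    symm
    rw [Nat.cast_eq_zero, Finset.card_eq_zero, Finset.filter_eq_empty_iff]
    intro v hv hv'
    exact h' hv hv'.2
  · rw [div_mul_cancel₀ _ h]

lemma one_sub_cellFrac_mul_count (S : Finset V) (c : ZMod m × ZMod m)
    [DecidablePred fun v => v ∉ S ∧ κ v = c] :
    (1 - cellFrac κ S c) * cellCount κ c =
      ((Finset.univ.filter fun v => v ∉ S ∧ κ v = c).card : ℝ) := by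
  classical
  rw [sub_mul, cellFrac_mul_count, one_mul, sub_eq_iff_eq_add]
  unfold cellCount
  rw [← Nat.cast_add, ← Finset.card_union_of_disjoint]
  · congr 2; ext v; simp; tauto
  · rw [Finset.disjoint_filter]; tauto

/-- Two completely joined cells cut every pair formed by a node of `S` in the first and a node
outside `S` in the second. The predicate `P` restricts the count to cuts starting near a given
place. -/
lemma cellFrac_mul_le_cutCount {R : V → V → Prop} {S : Finset V} {c c' : ZMod m × ZMod m}
    (hR : ∀ u v, κ u = c → κ v = c' → u ≠ v → R u v) {A : ℝ} (hA : 0 ≤ A)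
    (h : A ≤ cellCount κ c) (h' : A ≤ cellCount κ c') {P : V → Prop} (hP : ∀ u, κ u = c → P u) :
    cellFrac κ S c * (1 - cellFrac κ S c') * A ^ 2 ≤ cutCount R S P := by
  classical
  have f0 := cellFrac_nonneg κ S c
  have f1 := sub_nonneg.2 (cellFrac_le_one κ S c')
  have f2 := cellCount_nonneg κ c
  calc cellFrac κ S c * (1 - cellFrac κ S c') * A ^ 2
      = (cellFrac κ S c * A) * ((1 - cellFrac κ S c') * A) := by ring
    _ ≤ (cellFrac κ S c * cellCount κ c) * ((1 - cellFrac κ S c') * cellCount κ c') := by gcongr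
    _ = (((Finset.univ.filter fun v => v ∈ S ∧ κ v = c) ×ˢ
          (Finset.univ.filter fun v => v ∉ S ∧ κ v = c')).card : ℝ) := by
        rw [cellFrac_mul_count, one_sub_cellFrac_mul_count, Finset.card_product, Nat.cast_mul]
    _ ≤ cutCount R S P := by
        unfold cutCount
        gcongr
        intro p hp
        simp only [Finset.mem_product, Finset.mem_filter, Finset.mem_univ, true_and] at hp ⊢
        refine ⟨hp.1.1, hp.2.1, hR _ _ hp.1.2 hp.2.2 ?_, hP _ hp.1.2⟩
        intro e; rw [e] at hp; exact hp.2.1 hp.1.1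

lemma abs_cellFrac_sub_le_cutCount {R : V → V → Prop} (hsymm : ∀ u v, R u v → R v u)
    {S : Finset V} {c c' : ZMod m × ZMod m}
    (hR : ∀ u v, κ u = c → κ v = c' → u ≠ v → R u v) {A : ℝ} (hA : 0 ≤ A)
    (h : A ≤ cellCount κ c) (h' : A ≤ cellCount κ c') {P : V → Prop} (hP : ∀ u, κ u = c → P u)
    (hP' : ∀ u, κ u = c' → P u) :
    |cellFrac κ S c - cellFrac κ S c'| * A ^ 2 ≤ cutCount R S P := by
  have h1 := cellFrac_mul_le_cutCount κ hR hA h h' hP (S := S)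
  have h2 := cellFrac_mul_le_cutCount κ (fun u v hu hv huv => hsymm _ _ (hR v u hv hu huv.symm))
    hA h' h hP' (S := S)
  have a0 := cellFrac_nonneg κ S c
  have a1 := cellFrac_le_one κ S c
  have b0 := cellFrac_nonneg κ S c'
  have b1 := cellFrac_le_one κ S c'
  have A2 : 0 ≤ A ^ 2 := by positivity
  -- For `a, b` in `[0, 1]` one has `a - b ≤ a (1 - b)`, so a difference of fractions is controlled
  -- by cut pairs in one of the two directions.
  rcases abs_cases (cellFrac κ S c - cellFrac κ S c') with ⟨e, _⟩ | ⟨e, _⟩ <;> rw [e]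
  · refine le_trans (mul_le_mul_of_nonneg_right ?_ A2) h1
    nlinarith
  · refine le_trans (mul_le_mul_of_nonneg_right ?_ A2) h2
    nlinarith

lemma sum_filter_cell [NeZero m] (p : V → Prop) [DecidablePred p]
    [∀ c, DecidablePred fun v => p v ∧ κ v = c] :
    ((Finset.univ.filter p).card : ℝ) =
      ∑ c, ((Finset.univ.filter fun v => p v ∧ κ v = c).card : ℝ) := by
  classical
  rw [← Nat.cast_sum, Nat.cast_inj,
    Finset.card_eq_sum_card_fiberwise (f := κ) (t := Finset.univ) (by simp)]
  refine Finset.sum_congr rfl fun c _ => ?_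
  rw [Finset.filter_filter]
  congr

end Cells

/-! ### Windows of cells and blocks of good lines -/

section Windows

variable {m : ℕ}

/-- The cell with offset `(i, j)` from the cell `c`. -/
def cellShift (c : ZMod m × ZMod m) (i j : ℤ) : ZMod m × ZMod m := c + ((i : ZMod m), (j : ZMod m))

/-- The cells at offset at most `W` in both directions. -/
def InWindow (W : ℕ) (c d : ZMod m × ZMod m) : Prop :=
  ∃ i j : ℤ, |i| ≤ W ∧ |j| ≤ W ∧ d = cellShift c i j

lemma cellShift_cellShift (c : ZMod m × ZMod m) (i j i' j' : ℤ) :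
    cellShift (cellShift c i j) i' j' = cellShift c (i + i') (j + j') := by
  simp [cellShift, add_assoc]

lemma cellShift_zero (c : ZMod m × ZMod m) : cellShift c 0 0 = c := by simp [cellShift]

/-- Among `q` consecutive blocks of four rows of a window with fewer than `q` bad cells there is a
block without bad cells. -/
lemma exists_good_rows {q : ℕ} {P : ℤ → ℤ → Prop}
    (h : ∀ T : Finset (ℤ × ℤ), (∀ p ∈ T, |p.1| ≤ (4 * q : ℕ) ∧ |p.2| ≤ (4 * q : ℕ) ∧ ¬ P p.1 p.2) →
      T.card < q) {s : ℤ} (hs : s = 1 ∨ s = -1) :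
    ∃ a : ℤ, 0 ≤ a ∧ a + 4 ≤ (4 * q : ℕ) ∧
      ∀ t, a < t → t ≤ a + 4 → ∀ i : ℤ, |i| ≤ (4 * q : ℕ) → P i (s * t) := by
  -- A bad cell in each of the `q` disjoint blocks would give `q` bad cells in distinct rows. Blocks
  -- have four rows because an edge spans at most four cells and so cannot jump over a block.
  by_contra! hcon
  have hk : ∀ k : Fin q, ∃ t i : ℤ, 4 * (k : ℤ) < t ∧ t ≤ 4 * (k : ℤ) + 4 ∧
      |i| ≤ (4 * q : ℕ) ∧ ¬ P i (s * t) := by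
    intro k
    have hk := k.2
    obtain ⟨t, h1, h2, i, h3, h4⟩ := hcon (4 * (k : ℤ)) (by omega) (by push_cast; omega)
    exact ⟨t, i, h1, h2, h3, h4⟩
  choose t i h1 h2 h3 h4 using hk
  have := h (Finset.univ.image fun k : Fin q => (i k, s * t k)) (by
    intro p hp
    obtain ⟨k, -, rfl⟩ := Finset.mem_image.1 hp
    refine ⟨h3 k, ?_, h4 k⟩
    have hk := k.2
    have a1 := h1 k
    have a2 := h2 k
    push_cast
    rcases hs with rfl | rfl
    · rw [abs_le]; constructor <;> omega
    · rw [abs_le]; constructor <;> omega)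
  rw [Finset.card_image_of_injective] at this
  · simp at this
  · intro k l hkl
    have hkl : s * t k = s * t l := (Prod.mk.inj hkl).2
    have a1 := h1 k
    have a2 := h2 k
    have a3 := h1 l
    have a4 := h2 l
    apply Fin.ext
    rcases hs with rfl | rfl <;> omega

lemma exists_good_columns {q : ℕ} {P : ℤ → ℤ → Prop}
    (h : ∀ T : Finset (ℤ × ℤ), (∀ p ∈ T, |p.1| ≤ (4 * q : ℕ) ∧ |p.2| ≤ (4 * q : ℕ) ∧ ¬ P p.1 p.2) →
      T.card < q) {s : ℤ} (hs : s = 1 ∨ s = -1) :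
    ∃ a : ℤ, 0 ≤ a ∧ a + 4 ≤ (4 * q : ℕ) ∧
      ∀ t, a < t → t ≤ a + 4 → ∀ j : ℤ, |j| ≤ (4 * q : ℕ) → P (s * t) j := by
  refine exists_good_rows (P := fun i j => P j i) (fun T hT => ?_) hs
  have := h (T.map (Equiv.prodComm ℤ ℤ).toEmbedding) (by
    intro p hp
    obtain ⟨p', hp', rfl⟩ := Finset.mem_map.1 hp
    obtain ⟨a1, a2, a3⟩ := hT p' hp'
    exact ⟨a2, a1, a3⟩)
  simpa using this

end Windows

/-! ### Connected graphs on a grid with few sparse cells -/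

lemma exists_boundary_edge {V : Type*} {G : SimpleGraph V} (hG : G.Connected) {T : Set V} {u w : V}
    (hu : u ∈ T) (hw : w ∉ T) : ∃ x y, x ∈ T ∧ y ∉ T ∧ G.Adj x y := by
  obtain ⟨p⟩ := hG.preconnected u w
  obtain ⟨d, -, h1, h2⟩ := p.exists_boundary_dart T hu hw
  exact ⟨d.fst, d.snd, h1, h2, d.adj⟩

/-- A connected graph whose nodes are distributed over the cells of a grid, such that nodes in the
same or adjacent cells are adjacent, edges are short, and in each window there are fewer than `q`
cells with fewer than `A` nodes. -/
structure GridGraph {m : ℕ} {V : Type*} [Fintype V] (κ : V → ZMod m × ZMod m)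
    (G : SimpleGraph V) (q : ℕ) (A : ℝ) : Prop where
  connected : G.Connected
  adj_same : ∀ u v, κ v = κ u → u ≠ v → G.Adj u v
  adj_fst : ∀ u v, κ v = cellShift (κ u) 1 0 → u ≠ v → G.Adj u v
  adj_snd : ∀ u v, κ v = cellShift (κ u) 0 1 → u ≠ v → G.Adj u v
  short : ∀ u v, G.Adj u v → ∃ i j : ℤ, |i| ≤ 4 ∧ |j| ≤ 4 ∧ κ v = cellShift (κ u) i j
  pos : 0 < A
  few_bad : ∀ c, ∀ T : Finset (ℤ × ℤ), (∀ p ∈ T, |p.1| ≤ (4 * q : ℕ) ∧ |p.2| ≤ (4 * q : ℕ) ∧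
    ¬ A ≤ cellCount κ (cellShift c p.1 p.2)) → T.card < q

namespace GridGraph

variable {m : ℕ} {V : Type*} [Fintype V] {κ : V → ZMod m × ZMod m}
  {G : SimpleGraph V} {q : ℕ} {A : ℝ}

/-- The number of cut edges near a cell. -/
noncomputable def localCut (κ : V → ZMod m × ZMod m) (G : SimpleGraph V) (q : ℕ) (S : Finset V)
    (c : ZMod m × ZMod m) : ℝ :=
  cutCount G.Adj S fun u => InWindow (4 * q + 4) c (κ u)

lemma mem_iff_of_localCut_eq_zero (h : GridGraph κ G q A) {S : Finset V} {c : ZMod m × ZMod m}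
    (h0 : localCut κ G q S c = 0) {x y : V} (hxy : G.Adj x y) {i j : ℤ} (hi : |i| ≤ (4 * q : ℕ))
    (hj : |j| ≤ (4 * q : ℕ)) (hx : κ x = cellShift c i j) : x ∈ S ↔ y ∈ S := by
  classical
  unfold localCut cutCount at h0
  have h0 := Nat.cast_eq_zero.1 h0
  rw [Finset.card_eq_zero, Finset.filter_eq_empty_iff] at h0
  push_cast at hi hj
  rw [abs_le] at hi hj
  constructor
  · intro hxS
    by_contra hyS
    refine h0 (Finset.mem_univ (x, y)) ⟨hxS, hyS, hxy, i, j, ?_, ?_, hx⟩ <;>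
      (push_cast; rw [abs_le]; constructor <;> omega)
  · intro hyS
    by_contra hxS
    obtain ⟨a, b, ha, hb, hab⟩ := h.short x y hxy
    rw [hx, cellShift_cellShift] at hab
    rw [abs_le] at ha hb
    refine h0 (Finset.mem_univ (y, x)) ⟨hyS, hxS, hxy.symm, i + a, j + b, ?_, ?_, hab⟩ <;>
      (push_cast; rw [abs_le]; constructor <;> omega)

/-- The cell frequencies along a line of good cells differ little. -/
lemma abs_cellFrac_line_le (h : GridGraph κ G q A) (S : Finset V) (c : ZMod m × ZMod m)
    (γ : ℤ → ZMod m × ZMod m)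
    (hγ : ∀ s u v, κ u = γ s → κ v = γ (s + 1) → u ≠ v → G.Adj u v)
    (hin : ∀ s : ℤ, |s| ≤ (4 * q : ℕ) → InWindow (4 * q + 4) c (γ s))
    (hgood : ∀ s : ℤ, |s| ≤ (4 * q : ℕ) → A ≤ cellCount κ (γ s))
    {s t : ℤ} (hs : |s| ≤ (4 * q : ℕ)) (ht : |t| ≤ (4 * q : ℕ)) :
    |cellFrac κ S (γ s) - cellFrac κ S (γ t)| * A ^ 2 ≤ (8 * q : ℕ) * localCut κ G q S c := by
  have hD : 0 ≤ localCut κ G q S c := cutCount_nonneg _ _ _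
  wlog hst : s ≤ t generalizing s t
  · rw [abs_sub_comm]
    exact this ht hs (by omega)
  have step : ∀ n : ℕ, |s + n| ≤ (4 * q : ℕ) →
      |cellFrac κ S (γ s) - cellFrac κ S (γ (s + n))| * A ^ 2 ≤ n * localCut κ G q S c := by
    intro n
    induction n with
    | zero => intro; simp
    | succ n ih =>
      intro hn
      have hn' : |s + n| ≤ (4 * q : ℕ) := by
        rw [abs_le] at hs hn ⊢; push_cast at hn hs ⊢; constructor <;> omega
      have h1 := ih hn'
      have e : s + ((n + 1 : ℕ) : ℤ) = s + n + 1 := by push_cast; ring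
      rw [e] at hn ⊢
      have h2 := abs_cellFrac_sub_le_cutCount κ (R := G.Adj) (S := S) (fun _ _ hh => hh.symm)
        (hγ (s + n)) h.pos.le (hgood _ hn') (hgood _ hn)
        (P := fun u => InWindow (4 * q + 4) c (κ u)) (fun u hu => hu ▸ hin _ hn')
        (fun u hu => hu ▸ hin _ hn)
      have h3 := abs_sub_le (cellFrac κ S (γ s)) (cellFrac κ S (γ (s + n)))
        (cellFrac κ S (γ (s + n + 1)))
      have h4 := mul_le_mul_of_nonneg_right h3 (sq_nonneg A)
      push_cast
      unfold localCut at h1 ⊢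
      linarith
  obtain ⟨n, rfl⟩ := Int.le.dest hst
  refine (step n ht).trans ?_
  gcongr
  rw [abs_le] at hs ht
  push_cast at hs ht
  omega

end GridGraph

namespace GridGraph

variable {m : ℕ} {V : Type*} [Fintype V] {κ : V → ZMod m × ZMod m}
  {G : SimpleGraph V} {q : ℕ} {A : ℝ}

/-- All cells of the row with offset `t` in the window around `c` are good. -/
def GoodRow (κ : V → ZMod m × ZMod m) (q : ℕ) (A : ℝ) (c : ZMod m × ZMod m) (t : ℤ) : Prop :=
  ∀ i : ℤ, |i| ≤ (4 * q : ℕ) → A ≤ cellCount κ (cellShift c i t)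

/-- All cells of the column with offset `t` in the window around `c` are good. -/
def GoodColumn (κ : V → ZMod m × ZMod m) (q : ℕ) (A : ℝ) (c : ZMod m × ZMod m) (t : ℤ) : Prop :=
  ∀ j : ℤ, |j| ≤ (4 * q : ℕ) → A ≤ cellCount κ (cellShift c t j)

lemma row_le (h : GridGraph κ G q A) (S : Finset V) {c : ZMod m × ZMod m} {t : ℤ}
    (hrow : GoodRow κ q A c t) (ht : |t| ≤ (4 * q : ℕ))
    {i i' : ℤ} (hi : |i| ≤ (4 * q : ℕ)) (hi' : |i'| ≤ (4 * q : ℕ)) :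
    |cellFrac κ S (cellShift c i t) - cellFrac κ S (cellShift c i' t)| * A ^ 2 ≤
      (8 * q : ℕ) * localCut κ G q S c := by
  refine h.abs_cellFrac_line_le S c (fun s => cellShift c s t) ?_ ?_ hrow hi hi'
  · intro s u v hu hv huv
    refine h.adj_fst u v ?_ huv
    rw [hu, hv, cellShift_cellShift, add_zero]
  · intro s hs
    exact ⟨s, t, by push_cast at hs ⊢; omega, by push_cast at ht ⊢; omega, rfl⟩

lemma column_le (h : GridGraph κ G q A) (S : Finset V) {c : ZMod m × ZMod m} {t : ℤ}
    (hcol : GoodColumn κ q A c t) (ht : |t| ≤ (4 * q : ℕ))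
    {j j' : ℤ} (hj : |j| ≤ (4 * q : ℕ)) (hj' : |j'| ≤ (4 * q : ℕ)) :
    |cellFrac κ S (cellShift c t j) - cellFrac κ S (cellShift c t j')| * A ^ 2 ≤
      (8 * q : ℕ) * localCut κ G q S c := by
  refine h.abs_cellFrac_line_le S c (fun s => cellShift c t s) ?_ ?_ hcol hj hj'
  · intro s u v hu hv huv
    refine h.adj_snd u v ?_ huv
    rw [hu, hv, cellShift_cellShift, add_zero]
  · intro s hs
    exact ⟨t, s, by push_cast at ht ⊢; omega, by push_cast at hs ⊢; omega, rfl⟩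

/-- A rectangle around the cell `c` that is framed by four consecutive good rows or columns on
each side. -/
structure Frame (κ : V → ZMod m × ZMod m) (q : ℕ) (A : ℝ) (c : ZMod m × ZMod m)
    (i₁ i₂ j₁ j₂ : ℤ) : Prop where
  right_nonneg : 0 ≤ i₁
  right_le : i₁ + 4 ≤ (4 * q : ℕ)
  right : ∀ t, i₁ < t → t ≤ i₁ + 4 → GoodColumn κ q A c t
  left_nonneg : 0 ≤ i₂
  left_le : i₂ + 4 ≤ (4 * q : ℕ)
  left : ∀ t, i₂ < t → t ≤ i₂ + 4 → GoodColumn κ q A c (-t)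
  top_nonneg : 0 ≤ j₁
  top_le : j₁ + 4 ≤ (4 * q : ℕ)
  top : ∀ t, j₁ < t → t ≤ j₁ + 4 → GoodRow κ q A c t
  bottom_nonneg : 0 ≤ j₂
  bottom_le : j₂ + 4 ≤ (4 * q : ℕ)
  bottom : ∀ t, j₂ < t → t ≤ j₂ + 4 → GoodRow κ q A c (-t)

lemma exists_frame (h : GridGraph κ G q A) (c : ZMod m × ZMod m) :
    ∃ i₁ i₂ j₁ j₂, Frame κ q A c i₁ i₂ j₁ j₂ := by
  let P : ℤ → ℤ → Prop := fun i j => A ≤ cellCount κ (cellShift c i j)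
  obtain ⟨i₁, a1, a2, a3⟩ := exists_good_columns (P := P) (h.few_bad c) (Or.inl rfl)
  obtain ⟨i₂, b1, b2, b3⟩ := exists_good_columns (P := P) (h.few_bad c) (Or.inr rfl)
  obtain ⟨j₁, c1, c2, c3⟩ := exists_good_rows (P := P) (h.few_bad c) (Or.inl rfl)
  obtain ⟨j₂, d1, d2, d3⟩ := exists_good_rows (P := P) (h.few_bad c) (Or.inr rfl)
  simp only [one_mul, neg_mul] at a3 b3 c3 d3
  exact ⟨i₁, i₂, j₁, j₂, a1, a2, a3, b1, b2, b3, c1, c2, c3, d1, d2, d3⟩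

/-- The representative of a framed cell: the crossing of a good column and a good row. -/
def corner (c : ZMod m × ZMod m) (i₁ j₁ : ℤ) : ZMod m × ZMod m := cellShift c (i₁ + 1) (j₁ + 1)

lemma good_corner {c : ZMod m × ZMod m} {i₁ i₂ j₁ j₂ : ℤ} (hf : Frame κ q A c i₁ i₂ j₁ j₂) :
    A ≤ cellCount κ (corner c i₁ j₁) := by
  have h1 := hf.right_nonneg
  have h2 := hf.right_le
  exact hf.top (j₁ + 1) (by omega) (by omega) _ (by rw [abs_le]; constructor <;> omega)

/-- Follow the good row through the corner of `c` to the good column through the corner of `c'`, and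
then that column. The column has offset `i₁' + 1` seen from `c'` and `i₁' + 2` seen from `c`; four
good lines leave room for this inside the window. -/
lemma corner_sub_corner_fst (h : GridGraph κ G q A) (S : Finset V) {c c' : ZMod m × ZMod m}
    {i₁ i₂ j₁ j₂ i₁' i₂' j₁' j₂' : ℤ} (hf : Frame κ q A c i₁ i₂ j₁ j₂)
    (hf' : Frame κ q A c' i₁' i₂' j₁' j₂') (hc : c' = cellShift c 1 0) :
    |cellFrac κ S (corner c' i₁' j₁') - cellFrac κ S (corner c i₁ j₁)| * A ^ 2 ≤
      (8 * q : ℕ) * (localCut κ G q S c + localCut κ G q S c') := by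
  have a1 := hf.right_nonneg
  have a2 := hf.right_le
  have a3 := hf.top_nonneg
  have a4 := hf.top_le
  have b1 := hf'.right_nonneg
  have b2 := hf'.right_le
  have b3 := hf'.top_nonneg
  have b4 := hf'.top_le
  have h1 := h.row_le S (hf.top (j₁ + 1) (by omega) (by omega))
    (by rw [abs_le]; constructor <;> omega) (i := i₁' + 2) (i' := i₁ + 1)
    (by rw [abs_le]; constructor <;> omega) (by rw [abs_le]; constructor <;> omega)
  have h2 := h.column_le S (hf'.right (i₁' + 1) (by omega) (by omega))
    (by rw [abs_le]; constructor <;> omega) (j := j₁' + 1) (j' := j₁ + 1)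
    (by rw [abs_le]; constructor <;> omega) (by rw [abs_le]; constructor <;> omega)
  have e : cellShift c' (i₁' + 1) (j₁ + 1) = cellShift c (i₁' + 2) (j₁ + 1) := by
    rw [hc, cellShift_cellShift]; congr 1 <;> ring
  rw [e] at h2
  have h3 := abs_sub_le (cellFrac κ S (corner c' i₁' j₁'))
    (cellFrac κ S (cellShift c (i₁' + 2) (j₁ + 1))) (cellFrac κ S (corner c i₁ j₁))
  have h4 := mul_le_mul_of_nonneg_right h3 (sq_nonneg A)
  unfold corner at h4 ⊢
  linarith

lemma corner_sub_corner_snd (h : GridGraph κ G q A) (S : Finset V) {c c' : ZMod m × ZMod m}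
    {i₁ i₂ j₁ j₂ i₁' i₂' j₁' j₂' : ℤ} (hf : Frame κ q A c i₁ i₂ j₁ j₂)
    (hf' : Frame κ q A c' i₁' i₂' j₁' j₂') (hc : c' = cellShift c 0 1) :
    |cellFrac κ S (corner c' i₁' j₁') - cellFrac κ S (corner c i₁ j₁)| * A ^ 2 ≤
      (8 * q : ℕ) * (localCut κ G q S c + localCut κ G q S c') := by
  have a1 := hf.right_nonneg
  have a2 := hf.right_le
  have a3 := hf.top_nonneg
  have a4 := hf.top_le
  have b1 := hf'.right_nonneg
  have b2 := hf'.right_le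
  have b3 := hf'.top_nonneg
  have b4 := hf'.top_le
  have h1 := h.row_le S (hf.top (j₁ + 1) (by omega) (by omega))
    (by rw [abs_le]; constructor <;> omega) (i := i₁' + 1) (i' := i₁ + 1)
    (by rw [abs_le]; constructor <;> omega) (by rw [abs_le]; constructor <;> omega)
  have h2 := h.column_le S (hf'.right (i₁' + 1) (by omega) (by omega))
    (by rw [abs_le]; constructor <;> omega) (j := j₁' + 1) (j' := j₁)
    (by rw [abs_le]; constructor <;> omega) (by rw [abs_le]; constructor <;> omega)
  have e : cellShift c' (i₁' + 1) j₁ = cellShift c (i₁' + 1) (j₁ + 1) := by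
    rw [hc, cellShift_cellShift]; congr 1 <;> ring
  rw [e] at h2
  have h3 := abs_sub_le (cellFrac κ S (corner c' i₁' j₁'))
    (cellFrac κ S (cellShift c (i₁' + 1) (j₁ + 1))) (cellFrac κ S (corner c i₁ j₁))
  have h4 := mul_le_mul_of_nonneg_right h3 (sq_nonneg A)
  unfold corner at h4 ⊢
  linarith

lemma cellFrac_mul_one_sub_le (h : GridGraph κ G q A) (S : Finset V) {c : ZMod m × ZMod m}
    {i j : ℤ} (hi : |i| ≤ (4 * q : ℕ)) (hj : |j| ≤ (4 * q : ℕ))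
    (hgood : A ≤ cellCount κ (cellShift c i j)) :
    cellFrac κ S (cellShift c i j) * (1 - cellFrac κ S (cellShift c i j)) * A ^ 2 ≤
      localCut κ G q S c := by
  refine cellFrac_mul_le_cutCount κ (fun u v hu hv huv => h.adj_same u v (by rw [hu, hv]) huv)
    h.pos.le hgood hgood fun u hu => ?_
  exact ⟨i, j, by push_cast at hi ⊢; omega, by push_cast at hj ⊢; omega, hu⟩

/-- If there are no cut edges near a good cell, then all its nodes are on the same side. -/
lemma cellFrac_eq_of_mem (h : GridGraph κ G q A) {S : Finset V} {c : ZMod m × ZMod m}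
    (h0 : localCut κ G q S c = 0)
    {i j : ℤ} (hi : |i| ≤ (4 * q : ℕ)) (hj : |j| ≤ (4 * q : ℕ))
    (hgood : A ≤ cellCount κ (cellShift c i j)) {x : V} (hx : κ x = cellShift c i j) :
    (x ∈ S → cellFrac κ S (cellShift c i j) = 1) ∧ (x ∉ S → cellFrac κ S (cellShift c i j) = 0) := by
  classical
  have hA2 : 0 < A ^ 2 := by have := h.pos; positivity
  have h1 := h.cellFrac_mul_one_sub_le S hi hj hgood
  rw [h0] at h1
  have a0 := cellFrac_nonneg κ S (cellShift c i j)
  have a1 := cellFrac_le_one κ S (cellShift c i j)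
  have h2 : cellFrac κ S (cellShift c i j) * (1 - cellFrac κ S (cellShift c i j)) ≤ 0 := by
    by_contra! hcon
    exact absurd h1 (not_le.2 (mul_pos hcon hA2))
  have h3 : cellFrac κ S (cellShift c i j) * (1 - cellFrac κ S (cellShift c i j)) = 0 :=
    le_antisymm h2 (mul_nonneg a0 (by linarith))
  have h4 := cellFrac_mul_count κ S (cellShift c i j)
  have h5 := one_sub_cellFrac_mul_count κ S (cellShift c i j)
  constructor
  · intro hxS
    rcases mul_eq_zero.1 h3 with e | e
    · rw [e, zero_mul] at h4
      have h4 := Nat.cast_eq_zero.1 h4.symm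
      rw [Finset.card_eq_zero, Finset.filter_eq_empty_iff] at h4
      exact absurd ⟨hxS, hx⟩ (h4 (Finset.mem_univ x))
    · linarith
  · intro hxS
    rcases mul_eq_zero.1 h3 with e | e
    · exact e
    · rw [e, zero_mul] at h5
      have h5 := Nat.cast_eq_zero.1 h5.symm
      rw [Finset.card_eq_zero, Finset.filter_eq_empty_iff] at h5
      exact absurd ⟨hxS, hx⟩ (h5 (Finset.mem_univ x))

/-- If there are no cut edges near a cell, then the representative of the cell is on the same side
as the nodes of the cell. -/
lemma cellFrac_corner (h : GridGraph κ G q A) {S : Finset V} {c : ZMod m × ZMod m}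
    {i₁ i₂ j₁ j₂ : ℤ} (hf : Frame κ q A c i₁ i₂ j₁ j₂) (h0 : localCut κ G q S c = 0)
    {u w : V} (hu : κ u = c) (hw : ¬ (w ∈ S ↔ u ∈ S)) :
    (u ∈ S → cellFrac κ S (corner c i₁ j₁) = 1) ∧ (u ∉ S → cellFrac κ S (corner c i₁ j₁) = 0) := by
  have hA2 : A ^ 2 ≠ 0 := by have := h.pos; positivity
  have a1 := hf.right_nonneg
  have a2 := hf.right_le
  have a3 := hf.top_nonneg
  have a4 := hf.top_le
  have b1 := hf.left_nonneg
  have b2 := hf.left_le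
  have b3 := hf.bottom_nonneg
  have b4 := hf.bottom_le
  -- Connectivity enters here: the set of nodes inside the rectangle on the side of `u` contains `u`
  -- but not `w`, which is on the other side, so some edge leaves it.
  obtain ⟨x, y, ⟨i, j, hi1, hi2, hj1, hj2, hx, hxS⟩, hy, hxy⟩ := exists_boundary_edge h.connected
    (T := {x | ∃ i j : ℤ, -i₂ ≤ i ∧ i ≤ i₁ ∧ -j₂ ≤ j ∧ j ≤ j₁ ∧ κ x = cellShift c i j ∧
      (x ∈ S ↔ u ∈ S)}) (u := u) (w := w)
    ⟨0, 0, by omega, by omega, by omega, by omega, by rw [cellShift_zero, hu], Iff.rfl⟩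
    (fun ⟨_, _, _, _, _, _, _, h'⟩ => hw h')
  have hyS : y ∈ S ↔ u ∈ S := by
    rw [← hxS]
    exact (h.mem_iff_of_localCut_eq_zero h0 hxy (by rw [abs_le]; constructor <;> omega)
      (by rw [abs_le]; constructor <;> omega) hx).symm
  obtain ⟨a, b, ha, hb, hab⟩ := h.short x y hxy
  rw [hx, cellShift_cellShift] at hab
  rw [abs_le] at ha hb
  obtain ⟨k, hk⟩ : ∃ k, k = i + a := ⟨_, rfl⟩
  obtain ⟨l, hl⟩ : ∃ l, l = j + b := ⟨_, rfl⟩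
  rw [← hk, ← hl] at hab
  have hkabs : |k| ≤ (4 * q : ℕ) := by rw [abs_le]; constructor <;> omega
  have hlabs : |l| ≤ (4 * q : ℕ) := by rw [abs_le]; constructor <;> omega
  have hi₁ : |i₁ + 1| ≤ (4 * q : ℕ) := by rw [abs_le]; constructor <;> omega
  have hj₁ : |j₁ + 1| ≤ (4 * q : ℕ) := by rw [abs_le]; constructor <;> omega
  -- No edge is cut near `c`, so `y` is still on the side of `u` and must have left the rectangle.
  -- The edge is short, so `y` has landed in one of the good lines of the frame.
  have hout : (i₁ < k ∨ k < -i₂) ∨ (j₁ < l ∨ l < -j₂) := by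
    by_contra! hcon
    exact hy ⟨k, l, hcon.1.2, hcon.1.1, hcon.2.2, hcon.2.1, hab, hyS⟩
  have hcol := hf.right (i₁ + 1) (by omega) (by omega)
  have hrow := hf.top (j₁ + 1) (by omega) (by omega)
  have zero_of : ∀ {z z' : ℝ}, |z - z'| * A ^ 2 ≤ (8 * q : ℕ) * localCut κ G q S c → z = z' := by
    intro z z' hz
    rw [h0, mul_zero] at hz
    have := le_antisymm hz (by positivity)
    rcases mul_eq_zero.1 this with e | e
    · exact sub_eq_zero.1 (abs_eq_zero.1 e)
    · exact absurd e hA2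
  -- Along good lines the fraction is constant when `localCut` vanishes; the line of `y` meets the
  -- row or column through the corner.
  have key : A ≤ cellCount κ (cellShift c k l) ∧
      cellFrac κ S (cellShift c k l) = cellFrac κ S (corner c i₁ j₁) := by
    rcases hout with hout | hout
    · have hgc : GoodColumn κ q A c k := by
        rcases hout with hout | hout
        · exact hf.right k hout (by omega)
        · have := hf.left (-k) (by omega) (by omega)
          rwa [neg_neg] at this
      refine ⟨hgc l hlabs, ?_⟩
      exact (zero_of (h.column_le S hgc hkabs hlabs hj₁)).trans
        (zero_of (h.row_le S hrow hj₁ hkabs hi₁))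
    · have hgr : GoodRow κ q A c l := by
        rcases hout with hout | hout
        · exact hf.top l hout (by omega)
        · have := hf.bottom (-l) (by omega) (by omega)
          rwa [neg_neg] at this
      refine ⟨hgr k hkabs, ?_⟩
      exact (zero_of (h.row_le S hgr hlabs hkabs hi₁)).trans
        (zero_of (h.column_le S hcol hi₁ hlabs hj₁))
  have h6 := h.cellFrac_eq_of_mem h0 hkabs hlabs key.1 hab
  rw [key.2, hyS] at h6
  exact h6

/-- Double counting: a cut pair is seen only from cells within offset `4 q + 4` of its first node.
-/
lemma sum_localCut_le [NeZero m] (κ : V → ZMod m × ZMod m) (G : SimpleGraph V) (q : ℕ)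
    (S : Finset V) :
    ∑ c, localCut κ G q S c ≤ (2 * (4 * q + 4) + 1 : ℝ) ^ 2 * cutCount G.Adj S fun _ => True := by
  classical
  have e1 : ∀ c, localCut κ G q S c = ∑ p : V × V,
      if p.1 ∈ S ∧ p.2 ∉ S ∧ G.Adj p.1 p.2 ∧ InWindow (4 * q + 4) c (κ p.1) then (1 : ℝ) else 0 := by
    intro c
    rw [Finset.sum_boole]
    unfold localCut cutCount
    congr!
  have e2 : cutCount G.Adj S (fun _ => True) = ∑ p : V × V,
      if p.1 ∈ S ∧ p.2 ∉ S ∧ G.Adj p.1 p.2 ∧ True then (1 : ℝ) else 0 := by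
    rw [Finset.sum_boole]
    unfold cutCount
    congr!
  simp only [e1, e2]
  rw [Finset.sum_comm, Finset.mul_sum]
  refine Finset.sum_le_sum fun p _ => ?_
  by_cases hp : p.1 ∈ S ∧ p.2 ∉ S ∧ G.Adj p.1 p.2
  · simp only [hp.1, hp.2.1, hp.2.2, true_and, not_false_eq_true, if_true, mul_one]
    rw [Finset.sum_boole]
    have hsub : (Finset.univ.filter fun c => InWindow (4 * q + 4) c (κ p.1)) ⊆
        (Finset.Icc (-(4 * q + 4 : ℤ)) (4 * q + 4) ×ˢ Finset.Icc (-(4 * q + 4 : ℤ)) (4 * q + 4)).image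
          fun ij => cellShift (κ p.1) ij.1 ij.2 := by
      intro c hc
      obtain ⟨i, j, hi, hj, hc⟩ := (Finset.mem_filter.1 hc).2
      rw [abs_le] at hi hj
      push_cast at hi hj
      refine Finset.mem_image.2 ⟨(-i, -j), ?_, ?_⟩
      · rw [Finset.mem_product, Finset.mem_Icc, Finset.mem_Icc]
        refine ⟨⟨?_, ?_⟩, ?_, ?_⟩ <;> dsimp only <;> omega
      · rw [hc, cellShift_cellShift, add_neg_cancel, add_neg_cancel, cellShift_zero]
    have h1 := (Finset.card_le_card hsub).trans Finset.card_image_le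
    rw [Finset.card_product, Int.card_Icc] at h1
    have h2 : ((4 * q + 4 : ℤ) + 1 - -(4 * q + 4 : ℤ)).toNat = 2 * (4 * q + 4) + 1 := by omega
    rw [h2] at h1
    calc _ ≤ (((2 * (4 * q + 4) + 1) * (2 * (4 * q + 4) + 1) : ℕ) : ℝ) := by exact_mod_cast h1
      _ = _ := by push_cast; ring
  · rw [Finset.sum_eq_zero, if_neg (fun h => hp ⟨h.1, h.2.1, h.2.2.1⟩), mul_zero]
    intro c _
    rw [if_neg fun h => hp ⟨h.1, h.2.1, h.2.2.1⟩]

end GridGraph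

/-! ### Isoperimetric inequalities on grids -/

namespace GridGraph

variable {m : ℕ} {V : Type*} [Fintype V] {κ : V → ZMod m × ZMod m}
  {G : SimpleGraph V} {q : ℕ} {A : ℝ}

/-- Isoperimetric inequality for a connected graph on a grid with few bad cells. -/
theorem card_le_or_card_mul_le [NeZero m] (h : GridGraph κ G q A) {B : ℝ}
    (hB : ∀ c, cellCount κ c ≤ B) {S : Finset V} (hS : S.Nonempty)
    (hS2 : 2 * S.card ≤ Fintype.card V) :
    let w : ℝ := (2 * (4 * q + 4) + 1) ^ 2
    let e := cutCount G.Adj S fun _ => True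
    (S.card : ℝ) ≤ 2 * B * w * e ∨
      (S.card : ℝ) * Fintype.card V * A ^ 2 ≤ 8 * B ^ 2 * w * (1 + 32 * q) * (m : ℝ) ^ 3 * e := by
  classical
  intro w e
  choose i₁ i₂ j₁ j₂ hf using h.exists_frame
  set f : ZMod m × ZMod m → ℝ := fun c => cellFrac κ S (corner c (i₁ c) (j₁ c)) with hfdef
  set D := localCut κ G q S with hD
  have D0 : ∀ c, 0 ≤ D c := fun c => cutCount_nonneg _ _ _
  have e0 : 0 ≤ e := cutCount_nonneg _ _ _
  have w0 : 0 ≤ w := by positivity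
  have hsumD : ∑ c, D c ≤ w * e := sum_localCut_le κ G q S
  have f0 : ∀ c, 0 ≤ f c := fun c => cellFrac_nonneg _ _ _
  have f1 : ∀ c, f c ≤ 1 := fun c => cellFrac_le_one _ _ _
  have hB0 : 0 ≤ B := (cellCount_nonneg κ (0 : ZMod m × ZMod m)).trans (hB 0)
  have hm1 : (1 : ℝ) ≤ m := by exact_mod_cast NeZero.one_le
  -- Integrality of the local cut: either the representative decides the side of the whole cell, or
  -- the error term `D c` already pays for all its nodes.
  have hD1 : ∀ c, D c = 0 ∨ 1 ≤ D c := by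
    intro c
    rw [hD]
    unfold localCut cutCount
    have (n : ℕ) : (n : ℝ) = 0 ∨ 1 ≤ (n : ℝ) :=
      n.eq_zero_or_pos.imp (fun h => by simp [h]) fun h => by exact_mod_cast h
    exact this _
  obtain ⟨u₀, hu₀⟩ := hS
  obtain ⟨w₀, hw₀⟩ : ∃ w, w ∉ S := by
    by_contra! hcon
    have : S.card = Fintype.card V := by
      rw [← Finset.card_univ]; congr 1; ext v; simp [hcon v]
    have : 0 < S.card := Finset.card_pos.2 ⟨u₀, hu₀⟩
    omega
  have hw : ∀ u, ∃ w, ¬ (w ∈ S ↔ u ∈ S) := by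
    intro u
    by_cases hu : u ∈ S
    · exact ⟨w₀, by tauto⟩
    · exact ⟨u₀, by tauto⟩
  have hcellS : ∀ c, ((Finset.univ.filter fun v => v ∈ S ∧ κ v = c).card : ℝ) ≤ B * (f c + D c) := by
    intro c
    rw [← cellFrac_mul_count]
    have b1 : cellFrac κ S c * cellCount κ c ≤ 1 * B := by
      gcongr
      · exact cellCount_nonneg _ _
      · exact cellFrac_le_one _ _ _
      · exact hB c
    rcases hD1 c with hc | hc
    · by_cases hex : ∃ u, u ∈ S ∧ κ u = c
      · obtain ⟨u, huS, hu⟩ := hex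
        obtain ⟨w', hw'⟩ := hw u
        have : f c = 1 := (h.cellFrac_corner (hf c) hc hu hw').1 huS
        rw [this, hc]; linarith
      · rw [cellFrac_mul_count, Finset.filter_eq_empty_iff.2 (fun v _ hv => hex ⟨v, hv⟩)]
        have := f0 c
        have := D0 c
        simp only [Finset.card_empty, Nat.cast_zero]
        positivity
    · refine b1.trans ?_
      have := f0 c
      nlinarith
  have hcellS' : ∀ c, ((Finset.univ.filter fun v => v ∉ S ∧ κ v = c).card : ℝ) ≤
      B * (1 - f c + D c) := by
    intro c
    rw [← one_sub_cellFrac_mul_count]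
    have b0 := cellFrac_nonneg κ S c
    have b1 : (1 - cellFrac κ S c) * cellCount κ c ≤ 1 * B := by
      gcongr
      · exact cellCount_nonneg _ _
      · linarith
      · exact hB c
    rcases hD1 c with hc | hc
    · by_cases hex : ∃ u, u ∉ S ∧ κ u = c
      · obtain ⟨u, huS, hu⟩ := hex
        obtain ⟨w', hw'⟩ := hw u
        have : f c = 0 := (h.cellFrac_corner (hf c) hc hu hw').2 huS
        rw [this, hc]; linarith
      · rw [one_sub_cellFrac_mul_count, Finset.filter_eq_empty_iff.2 (fun v _ hv => hex ⟨v, hv⟩)]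
        have := f1 c
        have := D0 c
        simp only [Finset.card_empty, Nat.cast_zero]
        exact mul_nonneg hB0 (by linarith)
    · refine b1.trans ?_
      have := f1 c
      nlinarith
  have hcardZ : ∑ c : ZMod m × ZMod m, (1 : ℝ) = (m : ℝ) ^ 2 := by simp [sq]
  set F := ∑ c, f c with hF
  have hSle : (S.card : ℝ) ≤ B * (F + w * e) := by
    have := sum_filter_cell κ (fun v => v ∈ S)
    rw [Finset.filter_mem_eq_inter, Finset.univ_inter] at this
    rw [this]
    refine (Finset.sum_le_sum fun c _ => hcellS c).trans ?_
    rw [← Finset.mul_sum, Finset.sum_add_distrib]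
    gcongr
  have hSle' : (Fintype.card V : ℝ) ≤ 2 * (B * ((m : ℝ) ^ 2 - F + w * e)) := by
    have h1 := sum_filter_cell κ (fun v => v ∉ S)
    have h2 : ((Finset.univ.filter fun v => v ∉ S).card : ℝ) = Fintype.card V - S.card := by
      have : (Finset.univ.filter fun v => v ∉ S) = Sᶜ := by ext; simp
      rw [this, Finset.card_compl, Nat.cast_sub (Finset.card_le_univ S)]
    have h3 : ((2 * S.card : ℕ) : ℝ) ≤ Fintype.card V := by exact_mod_cast hS2
    have h4 : ((Finset.univ.filter fun v => v ∉ S).card : ℝ) ≤ B * ((m : ℝ) ^ 2 - F + w * e) := by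
      rw [h1]
      refine (Finset.sum_le_sum fun c _ => hcellS' c).trans ?_
      rw [← Finset.mul_sum, Finset.sum_add_distrib, Finset.sum_sub_distrib, hcardZ]
      gcongr
    push_cast at h3
    linarith
  have hS2' : 2 * (S.card : ℝ) ≤ Fintype.card V := by exact_mod_cast hS2
  have hF0 : 0 ≤ F := Finset.sum_nonneg fun c _ => f0 c
  have hF1 : F ≤ (m : ℝ) ^ 2 := by
    rw [← hcardZ]; exact Finset.sum_le_sum fun c _ => f1 c
  -- If `w e` dominates `F` or `m² - F`, the errors control `|S|` directly and the first alternative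
  -- holds. Otherwise the errors are absorbed and the Poincaré inequality applies to `F (m² - F)`.
  rcases le_total F (w * e) with hcase | hcase
  · left
    refine hSle.trans ?_
    have := mul_le_mul_of_nonneg_left hcase hB0
    linarith
  rcases le_total ((m : ℝ) ^ 2 - F) (w * e) with hcase' | hcase'
  · left
    have := mul_le_mul_of_nonneg_left hcase' hB0
    linarith
  right
  have hP := mul_le_mul_of_nonneg_right (sum_mul_compl_le_grid f f0 f1) (sq_nonneg A)
  have hE1 : (∑ c, f c * (1 - f c)) * A ^ 2 ≤ w * e := by
    rw [Finset.sum_mul]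
    refine (Finset.sum_le_sum fun c _ => ?_).trans hsumD
    have a1 := (hf c).right_nonneg
    have a2 := (hf c).right_le
    have a3 := (hf c).top_nonneg
    have a4 := (hf c).top_le
    exact h.cellFrac_mul_one_sub_le S (by rw [abs_le]; constructor <;> omega)
      (by rw [abs_le]; constructor <;> omega) (good_corner (hf c))
  have hE2 : (∑ c, (|f (c + (1, 0)) - f c| + |f (c + (0, 1)) - f c|)) * A ^ 2 ≤
      32 * q * (w * e) := by
    have hshift : ∀ d : ZMod m × ZMod m, ∑ c, D (c + d) = ∑ c, D c := fun d =>
      Equiv.sum_comp (Equiv.addRight d) D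
    rw [Finset.sum_mul]
    calc ∑ c, (|f (c + (1, 0)) - f c| + |f (c + (0, 1)) - f c|) * A ^ 2
        ≤ ∑ c, ((8 * q : ℕ) * (D c + D (c + (1, 0))) + (8 * q : ℕ) * (D c + D (c + (0, 1)))) := by
          refine Finset.sum_le_sum fun c _ => ?_
          rw [add_mul]
          refine add_le_add ?_ ?_
          · exact h.corner_sub_corner_fst S (hf c) (hf _) (by simp [cellShift])
          · exact h.corner_sub_corner_snd S (hf c) (hf _) (by simp [cellShift])
      _ = 32 * q * ∑ c, D c := by
          simp only [Finset.sum_add_distrib, ← Finset.mul_sum, hshift]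
          push_cast; ring
      _ ≤ _ := by gcongr
  have hmpow : (m : ℝ) ^ 2 ≤ (m : ℝ) ^ 3 := pow_le_pow_right₀ hm1 (by norm_num)
  have hwe : 0 ≤ w * e := mul_nonneg w0 e0
  have hE0 : 0 ≤ ∑ c, f c * (1 - f c) :=
    Finset.sum_nonneg fun c _ => mul_nonneg (f0 c) (sub_nonneg.2 (f1 c))
  have hfin : F * ((m : ℝ) ^ 2 - F) * A ^ 2 ≤ (1 + 32 * q) * (m : ℝ) ^ 3 * (w * e) := by
    calc F * ((m : ℝ) ^ 2 - F) * A ^ 2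
        ≤ (m : ℝ) ^ 2 * ((∑ c, f c * (1 - f c)) * A ^ 2) + (m : ℝ) ^ 3 *
          ((∑ c, (|f (c + (1, 0)) - f c| + |f (c + (0, 1)) - f c|)) * A ^ 2) := by
          refine hP.trans (le_of_eq ?_); ring
      _ ≤ (m : ℝ) ^ 3 * (w * e) + (m : ℝ) ^ 3 * (32 * q * (w * e)) := by gcongr
      _ = _ := by ring
  have h1 : (S.card : ℝ) ≤ 2 * B * F := by
    have := mul_le_mul_of_nonneg_left hcase hB0
    linarith
  have h2 : (Fintype.card V : ℝ) ≤ 4 * B * ((m : ℝ) ^ 2 - F) := by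
    have := mul_le_mul_of_nonneg_left hcase' hB0
    linarith
  calc (S.card : ℝ) * Fintype.card V * A ^ 2
      ≤ (2 * B * F) * (4 * B * ((m : ℝ) ^ 2 - F)) * A ^ 2 := by gcongr
    _ = 8 * B ^ 2 * (F * ((m : ℝ) ^ 2 - F) * A ^ 2) := by ring
    _ ≤ 8 * B ^ 2 * ((1 + 32 * q) * (m : ℝ) ^ 3 * (w * e)) := by gcongr
    _ = _ := by ring

end GridGraph

/-- Isoperimetric inequality for a graph on a grid whose cells all have about the same number of
nodes. -/
theorem card_mul_le_of_uniform_grid {m : ℕ} [NeZero m] {V : Type*} [Fintype V]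
    {κ : V → ZMod m × ZMod m} {R : V → V → Prop} (hsymm : ∀ u v, R u v → R v u)
    (h_same : ∀ u v, κ v = κ u → R u v) (h_fst : ∀ u v, κ v = cellShift (κ u) 1 0 → R u v)
    (h_snd : ∀ u v, κ v = cellShift (κ u) 0 1 → R u v) {A B : ℝ} (hA0 : 0 ≤ A)
    (hA : ∀ c, A ≤ cellCount κ c) (hB : ∀ c, cellCount κ c ≤ B) {S : Finset V}
    (hS2 : 2 * S.card ≤ Fintype.card V) :
    (S.card : ℝ) * Fintype.card V * A ^ 2 ≤
      10 * B ^ 2 * (m : ℝ) ^ 3 * cutCount R S fun _ => True := by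
  classical
  set e := cutCount R S fun _ => True
  -- Every cell is populated, so the fractions of the cells themselves enter the Poincaré inequality
  -- and no representatives are needed.
  set f : ZMod m × ZMod m → ℝ := cellFrac κ S
  set D : ZMod m × ZMod m → ℝ := fun c => cutCount R S fun u => κ u = c
  have e0 : 0 ≤ e := cutCount_nonneg _ _ _
  have f0 : ∀ c, 0 ≤ f c := fun c => cellFrac_nonneg _ _ _
  have f1 : ∀ c, f c ≤ 1 := fun c => cellFrac_le_one _ _ _
  have hB0 : 0 ≤ B := (cellCount_nonneg κ (0 : ZMod m × ZMod m)).trans (hB 0)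
  have hm1 : (1 : ℝ) ≤ m := by exact_mod_cast NeZero.one_le
  have hsumD : ∑ c, D c = e := by
    have := sum_filter_cell (κ ∘ Prod.fst)
      (fun p : V × V => p.1 ∈ S ∧ p.2 ∉ S ∧ R p.1 p.2 ∧ True)
    simp only [and_assoc, true_and, Function.comp_apply] at this
    unfold D e cutCount
    convert this.symm
  have hcardZ : ∑ c : ZMod m × ZMod m, (1 : ℝ) = (m : ℝ) ^ 2 := by simp [sq]
  set F := ∑ c, f c with hF
  have hF0 : 0 ≤ F := Finset.sum_nonneg fun c _ => f0 c
  have hF1 : F ≤ (m : ℝ) ^ 2 := by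
    rw [← hcardZ]; exact Finset.sum_le_sum fun c _ => f1 c
  have hSle : (S.card : ℝ) ≤ B * F := by
    have := sum_filter_cell κ (fun v => v ∈ S)
    rw [Finset.filter_mem_eq_inter, Finset.univ_inter] at this
    rw [this, hF, Finset.mul_sum]
    refine Finset.sum_le_sum fun c _ => ?_
    rw [← cellFrac_mul_count, mul_comm]
    exact mul_le_mul_of_nonneg_right (hB c) (f0 c)
  have hSle' : (Fintype.card V : ℝ) ≤ 2 * (B * ((m : ℝ) ^ 2 - F)) := by
    have h1 := sum_filter_cell κ (fun v => v ∉ S)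
    have h2 : ((Finset.univ.filter fun v => v ∉ S).card : ℝ) = Fintype.card V - S.card := by
      have : (Finset.univ.filter fun v => v ∉ S) = Sᶜ := by ext; simp
      rw [this, Finset.card_compl, Nat.cast_sub (Finset.card_le_univ S)]
    have h3 : ((2 * S.card : ℕ) : ℝ) ≤ Fintype.card V := by exact_mod_cast hS2
    have h4 : ((Finset.univ.filter fun v => v ∉ S).card : ℝ) ≤ B * ((m : ℝ) ^ 2 - F) := by
      rw [h1, hF, ← hcardZ, ← Finset.sum_sub_distrib, Finset.mul_sum]
      refine Finset.sum_le_sum fun c _ => ?_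
      rw [← one_sub_cellFrac_mul_count, mul_comm]
      exact mul_le_mul_of_nonneg_right (hB c) (sub_nonneg.2 (f1 c))
    push_cast at h3
    linarith
  have hP := mul_le_mul_of_nonneg_right (sum_mul_compl_le_grid f f0 f1) (sq_nonneg A)
  have hE1 : (∑ c, f c * (1 - f c)) * A ^ 2 ≤ e := by
    rw [Finset.sum_mul, ← hsumD]
    refine Finset.sum_le_sum fun c _ => ?_
    exact cellFrac_mul_le_cutCount κ (fun u v hu hv _ => h_same u v (by rw [hu, hv])) hA0 (hA c)
      (hA c) fun u hu => hu
  have hE2 : (∑ c, (|f (c + (1, 0)) - f c| + |f (c + (0, 1)) - f c|)) * A ^ 2 ≤ 4 * e := by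
    have hDadd : ∀ c c', (cutCount R S fun u => κ u = c ∨ κ u = c') ≤ D c + D c' := by
      intro c c'
      unfold D cutCount
      rw [← Nat.cast_add, Nat.cast_le]
      refine le_trans (Finset.card_le_card fun p hp => ?_) (Finset.card_union_le _ _)
      simp only [Finset.mem_union, Finset.mem_filter, Finset.mem_univ, true_and] at hp ⊢
      tauto
    have hshift : ∀ d : ZMod m × ZMod m, ∑ c, D (c + d) = ∑ c, D c := fun d =>
      Equiv.sum_comp (Equiv.addRight d) D
    rw [Finset.sum_mul]
    calc ∑ c, (|f (c + (1, 0)) - f c| + |f (c + (0, 1)) - f c|) * A ^ 2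
        ≤ ∑ c, ((D c + D (c + (1, 0))) + (D c + D (c + (0, 1)))) := by
          refine Finset.sum_le_sum fun c _ => ?_
          rw [add_mul]
          refine add_le_add ?_ ?_
          · rw [abs_sub_comm]
            refine (abs_cellFrac_sub_le_cutCount κ hsymm (fun u v hu hv _ => h_fst u v ?_) hA0
              (hA _) (hA _) (fun u hu => Or.inl hu) fun u hu => Or.inr hu).trans (hDadd _ _)
            rw [hu, hv]; simp [cellShift]
          · rw [abs_sub_comm]
            refine (abs_cellFrac_sub_le_cutCount κ hsymm (fun u v hu hv _ => h_snd u v ?_) hA0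
              (hA _) (hA _) (fun u hu => Or.inl hu) fun u hu => Or.inr hu).trans (hDadd _ _)
            rw [hu, hv]; simp [cellShift]
      _ = 4 * e := by
          simp only [Finset.sum_add_distrib, hshift, hsumD]
          ring
  have hmpow : (m : ℝ) ^ 2 ≤ (m : ℝ) ^ 3 := pow_le_pow_right₀ hm1 (by norm_num)
  have hE0 : 0 ≤ ∑ c, f c * (1 - f c) :=
    Finset.sum_nonneg fun c _ => mul_nonneg (f0 c) (sub_nonneg.2 (f1 c))
  have hfin : F * ((m : ℝ) ^ 2 - F) * A ^ 2 ≤ 5 * (m : ℝ) ^ 3 * e := by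
    calc F * ((m : ℝ) ^ 2 - F) * A ^ 2
        ≤ (m : ℝ) ^ 2 * ((∑ c, f c * (1 - f c)) * A ^ 2) + (m : ℝ) ^ 3 *
          ((∑ c, (|f (c + (1, 0)) - f c| + |f (c + (0, 1)) - f c|)) * A ^ 2) := by
          refine hP.trans (le_of_eq ?_); ring
      _ ≤ (m : ℝ) ^ 3 * e + (m : ℝ) ^ 3 * (4 * e) := by gcongr
      _ = _ := by ring
  calc (S.card : ℝ) * Fintype.card V * A ^ 2
      ≤ (B * F) * (2 * (B * ((m : ℝ) ^ 2 - F))) * A ^ 2 := by gcongr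
    _ = 2 * B ^ 2 * (F * ((m : ℝ) ^ 2 - F) * A ^ 2) := by ring
    _ ≤ 2 * B ^ 2 * (5 * (m : ℝ) ^ 3 * e) := by gcongr
    _ = _ := by ring

/-! ### Uniform laws on disks and the law of the move -/

section Disk

/-- The minimum with 1 accounts for squares that wrap around the torus. Disks are compared with
inscribed and circumscribed squares, which suffices up to constants. -/
lemma volume_real_square (p : Torus) {s : ℝ} (hs : 0 ≤ s) :
    (volume : Measure Torus).real {y | ‖p 0 - y 0‖ ≤ s ∧ ‖p 1 - y 1‖ ≤ s} = (min 1 (2 * s)) ^ 2 := by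
  have : {y : Torus | ‖p 0 - y 0‖ ≤ s ∧ ‖p 1 - y 1‖ ≤ s} =
      {y | y 0 ∈ Metric.closedBall (p 0) s ∧ y 1 ∈ Metric.closedBall (p 1) s} := by
    ext y
    simp [Metric.mem_closedBall, dist_eq_norm, norm_sub_rev]
  rw [Measure.real, this, volume_pair, AddCircle.volume_closedBall, AddCircle.volume_closedBall,
    ENNReal.toReal_mul, ENNReal.toReal_ofReal (by positivity), sq]

lemma measurableSet_square (p : Torus) (s : ℝ) :
    MeasurableSet {y : Torus | ‖p 0 - y 0‖ ≤ s ∧ ‖p 1 - y 1‖ ≤ s} := by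
  refine IsClosed.measurableSet ?_
  have h (k : Fin 2) : Continuous fun y : Torus => ‖p k - y k‖ := by fun_prop
  exact (isClosed_le (h 0) continuous_const).inter (isClosed_le (h 1) continuous_const)

lemma measurableSet_disk (p : Torus) (ρ : ℝ) : MeasurableSet {y | torusDist p y ≤ ρ} :=
  (isClosed_le (continuous_torusDist.comp (by fun_prop : Continuous fun y : Torus => (p, y)))
    continuous_const).measurableSet

lemma torusDist_le_of_square {p y : Torus} {ρ : ℝ} (hρ : 0 ≤ ρ)
    (h0 : ‖p 0 - y 0‖ ≤ ρ / 2) (h1 : ‖p 1 - y 1‖ ≤ ρ / 2) : torusDist p y ≤ ρ := by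
  refine (torusDist_le h0 h1).trans ?_
  rw [Real.sqrt_le_left hρ]
  nlinarith [sq_nonneg ρ]

lemma volume_real_disk_le (p : Torus) {ρ : ℝ} (hρ : 0 ≤ ρ) :
    (volume : Measure Torus).real {y | torusDist p y ≤ ρ} ≤ (min 1 (2 * ρ)) ^ 2 := by
  rw [← volume_real_square p hρ]
  exact measureReal_mono fun y hy =>
    ⟨(norm_le_torusDist_zero p y).trans hy, (norm_le_torusDist_one p y).trans hy⟩

lemma le_volume_real_disk (p : Torus) {ρ : ℝ} (hρ : 0 ≤ ρ) :
    (min 1 ρ) ^ 2 ≤ (volume : Measure Torus).real {y | torusDist p y ≤ ρ} := by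
  have := volume_real_square p (s := ρ / 2) (by positivity)
  rw [mul_div_cancel₀ _ (by norm_num : (2 : ℝ) ≠ 0)] at this
  rw [← this]
  exact measureReal_mono fun y hy => torusDist_le_of_square hρ hy.1 hy.2

lemma volume_disk_ne_zero (p : Torus) {ρ : ℝ} (hρ : 0 < ρ) :
    (volume : Measure Torus) {y | torusDist p y ≤ ρ} ≠ 0 := by
  intro h
  have := le_volume_real_disk p hρ.le
  rw [Measure.real, h, ENNReal.toReal_zero] at this
  have h2 : 0 < min 1 ρ := lt_min one_pos hρ
  have : 0 < (min 1 ρ) ^ 2 := by positivity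
  linarith

lemma isProbabilityMeasure_diskLaw {ρ : ℝ} (hρ : 0 < ρ) (p : Torus) :
    IsProbabilityMeasure (diskLaw ρ p) :=
  cond_isProbabilityMeasure (volume_disk_ne_zero p hρ)

lemma isProbabilityMeasure_move {ρ : ℝ} (hρ : 0 < ρ) {n : ℕ} (h : Fin n → Torus) :
    IsProbabilityMeasure (areaConstrainedMove ρ h) := by
  have := fun i => isProbabilityMeasure_diskLaw hρ (h i)
  unfold areaConstrainedMove
  infer_instance

lemma diskLaw_real_apply (ρ : ℝ) (p : Torus) (A : Set Torus) :
    (diskLaw ρ p).real A = (volume.real {y | torusDist p y ≤ ρ})⁻¹ *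
      volume.real ({y | torusDist p y ≤ ρ} ∩ A) := by
  unfold diskLaw
  rw [Measure.real, cond_apply (measurableSet_disk p ρ), ENNReal.toReal_mul, ENNReal.toReal_inv]
  rfl

lemma ae_diskLaw_torusDist_le (ρ : ℝ) (p : Torus) : ∀ᵐ y ∂(diskLaw ρ p), torusDist p y ≤ ρ :=
  ae_cond_mem (measurableSet_disk p ρ)

lemma diskLaw_eq_map (ρ : ℝ) (p : Torus) :
    diskLaw ρ p = (diskLaw ρ 0).map (fun u => p + u) := by
  have hpre : (fun u => p + u) ⁻¹' {y | torusDist p y ≤ ρ} = {y | torusDist 0 y ≤ ρ} := by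
    ext u
    simp [torusDist]
  ext A hA
  rw [Measure.map_apply (measurable_const_add p) hA]
  unfold diskLaw
  rw [cond_apply (measurableSet_disk p ρ), cond_apply (measurableSet_disk 0 ρ), ← hpre,
    ← Set.preimage_inter, measure_preimage_add, measure_preimage_add]

/-- The new positions are the homes plus a noise whose law does not depend on the homes; this makes
averages over the homes accessible to Fubini. -/
lemma areaConstrainedMove_eq_map {ρ : ℝ} (hρ : 0 < ρ) {n : ℕ} (h : Fin n → Torus) :
    areaConstrainedMove ρ h = (areaConstrainedMove ρ 0).map (fun u => h + u) := by
  have := fun i : Fin n => isProbabilityMeasure_diskLaw hρ ((0 : Fin n → Torus) i)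
  have h2 : ∀ i, IsProbabilityMeasure
      ((diskLaw ρ ((0 : Fin n → Torus) i)).map (fun u => h i + u)) := fun i =>
    Measure.isProbabilityMeasure_map (measurable_const_add (h i)).aemeasurable
  unfold areaConstrainedMove
  have e := Measure.pi_map_pi (μ := fun i : Fin n => diskLaw ρ ((0 : Fin n → Torus) i))
    (f := fun i u => h i + u) (fun i => (measurable_const_add (h i)).aemeasurable)
  simp only [Pi.zero_apply] at e ⊢
  simp only [← diskLaw_eq_map] at e
  exact e.symm

/-- After the move of nodes with uniform home points the positions are uniform. -/
lemma volume_le_move_apply {ρ : ℝ} (hρ : 0 < ρ) {n : ℕ} (B : Set (Fin n → Torus)) {ε : ENNReal}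
    (hε : ε ≠ 0) (hε' : ε ≠ ⊤) :
    volume {h : Fin n → Torus | ε ≤ areaConstrainedMove ρ h B} ≤ volume B / ε := by
  have hp := isProbabilityMeasure_move hρ (0 : Fin n → Torus)
  -- No measurability of `B` is assumed; its measurable hull has the same volume.
  set B' := toMeasurable volume B
  have hB' : MeasurableSet B' := measurableSet_toMeasurable _ _
  have e1 : ∀ h : Fin n → Torus, areaConstrainedMove ρ h B' =
      ∫⁻ u, B'.indicator 1 (h + u) ∂(areaConstrainedMove ρ 0) := by
    intro h
    rw [areaConstrainedMove_eq_map hρ, Measure.map_apply (measurable_const_add h) hB',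
      ← lintegral_indicator_one ((measurable_const_add h) hB')]
    rfl
  have hm : Measurable fun p : (Fin n → Torus) × (Fin n → Torus) =>
      (B'.indicator 1 (p.1 + p.2) : ENNReal) :=
    (measurable_one.indicator hB').comp measurable_add
  have hm1 : Measurable fun h : Fin n → Torus => areaConstrainedMove ρ h B' := by
    simp only [e1]
    exact hm.lintegral_prod_right'
  have e2 : ∫⁻ h : Fin n → Torus, areaConstrainedMove ρ h B' = volume B := by
    simp only [e1]
    rw [lintegral_lintegral_swap hm.aemeasurable]
    -- For each fixed noise `u` the translate `h + u` of a uniform `h` is uniform; averaging over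
    -- `u` and Markov's inequality finish the proof.
    have : ∀ u : Fin n → Torus, ∫⁻ h, (B'.indicator 1 (h + u) : ENNReal) = volume B := by
      intro u
      have : (volume : Measure (Fin n → Torus)).IsAddLeftInvariant := Measure.pi.isAddLeftInvariant _
      simp only [add_comm _ u]
      rw [lintegral_add_left_eq_self (fun h => (B'.indicator 1 h : ENNReal)),
        lintegral_indicator_one hB', measure_toMeasurable]
    simp [this]
  calc volume {h : Fin n → Torus | ε ≤ areaConstrainedMove ρ h B}
      ≤ volume {h : Fin n → Torus | ε ≤ areaConstrainedMove ρ h B'} :=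
        measure_mono fun h hh => le_trans hh (measure_mono (subset_toMeasurable _ _))
    _ ≤ (∫⁻ h : Fin n → Torus, areaConstrainedMove ρ h B') / ε :=
        meas_ge_le_lintegral_div hm1.aemeasurable hε hε'
    _ = volume B / ε := by rw [e2]

end Disk

/-! ### Contact probabilities and conductance -/

section Conductance

variable {n : ℕ}

lemma measurableSet_adj (r : ℝ) (i j : Fin n) : MeasurableSet {x | (geomGraph r x).Adj i j} := by
  have : {x : Fin n → Torus | (geomGraph r x).Adj i j} =
      {_x | i ≠ j} ∩ {x | torusDist (x i) (x j) < r} := rfl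
  rw [this]
  refine (MeasurableSet.const _).inter ?_
  exact (isOpen_lt (continuous_torusDist.comp
    (by fun_prop : Continuous fun x : Fin n → Torus => (x i, x j))) continuous_const).measurableSet

lemma ncard_neighborSet_eq (r : ℝ) (x : Fin n → Torus) (i : Fin n) :
    (((geomGraph r x).neighborSet i).ncard : ℝ) =
      ∑ k, {x | (geomGraph r x).Adj i k}.indicator (fun _ => (1 : ℝ)) x := by
  classical
  have : (geomGraph r x).neighborSet i =
      ((Finset.univ.filter fun k => (geomGraph r x).Adj i k : Finset (Fin n)) : Set (Fin n)) := by
    ext k; simp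
  rw [this, Set.ncard_coe_finset]
  simp [Set.indicator_apply, Finset.sum_boole]

lemma measurable_contactProb (r : ℝ) (i j : Fin n) :
    Measurable fun x : Fin n → Torus => contactProb r x i j := by
  unfold contactProb
  refine Measurable.ite (measurableSet_adj r i j) ?_ measurable_const
  refine measurable_const.div ?_
  simp only [ncard_neighborSet_eq]
  exact Finset.measurable_sum _ fun k _ => measurable_const.indicator (measurableSet_adj r i k)

lemma contactProb_nonneg (r : ℝ) (x : Fin n → Torus) (i j : Fin n) : 0 ≤ contactProb r x i j := by
  unfold contactProb
  split_ifs <;> positivity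

lemma sum_contactProb_le_one (r : ℝ) (x : Fin n → Torus) (i : Fin n) (T : Finset (Fin n)) :
    ∑ j ∈ T, contactProb r x i j ≤ 1 := by
  classical
  refine (Finset.sum_le_univ_sum_of_nonneg fun j => contactProb_nonneg r x i j).trans ?_
  unfold contactProb
  rw [← Finset.sum_filter, Finset.sum_const, nsmul_eq_mul]
  have : (geomGraph r x).neighborSet i =
      ((Finset.univ.filter fun k => (geomGraph r x).Adj i k : Finset (Fin n)) : Set (Fin n)) := by
    ext k; simp
  rw [this, Set.ncard_coe_finset, mul_one_div]
  exact div_self_le_one _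

/-- The flow of contacts out of the set `S`. -/
noncomputable def contactFlow (r : ℝ) (S : Finset (Fin n)) (x : Fin n → Torus) : ℝ :=
  (∑ i ∈ S, ∑ j ∈ Sᶜ, contactProb r x i j) / (S.card : ℝ)

lemma measurable_contactFlow (r : ℝ) (S : Finset (Fin n)) : Measurable (contactFlow r S) :=
  (Finset.measurable_sum _ fun i _ => Finset.measurable_sum _ fun j _ =>
    measurable_contactProb r i j).div_const _

lemma contactFlow_nonneg (r : ℝ) (S : Finset (Fin n)) (x : Fin n → Torus) :
    0 ≤ contactFlow r S x :=
  div_nonneg (Finset.sum_nonneg fun i _ => Finset.sum_nonneg fun j _ => contactProb_nonneg r x i j)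
    (Nat.cast_nonneg _)

lemma contactFlow_le_one (r : ℝ) (S : Finset (Fin n)) (x : Fin n → Torus) :
    contactFlow r S x ≤ 1 := by
  refine div_le_one_of_le₀ ?_ (Nat.cast_nonneg _)
  refine (Finset.sum_le_sum fun i _ => sum_contactProb_le_one r x i _).trans ?_
  simp

lemma integrable_contactFlow (r : ℝ) (S : Finset (Fin n)) (ν : Measure (Fin n → Torus))
    [IsProbabilityMeasure ν] : Integrable (contactFlow r S) ν :=
  Integrable.of_bound (measurable_contactFlow r S).aestronglyMeasurable 1
    (Eventually.of_forall fun x => by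
      rw [Real.norm_of_nonneg (contactFlow_nonneg r S x)]; exact contactFlow_le_one r S x)

lemma mobileConductance_le (r : ℝ) (ν : Measure (Fin n → Torus)) {S : Finset (Fin n)}
    (hS : S.Nonempty) (hS2 : 2 * S.card ≤ n) : mobileConductance r ν ≤ ∫ x, contactFlow r S x ∂ν :=
  ciInf_le (Set.finite_range _).bddBelow
    (⟨S, hS, hS2⟩ : {S : Finset (Fin n) // S.Nonempty ∧ 2 * S.card ≤ n})

lemma le_mobileConductance (hn : 2 ≤ n) (r : ℝ) (ν : Measure (Fin n → Torus)) {t : ℝ}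
    (h : ∀ S : Finset (Fin n), S.Nonempty → 2 * S.card ≤ n → t ≤ ∫ x, contactFlow r S x ∂ν) :
    t ≤ mobileConductance r ν := by
  -- A singleton is admissible once `n ≥ 2`, so the infimum is not the default value over an empty
  -- family.
  have : Nonempty {S : Finset (Fin n) // S.Nonempty ∧ 2 * S.card ≤ n} :=
    ⟨⟨{⟨0, by omega⟩}, by simp, by simpa using hn⟩⟩
  exact le_ciInf fun S => h S.1 S.2.1 S.2.2

lemma mul_le_integral_of_le_off {Ω : Type*} [MeasurableSpace Ω] (ν : Measure Ω)
    [IsProbabilityMeasure ν] {g : Ω → ℝ} (hg : Integrable g ν) (hg0 : ∀ x, 0 ≤ g x) {B : Set Ω}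
    {t : ℝ} (ht : ∀ x ∉ B, t ≤ g x) : t * (1 - ν.real B) ≤ ∫ x, g x ∂ν := by
  set B' := toMeasurable ν B
  have hB' : MeasurableSet B' := measurableSet_toMeasurable _ _
  have e : ν.real B = ν.real B' := by
    rw [Measure.real, Measure.real, measure_toMeasurable]
  have h1 : ∫ x, B'ᶜ.indicator (fun _ => t) x ∂ν ≤ ∫ x, g x ∂ν := by
    refine integral_mono ((integrable_const t).indicator hB'.compl) hg fun x => ?_
    by_cases hx : x ∈ B'
    · simpa [hx] using hg0 x
    · simpa [hx] using ht x fun h => hx (subset_toMeasurable _ _ h)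
  rw [integral_indicator_const _ hB'.compl, probReal_compl_eq_one_sub hB', smul_eq_mul] at h1
  rw [e, mul_comm]
  exact h1

end Conductance

instance isProbabilityMeasure_torus : IsProbabilityMeasure (volume : Measure Torus) :=
  ⟨by simpa using volume_pair Set.univ Set.univ⟩

instance isProbabilityMeasure_pi_torus (n : ℕ) :
    IsProbabilityMeasure (volume : Measure (Fin n → Torus)) :=
  inferInstanceAs (IsProbabilityMeasure (Measure.pi fun _ => volume))

/-! ### The geometric graph seen on the grid -/

section StaticGraph

variable {n m : ℕ}

lemma cellCount_torusCell (x : Fin n → Torus) (c : ZMod m × ZMod m) :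
    cellCount (fun i => torusCell m (x i)) c = countIn x {y | torusCell m y = c} := by
  classical
  unfold cellCount countIn
  congr!

lemma torusCell_eq_cellShift {x y : Torus} {i j : ℤ} :
    torusCell m y = cellShift (torusCell m x) i j ↔
      circleCell m (y 0) = circleCell m (x 0) + i ∧ circleCell m (y 1) = circleCell m (x 1) + j := by
  simp [torusCell, cellShift, Prod.ext_iff]

lemma norm_sub_le_of_torusCell (hm : 0 < m) {x y : Torus} {i j : ℤ}
    (h : torusCell m y = cellShift (torusCell m x) i j) (hi : |i| ≤ 1) (hj : |j| ≤ 1) :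
    ‖x 0 - y 0‖ ≤ 2 / m ∧ ‖x 1 - y 1‖ ≤ 2 / m := by
  rw [torusCell_eq_cellShift] at h
  have hi' : ((|i| : ℤ) : ℝ) ≤ 1 := by exact_mod_cast hi
  have hj' : ((|j| : ℤ) : ℝ) ≤ 1 := by exact_mod_cast hj
  refine ⟨(norm_sub_le_of_circleCell hm h.1).trans ?_, (norm_sub_le_of_circleCell hm h.2).trans ?_⟩
  · gcongr; linarith
  · gcongr; linarith

/-- Points in equal or side-sharing cells differ by at most `2 / m` in one coordinate and `1 / m` in
the other, and `√5 < 3`. -/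
lemma torusDist_lt_of_torusCell (hm : 0 < m) {r : ℝ} (hr : 3 / m ≤ r) {x y : Torus} {i j : ℤ}
    (h : torusCell m y = cellShift (torusCell m x) i j) (hij : |i| + |j| ≤ 1) :
    torusDist x y < r := by
  rw [torusCell_eq_cellShift] at h
  have hm' : (0 : ℝ) < m := by exact_mod_cast hm
  have h1 := norm_sub_le_of_circleCell hm h.1
  have h2 := norm_sub_le_of_circleCell hm h.2
  refine lt_of_lt_of_le (lt_of_le_of_lt (torusDist_le h1 h2) ?_) hr
  rw [Real.sqrt_lt' (by positivity), div_pow, div_pow, div_pow, ← add_div]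
  gcongr
  have a1 : (0 : ℝ) ≤ ((|i| : ℤ) : ℝ) := by exact_mod_cast abs_nonneg i
  have a2 : (0 : ℝ) ≤ ((|j| : ℤ) : ℝ) := by exact_mod_cast abs_nonneg j
  have a3 : ((|i| : ℤ) : ℝ) + ((|j| : ℤ) : ℝ) ≤ 1 := by exact_mod_cast hij
  nlinarith

lemma exists_cellShift_of_adj (hm : 0 < m) {r : ℝ} (hr : r ≤ 4 / m) {x : Fin n → Torus} {u v : Fin n}
    (h : (geomGraph r x).Adj u v) : ∃ i j : ℤ, |i| ≤ 4 ∧ |j| ≤ 4 ∧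
      torusCell m (x v) = cellShift (torusCell m (x u)) i j := by
  have hd : torusDist (x u) (x v) < r := h.2
  obtain ⟨i, hi, hi'⟩ := exists_circleCell_eq_add hm (k := 4) (x := x u 0) (y := x v 0)
    (lt_of_le_of_lt (norm_le_torusDist_zero _ _) (hd.trans_le (by exact_mod_cast hr)))
  obtain ⟨j, hj, hj'⟩ := exists_circleCell_eq_add hm (k := 4) (x := x u 1) (y := x v 1)
    (lt_of_le_of_lt (norm_le_torusDist_one _ _) (hd.trans_le (by exact_mod_cast hr)))
  exact ⟨i, j, by exact_mod_cast hi, by exact_mod_cast hj, torusCell_eq_cellShift.2 ⟨hi', hj'⟩⟩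

lemma gridGraph_geomGraph (hm : 0 < m) {r : ℝ} (hr3 : 3 / m ≤ r) (hr4 : r ≤ 4 / m)
    {x : Fin n → Torus} (hx : (geomGraph r x).Connected) {q : ℕ} {A : ℝ} (hA : 0 < A)
    (hbad : ∀ c : ZMod m × ZMod m, ∀ T : Finset (ℤ × ℤ),
      (∀ p ∈ T, |p.1| ≤ (4 * q : ℕ) ∧ |p.2| ≤ (4 * q : ℕ) ∧
        ¬ A ≤ cellCount (fun i => torusCell m (x i)) (cellShift c p.1 p.2)) → T.card < q) :
    GridGraph (fun i => torusCell m (x i)) (geomGraph r x) q A where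
  connected := hx
  adj_same u v h huv := ⟨huv, torusDist_lt_of_torusCell hm hr3 (i := 0) (j := 0)
    (by rw [cellShift_zero]; exact h) (by simp)⟩
  adj_fst u v h huv := ⟨huv, torusDist_lt_of_torusCell hm hr3 h (by simp)⟩
  adj_snd u v h huv := ⟨huv, torusDist_lt_of_torusCell hm hr3 h (by simp)⟩
  short u v h := exists_cellShift_of_adj hm hr4 h
  pos := hA
  few_bad := hbad

/-- All neighbours lie in the `9 × 9` block of cells around the node. -/
lemma ncard_neighborSet_le (hm : 0 < m) {r : ℝ} (hr : r ≤ 4 / m) {x : Fin n → Torus} {B : ℝ}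
    (hB : ∀ c : ZMod m × ZMod m, cellCount (fun i => torusCell m (x i)) c ≤ B) (i : Fin n) :
    (((geomGraph r x).neighborSet i).ncard : ℝ) ≤ 81 * B := by
  classical
  set N : Finset (Fin n) := Finset.univ.filter fun k => (geomGraph r x).Adj i k
  have hN : (geomGraph r x).neighborSet i = (N : Set (Fin n)) := by ext k; simp [N]
  rw [hN, Set.ncard_coe_finset]
  obtain ⟨I, hI⟩ : ∃ I : Finset (ℤ × ℤ), I = Finset.Icc (-4) 4 ×ˢ Finset.Icc (-4) 4 := ⟨_, rfl⟩
  have hsub : N ⊆ I.biUnion fun p => Finset.univ.filter fun k =>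
      torusCell m (x k) = cellShift (torusCell m (x i)) p.1 p.2 := by
    intro k hk
    obtain ⟨a, b, ha, hb, hab⟩ := exists_cellShift_of_adj hm hr (Finset.mem_filter.1 hk).2
    refine Finset.mem_biUnion.2 ⟨(a, b), ?_, Finset.mem_filter.2 ⟨Finset.mem_univ _, hab⟩⟩
    rw [abs_le] at ha hb
    rw [hI]
    exact Finset.mem_product.2 ⟨Finset.mem_Icc.2 ha, Finset.mem_Icc.2 hb⟩
  have h1 : (N.card : ℝ) ≤ ∑ p ∈ I, ((Finset.univ.filter fun k =>
      torusCell m (x k) = cellShift (torusCell m (x i)) p.1 p.2).card : ℝ) := by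
    exact_mod_cast (Finset.card_le_card hsub).trans Finset.card_biUnion_le
  refine h1.trans ((Finset.sum_le_card_nsmul I _ B fun p _ => ?_).trans ?_)
  · refine le_trans (le_of_eq ?_) (hB (cellShift (torusCell m (x i)) p.1 p.2))
    unfold cellCount
    congr!
  · rw [nsmul_eq_mul]
    have : I.card = 81 := by rw [hI, Finset.card_product, Int.card_Icc]; rfl
    rw [this]; norm_num

/-- The flow of contacts is at least the number of cut edges divided by the maximal degree. -/
lemma cutCount_div_le_contactFlow {r : ℝ} {x : Fin n → Torus} {d : ℝ}
    (hdeg : ∀ i, (((geomGraph r x).neighborSet i).ncard : ℝ) ≤ d) (S : Finset (Fin n)) :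
    (cutCount (geomGraph r x).Adj S fun _ => True) / (d * S.card) ≤ contactFlow r S x := by
  classical
  unfold contactFlow
  rw [← div_div]
  gcongr
  have e : (cutCount (geomGraph r x).Adj S fun _ => True) =
      ∑ i ∈ S, ∑ j ∈ Sᶜ, if (geomGraph r x).Adj i j then (1 : ℝ) else 0 := by
    rw [← Finset.sum_product', Finset.sum_boole]
    unfold cutCount
    congr 2
    ext p
    simp
    tauto
  rw [e, Finset.sum_div]
  refine Finset.sum_le_sum fun i _ => ?_
  rw [Finset.sum_div]
  refine Finset.sum_le_sum fun j _ => ?_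
  unfold contactProb
  split_ifs with h
  · have h1 : 0 < ((geomGraph r x).neighborSet i).ncard :=
      (Set.ncard_pos (Set.toFinite _)).2 ⟨j, h⟩
    have h2 : (0 : ℝ) < ((geomGraph r x).neighborSet i).ncard := by exact_mod_cast h1
    exact one_div_le_one_div_of_le h2 (hdeg i)
  · simp

end StaticGraph

/-- A window that does not wrap around the torus: `q` bad offsets are then `q` different cells, as
the concentration estimate requires. -/
lemma cellShift_injOn {m q : ℕ} (hq : 8 * q < m) (c : ZMod m × ZMod m) :
    Set.InjOn (fun p : ℤ × ℤ => cellShift c p.1 p.2)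
      {p | |p.1| ≤ (4 * q : ℕ) ∧ |p.2| ≤ (4 * q : ℕ)} := by
  have key : ∀ a b : ℤ, |a| ≤ (4 * q : ℕ) → |b| ≤ (4 * q : ℕ) → (a : ZMod m) = b → a = b := by
    intro a b ha hb hab
    rw [ZMod.intCast_eq_intCast_iff_dvd_sub] at hab
    rw [abs_le] at ha hb
    have := Int.eq_zero_of_abs_lt_dvd hab (by rw [abs_lt]; constructor <;> omega)
    omega
  intro p hp p' hp' h
  simp only [cellShift, add_right_inj, Prod.mk.injEq] at h
  exact Prod.ext (key _ _ hp.1 hp'.1 h.1) (key _ _ hp.2 hp'.2 h.2)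

lemma countIn_mem_torusCell {n m : ℕ} (x : Fin n → Torus) (T : Finset (ZMod m × ZMod m)) :
    (countIn x {y | torusCell m y ∈ T} : ℝ) =
      ∑ c ∈ T, cellCount (fun i => torusCell m (x i)) c := by
  classical
  unfold countIn cellCount
  rw [← Nat.cast_sum, Nat.cast_inj, ← Finset.card_biUnion]
  · congr 1; ext i; simp
  · intro c _ d _ hcd
    refine Finset.disjoint_filter.2 ?_
    intro i _ h1 h2
    exact hcd (h1.symm.trans h2)

/-! ### Concentration of the cell counts -/

section CellConcentration

variable {n m : ℕ} [NeZero m]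

lemma volume_real_torusCell (c : ZMod m × ZMod m) :
    (volume : Measure Torus).real {y | torusCell m y = c} = 1 / (m : ℝ) ^ 2 := by
  rw [Measure.real, volume_torusCell]; simp

lemma volume_exists_le_cellCount (B : ℝ) :
    (volume : Measure (Fin n → Torus))
      {x | ∃ c : ZMod m × ZMod m, B ≤ cellCount (fun i => torusCell m (x i)) c} ≤
      ENNReal.ofReal ((m : ℝ) ^ 2 * Real.exp (7 / 4 * (n / (m : ℝ) ^ 2) - B)) := by
  have e : {x : Fin n → Torus | ∃ c : ZMod m × ZMod m, B ≤ cellCount (fun i => torusCell m (x i)) c} =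
      ⋃ c : ZMod m × ZMod m, {x | B ≤ countIn x {y | torusCell m y = c}} := by
    ext x; simp [cellCount_torusCell]
  rw [e]
  refine (measure_iUnion_fintype_le _ _).trans ?_
  refine (Finset.sum_le_sum fun c _ => measure_le_countIn volume n (measurableSet_torusCell m c)
    (volume_real_torusCell c).le B).trans ?_
  rw [Finset.sum_const, nsmul_eq_mul, ENNReal.ofReal_mul (by positivity)]
  refine le_of_eq ?_
  congr 2
  · simp [ZMod.card, sq, ENNReal.ofReal_mul]
  · rw [mul_one_div]

lemma volume_exists_cellCount_le (A : ℝ) :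
    (volume : Measure (Fin n → Torus))
      {x | ∃ c : ZMod m × ZMod m, cellCount (fun i => torusCell m (x i)) c ≤ A} ≤
      ENNReal.ofReal ((m : ℝ) ^ 2 * Real.exp (A - 3 / 5 * (n / (m : ℝ) ^ 2))) := by
  have e : {x : Fin n → Torus | ∃ c : ZMod m × ZMod m, cellCount (fun i => torusCell m (x i)) c ≤ A} =
      ⋃ c : ZMod m × ZMod m, {x | countIn x {y | torusCell m y = c} ≤ A} := by
    ext x; simp [cellCount_torusCell]
  rw [e]
  refine (measure_iUnion_fintype_le _ _).trans ?_
  refine (Finset.sum_le_sum fun c _ => measure_countIn_le volume n (measurableSet_torusCell m c)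
    (volume_real_torusCell c).ge A).trans ?_
  rw [Finset.sum_const, nsmul_eq_mul, ENNReal.ofReal_mul (by positivity)]
  refine le_of_eq ?_
  congr 2
  · simp [ZMod.card, sq, ENNReal.ofReal_mul]
  · rw [mul_one_div]

/-- It is unlikely that a window contains `q` cells with few points. -/
lemma volume_exists_bad_window {q : ℕ} (hq : 8 * q < m) (A : ℝ) :
    (volume : Measure (Fin n → Torus))
      {x | ¬ ∀ c : ZMod m × ZMod m, ∀ T : Finset (ℤ × ℤ),
        (∀ p ∈ T, |p.1| ≤ (4 * q : ℕ) ∧ |p.2| ≤ (4 * q : ℕ) ∧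
          ¬ A ≤ cellCount (fun i => torusCell m (x i)) (cellShift c p.1 p.2)) → T.card < q} ≤
      ENNReal.ofReal ((m : ℝ) ^ 2 * (2 : ℝ) ^ ((8 * q + 1) * (8 * q + 1)) *
        Real.exp (q * A - 3 / 5 * (q * (n / (m : ℝ) ^ 2)))) := by
  classical
  set I : Finset (ℤ × ℤ) := Finset.Icc (-(4 * q : ℤ)) (4 * q) ×ˢ Finset.Icc (-(4 * q : ℤ)) (4 * q)
  set J : Finset (Finset (ℤ × ℤ)) := I.powerset.filter fun T => T.card = q
  set U : ZMod m × ZMod m → Finset (ℤ × ℤ) → Finset (ZMod m × ZMod m) := fun c T =>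
    T.image fun p => cellShift c p.1 p.2
  have hI : ∀ p : ℤ × ℤ, p ∈ I ↔ |p.1| ≤ (4 * q : ℕ) ∧ |p.2| ≤ (4 * q : ℕ) := by
    intro p
    simp only [I, Finset.mem_product, Finset.mem_Icc, abs_le]
    push_cast
    rfl
  have hU : ∀ c, ∀ T ∈ J, (U c T).card = q := by
    intro c T hT
    obtain ⟨h1, h2⟩ := Finset.mem_filter.1 hT
    rw [← h2]
    refine Finset.card_image_of_injOn fun p hp p' hp' h => ?_
    exact cellShift_injOn hq c ((hI p).1 (Finset.mem_powerset.1 h1 hp))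
      ((hI p').1 (Finset.mem_powerset.1 h1 hp')) h
  have hJ : (J.card : ℝ) ≤ 2 ^ ((8 * q + 1) * (8 * q + 1)) := by
    have h1 : J.card ≤ 2 ^ I.card := by
      rw [← Finset.card_powerset]; exact Finset.card_filter_le _ _
    have h2 : I.card = (8 * q + 1) * (8 * q + 1) := by
      simp only [I]
      rw [Finset.card_product, Int.card_Icc]
      congr 1 <;> omega
    rw [h2] at h1
    exact_mod_cast h1
  -- The `q` sparse cells form one region of measure `q / m²` with at most `q A` points. A single
  -- Chernoff bound for the region gains the factor `q` in the exponent, which one sparse cell would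
  -- not give.
  have hsub : {x : Fin n → Torus | ¬ ∀ c : ZMod m × ZMod m, ∀ T : Finset (ℤ × ℤ),
        (∀ p ∈ T, |p.1| ≤ (4 * q : ℕ) ∧ |p.2| ≤ (4 * q : ℕ) ∧
          ¬ A ≤ cellCount (fun i => torusCell m (x i)) (cellShift c p.1 p.2)) → T.card < q} ⊆
      ⋃ c : ZMod m × ZMod m, ⋃ T ∈ J, {x | countIn x {y | torusCell m y ∈ U c T} ≤ q * A} := by
    intro x hx
    simp only [Set.mem_ofPred_eq, not_forall] at hx
    obtain ⟨c, T, hT, hqT⟩ := hx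
    obtain ⟨T', hT', hcard⟩ := Finset.exists_subset_card_eq (not_lt.1 hqT)
    have hJT : T' ∈ J := by
      refine Finset.mem_filter.2 ⟨Finset.mem_powerset.2 fun p hp => ?_, hcard⟩
      have := hT p (hT' hp)
      exact (hI p).2 ⟨this.1, this.2.1⟩
    refine Set.mem_iUnion.2 ⟨c, Set.mem_iUnion₂.2 ⟨T', hJT, ?_⟩⟩
    rw [Set.mem_ofPred_eq, countIn_mem_torusCell]
    have : ∑ d ∈ U c T', cellCount (fun i => torusCell m (x i)) d ≤ (U c T').card • A := by
      refine Finset.sum_le_card_nsmul _ _ _ fun d hd => ?_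
      obtain ⟨p, hp, rfl⟩ := Finset.mem_image.1 hd
      exact (not_le.1 (hT p (hT' hp)).2.2).le
    rwa [hU c T' hJT, nsmul_eq_mul] at this
  refine (measure_mono hsub).trans ((measure_iUnion_fintype_le _ _).trans ?_)
  have hone : ∀ c, (volume : Measure (Fin n → Torus))
      (⋃ T ∈ J, {x | countIn x {y | torusCell m y ∈ U c T} ≤ q * A}) ≤
      ENNReal.ofReal ((2 : ℝ) ^ ((8 * q + 1) * (8 * q + 1)) *
        Real.exp (q * A - 3 / 5 * (q * (n / (m : ℝ) ^ 2)))) := by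
    intro c
    refine (measure_biUnion_finset_le _ _).trans ?_
    have hT : ∀ T ∈ J, (volume : Measure (Fin n → Torus))
        {x | countIn x {y | torusCell m y ∈ U c T} ≤ q * A} ≤
        ENNReal.ofReal (Real.exp (q * A - 3 / 5 * (q * (n / (m : ℝ) ^ 2)))) := by
      intro T hT
      have := measure_countIn_le volume n (measurableSet_torusCell_mem m (U c T))
        (volume_real_biUnion_torusCell m (U c T)).ge (q * A)
      rw [hU c T hT] at this
      have e : (n : ℝ) * (q / (m : ℝ) ^ 2) = q * (n / (m : ℝ) ^ 2) := by ring
      rwa [e] at this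
    refine (Finset.sum_le_sum hT).trans ?_
    rw [Finset.sum_const, nsmul_eq_mul, ENNReal.ofReal_mul (by positivity)]
    gcongr
    rw [← ENNReal.ofReal_natCast]
    exact ENNReal.ofReal_le_ofReal hJ
  refine (Finset.sum_le_sum fun c _ => hone c).trans ?_
  rw [Finset.sum_const, nsmul_eq_mul, mul_assoc, ENNReal.ofReal_mul (by positivity : 0 ≤ (m : ℝ) ^ 2)]
  refine le_of_eq ?_
  congr 1
  simp [ZMod.card, sq, ENNReal.ofReal_mul]

end CellConcentration

/-! ### Asymptotics at range `√(log n / n)` and the lower bound by the range -/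

section Asymptotic

lemma tendsto_log_natCast : Tendsto (fun n : ℕ => Real.log n) atTop atTop :=
  Real.tendsto_log_atTop.comp tendsto_natCast_atTop_atTop

lemma eventually_mul_log_pow_le (K : ℝ) (k : ℕ) : ∀ᶠ n : ℕ in atTop, K * Real.log n ^ k ≤ n := by
  have h := (Real.isLittleO_pow_log_id_atTop (n := k)).comp_tendsto tendsto_natCast_atTop_atTop
  have h2 := h.def (c := (|K| + 1)⁻¹) (by positivity)
  filter_upwards [h2, tendsto_log_natCast.eventually_ge_atTop 0] with n hn h0
  simp only [Function.comp_apply, id, Real.norm_eq_abs, Nat.abs_cast] at hn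
  rw [abs_of_nonneg (by positivity), ← div_eq_inv_mul, le_div_iff₀ (by positivity)] at hn
  have := le_abs_self K
  have h3 : 0 ≤ Real.log n ^ k := by positivity
  nlinarith

lemma tendsto_ofReal_mul_exp_neg_mul_log (K : ℝ) {a : ℝ} (ha : 0 < a) :
    Tendsto (fun n : ℕ => ENNReal.ofReal (K * Real.exp (-(a * Real.log n)))) atTop (𝓝 0) := by
  rw [← ENNReal.ofReal_zero]
  refine ENNReal.tendsto_ofReal ?_
  have : Tendsto (fun n : ℕ => Real.exp (-(a * Real.log n))) atTop (𝓝 0) :=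
    Real.tendsto_exp_neg_atTop_nhds_zero.comp (tendsto_log_natCast.const_mul_atTop ha)
  simpa using this.const_mul K

/-- The range `r n` is of the order `√(log n / n)`, with explicit constants. -/
structure LogRange (r : ℕ → ℝ) (c₁ c₂ : ℝ) : Prop where
  c₁_pos : 0 < c₁
  c₂_pos : 0 < c₂
  pos : ∀ n, 0 < r n
  lower : ∀ᶠ n : ℕ in atTop, c₁ * Real.log n ≤ n * r n ^ 2
  upper : ∀ᶠ n : ℕ in atTop, n * r n ^ 2 ≤ c₂ * Real.log n

lemma exists_logRange {r : ℕ → ℝ} (hr : ∀ n, 0 < r n)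
    (h : r =Θ[atTop] fun n : ℕ => Real.sqrt (Real.log n / n)) : ∃ c₁ c₂, LogRange r c₁ c₂ := by
  obtain ⟨C, hC, h1⟩ := h.1.exists_pos
  obtain ⟨c, hc, h2⟩ := h.2.exists_pos
  refine ⟨(c ^ 2)⁻¹, C ^ 2, by positivity, by positivity, hr, ?_, ?_⟩
  · filter_upwards [h2.bound, eventually_gt_atTop 0, tendsto_log_natCast.eventually_ge_atTop 0]
      with n hn hn0 hlog
    have hn' : (0 : ℝ) < n := by exact_mod_cast hn0
    rw [Real.norm_of_nonneg (Real.sqrt_nonneg _), Real.norm_of_nonneg (hr n).le,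
      Real.sqrt_le_left (by have := hr n; positivity), div_le_iff₀ hn'] at hn
    rw [inv_mul_le_iff₀ (by positivity)]
    linarith
  · filter_upwards [h1.bound, eventually_gt_atTop 0, tendsto_log_natCast.eventually_ge_atTop 0]
      with n hn hn0 hlog
    have hn' : (0 : ℝ) < n := by exact_mod_cast hn0
    rw [Real.norm_of_nonneg (Real.sqrt_nonneg _), Real.norm_of_nonneg (hr n).le] at hn
    have h3 := pow_le_pow_left₀ (hr n).le hn 2
    rw [mul_pow, Real.sq_sqrt (by positivity), mul_div_assoc', le_div_iff₀ hn'] at h3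
    linarith

/-- The number of cells per side in a grid whose cells are a bit smaller than the range. -/
noncomputable def fineGrid (ρ : ℝ) : ℕ := ⌈3 / ρ⌉₊

lemma fineGrid_bounds {ρ : ℝ} (h0 : 0 < ρ) (h1 : ρ ≤ 1) :
    0 < fineGrid ρ ∧ 3 ≤ fineGrid ρ * ρ ∧ fineGrid ρ * ρ ≤ 4 := by
  have h3 : 3 / ρ ≤ fineGrid ρ := Nat.le_ceil _
  have h4 : (fineGrid ρ : ℝ) < 3 / ρ + 1 := Nat.ceil_lt_add_one (by positivity)
  refine ⟨Nat.ceil_pos.2 (by positivity), ?_, ?_⟩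
  · rwa [div_le_iff₀ h0] at h3
  · have := mul_le_mul_of_nonneg_right h4.le h0.le
    rw [add_mul, div_mul_cancel₀ _ h0.ne'] at this
    linarith

variable {r : ℕ → ℝ} {c₁ c₂ : ℝ}

lemma LogRange.eventually_mul_sq_le (h : LogRange r c₁ c₂) (K : ℝ) (k : ℕ) :
    ∀ᶠ n : ℕ in atTop, K * Real.log n ^ k * r n ^ 2 ≤ 1 := by
  filter_upwards [h.upper, eventually_mul_log_pow_le (c₂ * |K|) (k + 1), eventually_gt_atTop 0,
    tendsto_log_natCast.eventually_ge_atTop 0] with n h1 h2 hn0 hL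
  have hn' : (0 : ℝ) < n := by exact_mod_cast hn0
  rw [← mul_le_mul_iff_of_pos_left hn']
  have h3 : 0 ≤ |K| * Real.log n ^ k := by positivity
  have h4 := mul_le_mul_of_nonneg_left h1 h3
  have h5 : K * Real.log n ^ k * (n * r n ^ 2) ≤ |K| * Real.log n ^ k * (n * r n ^ 2) := by
    gcongr
    exact le_abs_self K
  calc (n : ℝ) * (K * Real.log n ^ k * r n ^ 2) = K * Real.log n ^ k * (n * r n ^ 2) := by ring
    _ ≤ |K| * Real.log n ^ k * (c₂ * Real.log n) := h5.trans h4
    _ = c₂ * |K| * Real.log n ^ (k + 1) := by ring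
    _ ≤ n * 1 := by rw [mul_one]; exact h2

lemma LogRange.eventually_le (h : LogRange r c₁ c₂) {δ : ℝ} (hδ : 0 < δ) :
    ∀ᶠ n in atTop, r n ≤ δ := by
  filter_upwards [h.eventually_mul_sq_le ((δ ^ 2)⁻¹) 0] with n hn
  rw [pow_zero, mul_one, inv_mul_le_iff₀ (by positivity), mul_one] at hn
  exact (pow_le_pow_iff_left₀ (h.pos n).le hδ.le two_ne_zero).1 hn

lemma LogRange.eventually_fineGrid (h : LogRange r c₁ c₂) (K : ℝ) : ∀ᶠ n : ℕ in atTop,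
    K < fineGrid (r n) ∧ (fineGrid (r n) : ℝ) ^ 2 ≤ n ∧
      c₁ / 16 * Real.log n ≤ n / (fineGrid (r n) : ℝ) ^ 2 ∧
      n / (fineGrid (r n) : ℝ) ^ 2 ≤ c₂ * Real.log n := by
  have hc := h.c₁_pos
  filter_upwards [h.eventually_le one_pos, h.eventually_le (δ := (|K| + 1)⁻¹) (by positivity),
    h.lower, h.upper, tendsto_log_natCast.eventually_ge_atTop (16 / c₁),
    tendsto_log_natCast.eventually_ge_atTop 0]
    with n hr1 hrK h1 h2 hL hL0
  have hr := h.pos n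
  obtain ⟨hm, hm3, hm4⟩ := fineGrid_bounds hr hr1
  set m := fineGrid (r n)
  have hm' : (0 : ℝ) < m := by exact_mod_cast hm
  rw [div_le_iff₀ hc] at hL
  have hmr : ((m : ℝ) * r n) ^ 2 ≤ 16 := by nlinarith
  have hmr' : 9 ≤ ((m : ℝ) * r n) ^ 2 := by nlinarith
  refine ⟨?_, ?_, ?_, ?_⟩
  · have h5 : m * r n ≤ m * (|K| + 1)⁻¹ := by gcongr
    have h6 : 3 ≤ m * (|K| + 1)⁻¹ := hm3.trans h5
    rw [← div_eq_mul_inv, le_div_iff₀ (by positivity)] at h6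
    have := le_abs_self K
    have := abs_nonneg K
    linarith
  · have h5 : (m : ℝ) ^ 2 * 16 ≤ (m : ℝ) ^ 2 * (n * r n ^ 2) := by gcongr; linarith
    have h6 : (m : ℝ) ^ 2 * (n * r n ^ 2) = n * (m * r n) ^ 2 := by ring
    have h7 : (n : ℝ) * (m * r n) ^ 2 ≤ n * 16 := by gcongr
    linarith
  · rw [le_div_iff₀ (by positivity)]
    have h6 : (m : ℝ) ^ 2 * (n * r n ^ 2) = n * (m * r n) ^ 2 := by ring
    have h7 : (n : ℝ) * (m * r n) ^ 2 ≤ n * 16 := by gcongr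
    have h8 : (m : ℝ) ^ 2 * (c₁ * Real.log n) ≤ (m : ℝ) ^ 2 * (n * r n ^ 2) := by gcongr
    linarith
  · rw [div_le_iff₀ (by positivity)]
    have h6 : (m : ℝ) ^ 2 * (n * r n ^ 2) = n * (m * r n) ^ 2 := by ring
    have h7 : (n : ℝ) * 9 ≤ n * (m * r n) ^ 2 := by gcongr
    have h8 : (m : ℝ) ^ 2 * (n * r n ^ 2) ≤ (m : ℝ) ^ 2 * (c₂ * Real.log n) := by gcongr
    have : (0 : ℝ) ≤ n := Nat.cast_nonneg n
    linarith

/-- With high probability no cell of the fine grid contains many points. -/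
lemma LogRange.volume_crowded_le (h : LogRange r c₁ c₂) : ∀ᶠ n : ℕ in atTop,
    (volume : Measure (Fin n → Torus)) {x | ∃ c : ZMod (fineGrid (r n)) × ZMod (fineGrid (r n)),
      (2 * c₂ + 5) * Real.log n ≤ cellCount (fun i => torusCell (fineGrid (r n)) (x i)) c} ≤
      ENNReal.ofReal (1 * Real.exp (-(4 * Real.log n))) := by
  filter_upwards [h.eventually_fineGrid 0, tendsto_log_natCast.eventually_ge_atTop 0,
    eventually_gt_atTop 0] with n ⟨hm, hmn, _, h2⟩ hL hn
  have hn' : (0 : ℝ) < n := by exact_mod_cast hn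
  have : NeZero (fineGrid (r n)) := ⟨by rintro e; simp [e] at hm⟩
  refine (volume_exists_le_cellCount _).trans (ENNReal.ofReal_le_ofReal ?_)
  have hc := h.c₂_pos
  -- A cell has mean at most `c₂ log n`, so the threshold leaves an exponent of at most `-5 log n`;
  -- the union over at most `n` cells costs one `log n`.
  calc _ ≤ (n : ℝ) * Real.exp (-(5 * Real.log n)) := by
        gcongr
        nlinarith
    _ = Real.exp (Real.log n) * Real.exp (-(5 * Real.log n)) := by rw [Real.exp_log hn']
    _ = _ := by rw [← Real.exp_add, one_mul]; congr 1; ring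

/-- With high probability there are few cells of the fine grid with few points in each window. -/
lemma LogRange.volume_bad_window_le (h : LogRange r c₁ c₂) {q : ℕ} (hq : 80 / c₁ ≤ q) :
    ∀ᶠ n : ℕ in atTop, (volume : Measure (Fin n → Torus))
      {x | ¬ ∀ c : ZMod (fineGrid (r n)) × ZMod (fineGrid (r n)), ∀ T : Finset (ℤ × ℤ),
        (∀ p ∈ T, |p.1| ≤ (4 * q : ℕ) ∧ |p.2| ≤ (4 * q : ℕ) ∧
          ¬ c₁ / 80 * Real.log n ≤ cellCount (fun i => torusCell (fineGrid (r n)) (x i))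
            (cellShift c p.1 p.2)) → T.card < q} ≤
      ENNReal.ofReal ((2 : ℝ) ^ ((8 * q + 1) * (8 * q + 1)) * Real.exp (-(1 * Real.log n))) := by
  have hc := h.c₁_pos
  filter_upwards [h.eventually_fineGrid (8 * q : ℕ), tendsto_log_natCast.eventually_ge_atTop 0,
    eventually_gt_atTop 0] with n ⟨hm, hmn, h1, _⟩ hL hn
  have hn' : (0 : ℝ) < n := by exact_mod_cast hn
  have hm' : 8 * q < fineGrid (r n) := by exact_mod_cast hm
  have : NeZero (fineGrid (r n)) := ⟨by omega⟩
  refine (volume_exists_bad_window hm' _).trans (ENNReal.ofReal_le_ofReal ?_)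
  rw [div_le_iff₀ hc] at hq
  -- Each cell contributes `3 / 5 · c₁ / 16 - c₁ / 80 = c₁ / 40` to the exponent, and at least `80 /
  -- c₁` of them give `2 log n`, enough for a union over `n` windows.
  have hexp : q * (c₁ / 80 * Real.log n) - 3 / 5 * (q * (n / (fineGrid (r n) : ℝ) ^ 2)) ≤
      -(2 * Real.log n) := by
    have a1 : (q : ℝ) * (c₁ / 16 * Real.log n) ≤ q * (n / (fineGrid (r n) : ℝ) ^ 2) := by gcongr
    have a2 : 80 * Real.log n ≤ q * c₁ * Real.log n := by gcongr
    nlinarith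
  calc _ ≤ (n : ℝ) * (2 : ℝ) ^ ((8 * q + 1) * (8 * q + 1)) * Real.exp (-(2 * Real.log n)) := by
        gcongr
    _ = (2 : ℝ) ^ ((8 * q + 1) * (8 * q + 1)) *
        (Real.exp (Real.log n) * Real.exp (-(2 * Real.log n))) := by rw [Real.exp_log hn']; ring
    _ = _ := by rw [← Real.exp_add]; congr 2; ring

/-- At a range that makes the random geometric graph connected its conductance is at least of the
order of the range. -/
theorem LogRange.exists_le_contactFlow (h : LogRange r c₁ c₂)
    (hconn : Tendsto (fun n => (volume : Measure (Fin n → Torus))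
      {x | ¬ (geomGraph (r n) x).Connected}) atTop (𝓝 0)) :
    ∃ c : ℝ, 0 < c ∧ Tendsto (fun n => (volume : Measure (Fin n → Torus))
      {x | ¬ ∀ S : Finset (Fin n), S.Nonempty → 2 * S.card ≤ n → c * r n ≤ contactFlow (r n) S x})
      atTop (𝓝 0) := by
  have hc₁ := h.c₁_pos
  have hc₂ := h.c₂_pos
  obtain ⟨q, hq⟩ := exists_nat_ge (80 / c₁)
  set b := 2 * c₂ + 5 with hb
  have hb0 : 0 < b := by positivity
  set ε := c₁ / 80 with hε
  have hε0 : 0 < ε := by positivity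
  set w : ℝ := (2 * (4 * q + 4) + 1) ^ 2 with hw
  have hw0 : 0 < w := by positivity
  set c := min 1 (c₁ * ε ^ 2 / (81 * 512 * b ^ 3 * w * (1 + 32 * q))) with hc
  have hc0 : 0 < c := lt_min one_pos (by positivity)
  refine ⟨c, hc0, ?_⟩
  have hlim := (hconn.add (tendsto_ofReal_mul_exp_neg_mul_log 1 (by norm_num : (0 : ℝ) < 4))).add
    (tendsto_ofReal_mul_exp_neg_mul_log ((2 : ℝ) ^ ((8 * q + 1) * (8 * q + 1))) one_pos)
  rw [add_zero, add_zero] at hlim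
  refine tendsto_of_tendsto_of_tendsto_of_le_of_le' tendsto_const_nhds hlim
    (Eventually.of_forall fun _ => zero_le) ?_
  filter_upwards [h.volume_crowded_le, h.volume_bad_window_le hq, h.eventually_le one_pos,
    h.lower, h.eventually_mul_sq_le ((162 * b ^ 2 * w) ^ 2) 4,
    tendsto_log_natCast.eventually_gt_atTop 0] with n hcrowd hwin hr1 hlow hsmall hL
  refine le_trans ?_ (add_le_add (add_le_add le_rfl hcrowd) hwin)
  refine le_trans (measure_mono ?_) ((measure_union_le _ _).trans
    (add_le_add (measure_union_le _ _) le_rfl))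
  intro x hx
  by_contra hcon
  rw [Set.mem_union, Set.mem_union, not_or, not_or] at hcon
  have hG := not_not.1 hcon.1.1
  have hbad := not_not.1 hcon.2
  refine hx fun S hS hS2 => ?_
  have hr := h.pos n
  obtain ⟨hm, hm3, hm4⟩ := fineGrid_bounds hr hr1
  set m := fineGrid (r n)
  have hm' : (0 : ℝ) < m := by exact_mod_cast hm
  have : NeZero m := ⟨hm.ne'⟩
  have hm3' : 3 / m ≤ r n := by rw [div_le_iff₀ hm']; linarith
  have hm4' : r n ≤ 4 / m := by rw [le_div_iff₀ hm']; linarith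
  set L := Real.log n
  have hgrid := gridGraph_geomGraph hm hm3' hm4' hG (A := ε * L) (by positivity) hbad
  have hB' : ∀ c : ZMod m × ZMod m, cellCount (fun i => torusCell m (x i)) c ≤ b * L :=
    fun c => le_of_not_ge fun hc => hcon.1.2 ⟨c, hc⟩
  have hdeg := ncard_neighborSet_le hm hm4' hB'
  refine le_trans ?_ (cutCount_div_le_contactFlow hdeg S)
  have hs : (0 : ℝ) < S.card := by exact_mod_cast hS.card_pos
  have hiso := hgrid.card_le_or_card_mul_le hB' hS (by simpa using hS2)
  rw [← hw, Fintype.card_fin] at hiso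
  set e := cutCount (geomGraph (r n) x).Adj S fun _ => True
  have he : 0 ≤ e := cutCount_nonneg _ _ _
  rw [le_div_iff₀ (by positivity)]
  rcases hiso with hiso | hiso
  -- In the first alternative the flow is even at least of order `1 / log² n`, which exceeds `r`
  -- eventually.
  · have h1 : 162 * b ^ 2 * w * L ^ 2 * r n ≤ 1 := by
      rw [← abs_of_nonneg (by positivity : 0 ≤ 162 * b ^ 2 * w * L ^ 2 * r n), ← sq_le_one_iff_abs_le_one]
      refine le_trans (le_of_eq ?_) hsmall
      ring
    calc c * r n * (81 * (b * L) * S.card) ≤ 1 * r n * (81 * (b * L) * (2 * (b * L) * w * e)) := by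
          gcongr; exact min_le_left _ _
      _ = 162 * b ^ 2 * w * L ^ 2 * r n * e := by ring
      _ ≤ 1 * e := by gcongr
      _ = e := one_mul e
  -- Since `m r ≤ 4` and `n r² ≥ c₁ log n`, the factor `m³ / n` is at most of order `1 / (r log n)`;
  -- the remaining logarithms cancel against `A²`, `B²` and the degree.
  · have h1 : S.card * ε ^ 2 * L ^ 2 * r n * (c₁ * L) ≤
        512 * b ^ 2 * L ^ 2 * w * (1 + 32 * q) * e := by
      calc S.card * ε ^ 2 * L ^ 2 * r n * (c₁ * L)
          ≤ S.card * ε ^ 2 * L ^ 2 * r n * (n * r n ^ 2) := by gcongr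
        _ = (S.card * n * (ε * L) ^ 2) * r n ^ 3 := by ring
        _ ≤ (8 * (b * L) ^ 2 * w * (1 + 32 * q) * (m : ℝ) ^ 3 * e) * r n ^ 3 := by gcongr
        _ = 8 * (b * L) ^ 2 * w * (1 + 32 * q) * e * (m * r n) ^ 3 := by ring
        _ ≤ 8 * (b * L) ^ 2 * w * (1 + 32 * q) * e * 4 ^ 3 := by gcongr
        _ = _ := by ring
    have h2 : S.card * ε ^ 2 * L * r n * c₁ ≤ 512 * b ^ 2 * w * (1 + 32 * q) * e := by
      refine le_of_mul_le_mul_right ?_ (by positivity : 0 < L ^ 2)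
      linarith
    calc c * r n * (81 * (b * L) * S.card)
        ≤ (c₁ * ε ^ 2 / (81 * 512 * b ^ 3 * w * (1 + 32 * q))) * r n * (81 * (b * L) * S.card) := by
          gcongr; exact min_le_right _ _
      _ = (S.card * ε ^ 2 * L * r n * c₁) / (512 * b ^ 2 * w * (1 + 32 * q)) := by
          field_simp
      _ ≤ e := by rw [div_le_iff₀ (by positivity)]; linarith

/-- The mobile conductance is at least of the order of the range. -/
theorem LogRange.exists_le_mobileConductance (h : LogRange r c₁ c₂)
    (hconn : Tendsto (fun n => (volume : Measure (Fin n → Torus))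
      {x | ¬ (geomGraph (r n) x).Connected}) atTop (𝓝 0)) {rc : ℕ → ℝ} (hrc : ∀ n, 0 < rc n) :
    ∃ c : ℝ, 0 < c ∧ Tendsto (fun n => (volume : Measure (Fin n → Torus))
      {x | ¬ c * r n ≤ mobileConductance (r n) (areaConstrainedMove (rc n) x)}) atTop (𝓝 0) := by
  obtain ⟨c, hc, hlim⟩ := h.exists_le_contactFlow hconn
  refine ⟨c / 2, by positivity, ?_⟩
  have hlim2 := ENNReal.Tendsto.div_const (b := (2 : ENNReal)⁻¹) hlim (Or.inr (by simp))
  rw [ENNReal.zero_div] at hlim2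
  refine tendsto_of_tendsto_of_tendsto_of_le_of_le' tendsto_const_nhds hlim2
    (Eventually.of_forall fun _ => zero_le) ?_
  filter_upwards [eventually_ge_atTop 2] with n hn
  -- The event handles all `S` at once, so it bounds each expectation. Unless it has conditional
  -- probability at least `1 / 2`, half of the static bound survives.
  set B := {x : Fin n → Torus | ¬ ∀ S : Finset (Fin n), S.Nonempty → 2 * S.card ≤ n →
    c * r n ≤ contactFlow (r n) S x} with hB
  refine le_trans (measure_mono fun x hx => ?_) (volume_le_move_apply (hrc n) B (ε := 2⁻¹)
    (by simp) (by simp))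
  by_contra hcon
  have hcon : areaConstrainedMove (rc n) x B < 2⁻¹ := not_le.1 hcon
  refine hx (le_mobileConductance hn _ _ fun S hS hS2 => ?_)
  have := isProbabilityMeasure_move (hrc n) x
  refine le_trans ?_ (mul_le_integral_of_le_off (areaConstrainedMove (rc n) x)
    (integrable_contactFlow (r n) S _) (contactFlow_nonneg (r n) S)
    (B := B) (t := c * r n) fun y hy => (not_not.1 hy) S hS hS2)
  have hle := ENNReal.toReal_mono (by simp) hcon.le
  rw [ENNReal.toReal_inv, ENNReal.toReal_ofNat] at hle
  have hcr : 0 < c * r n := mul_pos hc (h.pos n)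
  change (areaConstrainedMove (rc n) x).real _ ≤ _ at hle
  nlinarith

end Asymptotic

/-! ### The upper bound from a strip -/

section UpperBound

/-- On nearest real representatives, a segment from a point of the arc to a point outside it passes
one of the endpoints `0` and `1 / 4`. -/
lemma norm_le_of_circleCell_four {x y : UnitAddCircle} {w : ℝ} (hx : circleCell 4 x = 0)
    (hy : circleCell 4 y ≠ 0) (h : ‖x - y‖ ≤ w) :
    ‖x‖ ≤ w ∨ ‖x - ((1 / 4 : ℝ) : UnitAddCircle)‖ ≤ w := by
  obtain ⟨s, t, rfl, rfl, hst⟩ := exists_rep_sub x y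
  rw [← hst, abs_le] at h
  rw [circleCell_coe, ZMod.intCast_zmod_eq_zero_iff_dvd] at hx
  obtain ⟨k, hk⟩ := hx
  have hk0 : ((k : ℝ) : UnitAddCircle) = 0 := by
    rw [AddCircle.coe_eq_zero_iff]; exact ⟨k, by simp⟩
  have h1 := Int.floor_le (((4 : ℕ) : ℝ) * s)
  have h2 := Int.lt_floor_add_one (((4 : ℕ) : ℝ) * s)
  rw [hk] at h1 h2
  push_cast at h1 h2
  rcases lt_or_ge t k with ht | ht
  · left
    have e : (s : UnitAddCircle) = ((s - k : ℝ) : UnitAddCircle) := by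
      rw [AddCircle.coe_sub, hk0, sub_zero]
    rw [e]
    refine (norm_coe_le_abs _).trans ?_
    rw [abs_le]; constructor <;> linarith
  · right
    have ht' : k + 1 / 4 ≤ t := by
      by_contra! hcon
      refine hy ?_
      rw [circleCell_coe, ZMod.intCast_zmod_eq_zero_iff_dvd]
      refine ⟨k, ?_⟩
      rw [Int.floor_eq_iff]
      push_cast
      constructor <;> linarith
    have e : (s : UnitAddCircle) - ((1 / 4 : ℝ) : UnitAddCircle) =
        ((s - k - 1 / 4 : ℝ) : UnitAddCircle) := by
      rw [AddCircle.coe_sub, AddCircle.coe_sub, hk0, sub_zero]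
    rw [e]
    refine (norm_coe_le_abs _).trans ?_
    rw [abs_le]; constructor <;> linarith

/-- A vertical strip that occupies a quarter of the torus. -/
def strip : Set Torus := {y | circleCell 4 (y 0) = 0}

/-- The points near the border of the strip. -/
def stripBorder (w : ℝ) : Set Torus :=
  {y | ‖y 0‖ ≤ w ∨ ‖y 0 - ((1 / 4 : ℝ) : UnitAddCircle)‖ ≤ w}

lemma measurableSet_strip : MeasurableSet strip :=
  measurable_pi_apply (X := fun _ : Fin 2 => UnitAddCircle) 0 (measurableSet_circleCell 4 0)

lemma measurableSet_stripBorder (w : ℝ) : MeasurableSet (stripBorder w) := by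
  have h1 : Continuous fun y : Torus => ‖y 0‖ := by fun_prop
  have h2 : Continuous fun y : Torus => ‖y 0 - ((1 / 4 : ℝ) : UnitAddCircle)‖ := by fun_prop
  exact ((isClosed_le h1 continuous_const).union (isClosed_le h2 continuous_const)).measurableSet

lemma volume_fst_mem (A : Set UnitAddCircle) :
    (volume : Measure Torus) {y | y 0 ∈ A} = volume A := by
  have := volume_pair A Set.univ
  simpa using this

lemma volume_real_strip : (volume : Measure Torus).real strip = 1 / 4 := by
  have : (volume : Measure Torus) strip = ((4 : ℕ) : ENNReal)⁻¹ := by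
    rw [← volume_circleCell 4 0]; exact volume_fst_mem {x | circleCell 4 x = 0}
  rw [Measure.real, this]
  simp

lemma volume_real_stripBorder_le {w : ℝ} (hw : 0 ≤ w) :
    (volume : Measure Torus).real (stripBorder w) ≤ 4 * w := by
  have hball : ∀ a : UnitAddCircle,
      (volume : Measure Torus).real {y | y 0 ∈ Metric.closedBall a w} ≤ 2 * w := by
    intro a
    rw [Measure.real, volume_fst_mem, AddCircle.volume_closedBall,
      ENNReal.toReal_ofReal (by positivity)]
    exact min_le_right _ _
  have hsub : stripBorder w ⊆ {y | y 0 ∈ Metric.closedBall 0 w} ∪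
      {y | y 0 ∈ Metric.closedBall ((1 / 4 : ℝ) : UnitAddCircle) w} := by
    intro y hy
    simpa [stripBorder, dist_eq_norm] using hy
  refine (measureReal_mono hsub).trans ((measureReal_union_le _ _).trans ?_)
  have h1 := hball 0
  have h2 := hball ((1 / 4 : ℝ) : UnitAddCircle)
  linarith

variable {n : ℕ}

lemma ae_move_torusDist_le {ρ : ℝ} (hρ : 0 < ρ) (h : Fin n → Torus) :
    ∀ᵐ x ∂(areaConstrainedMove ρ h), ∀ i, torusDist (h i) (x i) ≤ ρ := by
  have := fun i => isProbabilityMeasure_diskLaw hρ (h i)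
  rw [eventually_all]
  intro i
  exact (Measure.quasiMeasurePreserving_eval (μ := fun i => diskLaw ρ (h i)) i).ae
    (ae_diskLaw_torusDist_le ρ (h i))

/-- A contact across the cut joins homes at distance at most `r + 2 ρ`, so it starts at a node with
home near the border; each such node contributes at most 1. -/
lemma contactFlow_le_of_near {r ρ : ℝ} {h x : Fin n → Torus}
    (hx : ∀ i, torusDist (h i) (x i) ≤ ρ) {S : Finset (Fin n)} (hS : ∀ i, i ∈ S ↔ h i ∈ strip) :
    contactFlow r S x ≤ countIn h (stripBorder (r + 2 * ρ)) / S.card := by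
  classical
  unfold contactFlow
  gcongr
  rw [countIn_eq_sum]
  refine (Finset.sum_le_sum fun i hi => ?_).trans
    (Finset.sum_le_univ_sum_of_nonneg fun i => Set.indicator_nonneg (fun _ _ => zero_le_one) _)
  by_cases hb : h i ∈ stripBorder (r + 2 * ρ)
  · rw [Set.indicator_of_mem hb]
    exact sum_contactProb_le_one r x i _
  · rw [Set.indicator_of_notMem hb]
    refine (Finset.sum_eq_zero fun j hj => ?_).le
    unfold contactProb
    rw [if_neg]
    intro hij
    refine hb (norm_le_of_circleCell_four ((hS i).1 hi) (y := h j 0)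
      (fun hj' => Finset.mem_compl.1 hj ((hS j).2 hj')) ?_)
    have h1 := (norm_le_torusDist_zero _ _).trans (hx i)
    have h2 := (norm_le_torusDist_zero _ _).trans (hx j)
    have h3 := (norm_le_torusDist_zero _ _).trans hij.2.le
    have e : h i 0 - h j 0 = (h i 0 - x i 0) + (x i 0 - x j 0) - (h j 0 - x j 0) := by abel
    rw [e]
    have := norm_sub_le ((h i 0 - x i 0) + (x i 0 - x j 0)) (h j 0 - x j 0)
    have := norm_add_le (h i 0 - x i 0) (x i 0 - x j 0)
    linarith

lemma mobileConductance_le_of_strip {r ρ : ℝ} (hρ : 0 < ρ) {h : Fin n → Torus} (hn : 0 < n)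
    (hlow : (n : ℝ) / 8 ≤ countIn h strip) (hup : (countIn h strip : ℝ) ≤ n / 2)
    (hb : (countIn h (stripBorder (r + 2 * ρ)) : ℝ) ≤ 16 * (n * (r + 2 * ρ))) :
    mobileConductance r (areaConstrainedMove ρ h) ≤ 128 * (r + 2 * ρ) := by
  classical
  have hn' : (0 : ℝ) < n := by exact_mod_cast hn
  set S : Finset (Fin n) := Finset.univ.filter fun i => h i ∈ strip
  have hcard : (S.card : ℝ) = countIn h strip := by unfold countIn; congr!
  rw [← hcard] at hlow hup
  have hpos : (0 : ℝ) < S.card := by linarith [div_pos hn' (by norm_num : (0 : ℝ) < 8)]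
  have hS : S.Nonempty := Finset.card_pos.1 (by exact_mod_cast hpos)
  have hS2 : 2 * S.card ≤ n := by
    have : (2 : ℝ) * S.card ≤ n := by linarith
    exact_mod_cast this
  have := isProbabilityMeasure_move hρ h
  refine (mobileConductance_le r _ hS hS2).trans ?_
  have h1 : ∫ x, contactFlow r S x ∂(areaConstrainedMove ρ h) ≤
      ∫ _, (countIn h (stripBorder (r + 2 * ρ)) : ℝ) / S.card ∂(areaConstrainedMove ρ h) := by
    refine integral_mono_ae (integrable_contactFlow r S _) (integrable_const _) ?_
    filter_upwards [ae_move_torusDist_le hρ h] with x hx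
    exact contactFlow_le_of_near hx fun i => by simp [S]
  refine h1.trans ?_
  rw [integral_const, probReal_univ, one_smul, div_le_iff₀ hpos]
  refine hb.trans ?_
  have : 0 ≤ 16 * (n * (r + 2 * ρ)) := le_trans (Nat.cast_nonneg _) hb
  have h2 : 0 ≤ r + 2 * ρ := by
    by_contra! hcon
    have := mul_neg_of_pos_of_neg hn' hcon
    linarith
  nlinarith

/-- The mobile conductance is at most of the order of the sum of the range and the mobility
capacity. -/
theorem LogRange.mobileConductance_le {r : ℕ → ℝ} {c₁ c₂ : ℝ} (h : LogRange r c₁ c₂)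
    {rc : ℕ → ℝ} (hrc : ∀ n, 0 < rc n) :
    Tendsto (fun n => (volume : Measure (Fin n → Torus))
      {x | ¬ mobileConductance (r n) (areaConstrainedMove (rc n) x) ≤ 128 * (r n + 2 * rc n)})
      atTop (𝓝 0) := by
  have hc := h.c₁_pos
  have hlim := ((tendsto_ofReal_mul_exp_neg_mul_log 1 one_pos).add
    (tendsto_ofReal_mul_exp_neg_mul_log 1 one_pos)).add (tendsto_ofReal_mul_exp_neg_mul_log 1 hc)
  rw [add_zero, add_zero] at hlim
  refine tendsto_of_tendsto_of_tendsto_of_le_of_le' tendsto_const_nhds hlim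
    (Eventually.of_forall fun _ => zero_le) ?_
  filter_upwards [eventually_gt_atTop 0, eventually_mul_log_pow_le 40 1, h.eventually_le one_pos,
    h.lower, tendsto_log_natCast.eventually_ge_atTop 0] with n hn hnL hr1 hlow hL
  have hr := h.pos n
  have hrcn := hrc n
  have hn' : (0 : ℝ) < n := by exact_mod_cast hn
  rw [pow_one] at hnL
  -- The strip has area `1 / 4`, so that the Chernoff bounds place its count between `n / 8` and `n
  -- / 2` and `S` is admissible; area `1 / 2` would leave no margin.
  have b1 : (volume : Measure (Fin n → Torus)) {x | countIn x strip ≤ (n : ℝ) / 8} ≤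
      ENNReal.ofReal (1 * Real.exp (-(1 * Real.log n))) := by
    refine (measure_countIn_le volume n measurableSet_strip volume_real_strip.ge _).trans
      (ENNReal.ofReal_le_ofReal ?_)
    rw [one_mul, Real.exp_le_exp]
    linarith
  have b2 : (volume : Measure (Fin n → Torus)) {x | (n : ℝ) / 2 ≤ countIn x strip} ≤
      ENNReal.ofReal (1 * Real.exp (-(1 * Real.log n))) := by
    refine (measure_le_countIn volume n measurableSet_strip volume_real_strip.le _).trans
      (ENNReal.ofReal_le_ofReal ?_)
    rw [one_mul, Real.exp_le_exp]
    linarith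
  have b3 : (volume : Measure (Fin n → Torus)) {x | 16 * (n * (r n + 2 * rc n)) ≤
      countIn x (stripBorder (r n + 2 * rc n))} ≤
      ENNReal.ofReal (1 * Real.exp (-(c₁ * Real.log n))) := by
    refine (measure_le_countIn volume n (measurableSet_stripBorder _)
      (volume_real_stripBorder_le (by positivity)) _).trans (ENNReal.ofReal_le_ofReal ?_)
    rw [one_mul, Real.exp_le_exp]
    have h1 : (n : ℝ) * r n ^ 2 ≤ n * r n := by
      gcongr
      nlinarith
    have h2 : 0 ≤ (n : ℝ) * rc n := by positivity
    have h3 : 0 ≤ (n : ℝ) * r n := by positivity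
    nlinarith
  refine le_trans ?_ (add_le_add (add_le_add b1 b2) b3)
  refine le_trans (measure_mono ?_) ((measure_union_le _ _).trans
    (add_le_add (measure_union_le _ _) le_rfl))
  intro x hx
  by_contra hcon
  rw [Set.mem_union, Set.mem_union, not_or, not_or] at hcon
  exact hx (mobileConductance_le_of_strip hrcn hn (le_of_not_ge hcon.1.1)
    (le_of_not_ge hcon.1.2) (le_of_not_ge hcon.2))

end UpperBound

/-! ### Meeting probability of two nodes -/

section Meeting

lemma map_pair_pi {ι : Type*} [Fintype ι] {α : ι → Type*} [∀ i, MeasurableSpace (α i)]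
    (μ : (i : ι) → Measure (α i)) [∀ i, IsProbabilityMeasure (μ i)] {u v : ι} (huv : u ≠ v) :
    (Measure.pi μ).map (fun x => (x u, x v)) = (μ u).prod (μ v) := by
  have h := (iIndepFun_pi (μ := μ) (X := fun i => (id : α i → α i))
    fun i => aemeasurable_id).indepFun huv
  have h : IndepFun (fun x : ∀ i, α i => x u) (fun x => x v) (Measure.pi μ) := h
  rw [indepFun_iff_map_prod_eq_prod_map_map (measurable_pi_apply u).aemeasurable
    (measurable_pi_apply v).aemeasurable] at h
  rw [← (measurePreserving_eval μ u).map_eq, ← (measurePreserving_eval μ v).map_eq]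
  exact h

lemma mul_le_prod_real {α β : Type*} [MeasurableSpace α] [MeasurableSpace β] (μ : Measure α)
    (ν : Measure β) [IsProbabilityMeasure μ] [IsProbabilityMeasure ν] {s : Set (α × β)}
    (hs : MeasurableSet s) {Q : Set α} (hQ : MeasurableSet Q) {b : ℝ}
    (h : ∀ x ∈ Q, b ≤ ν.real {y | (x, y) ∈ s}) : b * μ.real Q ≤ (μ.prod ν).real s := by
  have h1 : ENNReal.ofReal b * μ Q ≤ μ.prod ν s := by
    rw [Measure.prod_apply hs, ← setLIntegral_const]
    refine (setLIntegral_mono_ae' hQ (ae_of_all _ fun x hx => ?_)).trans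
      (setLIntegral_le_lintegral Q _)
    exact ENNReal.ofReal_le_of_le_toReal (h x hx)
  have h2 := ENNReal.toReal_mono (measure_ne_top _ _) h1
  rw [ENNReal.toReal_mul] at h2
  refine le_trans ?_ h2
  rw [ENNReal.toReal_ofReal']
  exact mul_le_mul_of_nonneg_right (le_max_left _ _) measureReal_nonneg

lemma diskLaw_real_square {ρ : ℝ} (hρ : 0 < ρ) {p x : Torus} {s : ℝ} (hs : 0 ≤ s)
    (hx0 : ‖p 0 - x 0‖ + s ≤ ρ / 2) (hx1 : ‖p 1 - x 1‖ + s ≤ ρ / 2) :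
    (min 1 (2 * s)) ^ 2 / (min 1 (2 * ρ)) ^ 2 ≤
      (diskLaw ρ p).real {y | ‖x 0 - y 0‖ ≤ s ∧ ‖x 1 - y 1‖ ≤ s} := by
  have hsub : {y : Torus | ‖x 0 - y 0‖ ≤ s ∧ ‖x 1 - y 1‖ ≤ s} ⊆ {y | torusDist p y ≤ ρ} := by
    intro y hy
    refine torusDist_le_of_square hρ.le ?_ ?_
    · have := norm_sub_le_norm_sub_add_norm_sub (p 0) (x 0) (y 0)
      have := hy.1
      linarith
    · have := norm_sub_le_norm_sub_add_norm_sub (p 1) (x 1) (y 1)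
      have := hy.2
      linarith
  rw [diskLaw_real_apply, Set.inter_eq_self_of_subset_right hsub, volume_real_square x hs,
    div_eq_inv_mul]
  have h1 := le_volume_real_disk p hρ.le
  have h2 : 0 < (min 1 ρ) ^ 2 := by
    have : 0 < min 1 ρ := lt_min one_pos hρ
    positivity
  have h3 := volume_real_disk_le p hρ.le
  gcongr
  linarith

/-- Nodes with close home points meet with a probability of the order `(r / ρ) ^ 2`. -/
lemma le_move_real_adj {n : ℕ} {r ρ : ℝ} (hr : 0 < r) (hr1 : r ≤ 1) (hrρ : r ≤ 3 / 4 * ρ)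
    {h : Fin n → Torus} {u v : Fin n} (huv : u ≠ v)
    (h0 : ‖h u 0 - h v 0‖ ≤ ρ / 8) (h1 : ‖h u 1 - h v 1‖ ≤ ρ / 8) :
    r ^ 2 / (1024 * ρ ^ 2) ≤ (areaConstrainedMove ρ h).real {x | (geomGraph r x).Adj u v} := by
  have hρ : 0 < ρ := by linarith
  have hp := fun i => isProbabilityMeasure_diskLaw hρ (h i)
  have hmin : 0 < min 1 (2 * ρ) := lt_min one_pos (by positivity)
  set s : Set (Torus × Torus) := {p | torusDist p.1 p.2 < r}
  have hs : MeasurableSet s := (isOpen_lt continuous_torusDist continuous_const).measurableSet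
  have e : (areaConstrainedMove ρ h).real {x | (geomGraph r x).Adj u v} =
      ((diskLaw ρ (h u)).prod (diskLaw ρ (h v))).real s := by
    rw [← map_pair_pi (fun i => diskLaw ρ (h i)) huv, Measure.real, Measure.real,
      Measure.map_apply (by fun_prop) hs]
    congr 2
    ext x
    exact ⟨fun hx => hx.2, fun hx => ⟨huv, hx⟩⟩
  rw [e]
  -- Keep `u` within `ρ / 8` of its home in each coordinate, hence within `ρ / 4` of the home of
  -- `v`. As `r / 3 ≤ ρ / 4`, the square of half-side `r / 3` around `u` then lies in the disk of
  -- `v`.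
  set Q : Set Torus := {y | ‖h u 0 - y 0‖ ≤ ρ / 8 ∧ ‖h u 1 - y 1‖ ≤ ρ / 8}
  have hQ : 1 / 64 ≤ (diskLaw ρ (h u)).real Q := by
    refine le_trans ?_ (diskLaw_real_square hρ (by positivity : 0 ≤ ρ / 8) ?_ ?_)
    · rw [le_div_iff₀ (by positivity)]
      have : min 1 (2 * ρ) ≤ 8 * min 1 (2 * (ρ / 8)) := by
        rcases le_total 1 (2 * (ρ / 8)) with hh | hh
        · rw [min_eq_left hh]; linarith [min_le_left 1 (2 * ρ)]
        · rw [min_eq_right hh]; linarith [min_le_right 1 (2 * ρ)]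
      nlinarith
    · simp; linarith
    · simp; linarith
  have hb : ∀ x ∈ Q, r ^ 2 / (16 * ρ ^ 2) ≤ (diskLaw ρ (h v)).real {y | (x, y) ∈ s} := by
    intro x hx
    have hsub : {y : Torus | ‖x 0 - y 0‖ ≤ r / 3 ∧ ‖x 1 - y 1‖ ≤ r / 3} ⊆ {y | (x, y) ∈ s} := by
      intro y hy
      have : torusDist x y ≤ 2 / 3 * r := torusDist_le_of_square (by positivity)
        (by have := hy.1; linarith) (by have := hy.2; linarith)
      exact lt_of_le_of_lt this (by linarith)
    refine le_trans ?_ (measureReal_mono hsub)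
    refine le_trans ?_ (diskLaw_real_square hρ (by positivity : 0 ≤ r / 3) ?_ ?_)
    · rw [min_eq_right (by linarith : 2 * (r / 3) ≤ 1), div_le_div_iff₀ (by positivity) (by positivity)]
      have h2 : (min 1 (2 * ρ)) ^ 2 ≤ (2 * ρ) ^ 2 := by gcongr; exact min_le_right _ _
      calc r ^ 2 * (min 1 (2 * ρ)) ^ 2 ≤ r ^ 2 * (2 * ρ) ^ 2 := by gcongr
        _ ≤ _ := by nlinarith [sq_nonneg (r * ρ)]
    · have := norm_sub_le_norm_sub_add_norm_sub (h v 0) (h u 0) (x 0)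
      have := norm_sub_rev (h u 0) (h v 0)
      have := hx.1
      linarith
    · have := norm_sub_le_norm_sub_add_norm_sub (h v 1) (h u 1) (x 1)
      have := norm_sub_rev (h u 1) (h v 1)
      have := hx.2
      linarith
  refine le_trans ?_ (mul_le_prod_real _ _ hs (measurableSet_square _ _) hb)
  calc r ^ 2 / (1024 * ρ ^ 2) = r ^ 2 / (16 * ρ ^ 2) * (1 / 64) := by field_simp; norm_num
    _ ≤ _ := by gcongr

end Meeting

/-! ### Expected flow from pairwise meetings -/

section Flow

variable {n : ℕ}

lemma cutCount_eq_sum_indicator (r : ℝ) (S : Finset (Fin n)) (x : Fin n → Torus) :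
    (cutCount (geomGraph r x).Adj S fun _ => True) =
      ∑ i ∈ S, ∑ j ∈ Sᶜ, {x | (geomGraph r x).Adj i j}.indicator (fun _ => (1 : ℝ)) x := by
  classical
  simp only [Set.indicator_apply]
  rw [← Finset.sum_product', Finset.sum_boole]
  unfold cutCount
  congr 2
  ext p
  simp
  tauto

/-- A lower bound for the expected flow when the degrees are at most `d` outside the event `B` and
pairs of nodes related by `R` meet with probability at least `p`. -/
lemma le_integral_contactFlow {r : ℝ} (ν : Measure (Fin n → Torus)) [IsProbabilityMeasure ν]
    {B : Set (Fin n → Torus)} {d p : ℝ} (hd : 0 < d)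
    (hdeg : ∀ x ∉ B, ∀ i, (((geomGraph r x).neighborSet i).ncard : ℝ) ≤ d)
    {R : Fin n → Fin n → Prop}
    (hp : ∀ u v, u ≠ v → R u v → p ≤ ν.real {x | (geomGraph r x).Adj u v}) {S : Finset (Fin n)}
    (hS : S.Nonempty) :
    (p * (cutCount R S fun _ => True) - n * S.card * ν.real B) / (d * S.card) ≤
      ∫ x, contactFlow r S x ∂ν := by
  classical
  have hs : (0 : ℝ) < S.card := by exact_mod_cast hS.card_pos
  set B' := toMeasurable ν B
  have hB' : MeasurableSet B' := measurableSet_toMeasurable _ _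
  have eB : ν.real B = ν.real B' := by
    rw [Measure.real, Measure.real, measure_toMeasurable]
  set g : (Fin n → Torus) → ℝ := fun x => cutCount (geomGraph r x).Adj S fun _ => True
  have hg : g = fun x => ∑ i ∈ S, ∑ j ∈ Sᶜ,
      {x | (geomGraph r x).Adj i j}.indicator (fun _ => (1 : ℝ)) x :=
    funext fun x => cutCount_eq_sum_indicator r S x
  have hint : ∀ i j : Fin n, Integrable
      ({x : Fin n → Torus | (geomGraph r x).Adj i j}.indicator (fun _ => (1 : ℝ))) ν := fun i j =>
    (integrable_const _).indicator (measurableSet_adj r i j)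
  have hgint : Integrable g ν := by
    rw [hg]
    exact integrable_finsetSum _ fun i _ => integrable_finsetSum _ fun j _ => hint i j
  have hgcard : ∀ x, g x ≤ n * S.card := by
    intro x
    rw [hg]
    calc ∑ i ∈ S, ∑ j ∈ Sᶜ, {x | (geomGraph r x).Adj i j}.indicator (fun _ => (1 : ℝ)) x
        ≤ ∑ i ∈ S, ∑ j ∈ Sᶜ, 1 := by
          refine Finset.sum_le_sum fun i _ => Finset.sum_le_sum fun j _ => ?_
          exact Set.indicator_le_self' (fun _ _ => zero_le_one) _
      _ = (S.card : ℝ) * (Sᶜ).card := by simp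
      _ ≤ S.card * n := by
          gcongr
          exact (Finset.card_le_univ _).trans (by simp)
      _ = _ := mul_comm _ _
  -- On the exceptional event, where degrees are uncontrolled, the trivial bound `n |S|` is
  -- subtracted and makes the left side nonpositive.
  have hpt : ∀ x, (g x - B'.indicator (fun _ => (n * S.card : ℝ)) x) / (d * S.card) ≤
      contactFlow r S x := by
    intro x
    by_cases hx : x ∈ B'
    · refine le_trans ?_ (contactFlow_nonneg r S x)
      rw [Set.indicator_of_mem hx]
      exact div_nonpos_of_nonpos_of_nonneg (by linarith [hgcard x]) (by positivity)
    · rw [Set.indicator_of_notMem hx, sub_zero]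
      exact cutCount_div_le_contactFlow (hdeg x fun h => hx (subset_toMeasurable _ _ h)) S
  have hBint : Integrable (B'.indicator (fun _ => (n * S.card : ℝ))) ν :=
    (integrable_const _).indicator hB'
  have h1 := integral_mono ((hgint.sub hBint).div_const _) (integrable_contactFlow r S ν) hpt
  refine le_trans ?_ h1
  simp only [Pi.sub_apply]
  rw [integral_div, integral_sub hgint hBint, integral_indicator_const _ hB', smul_eq_mul, eB]
  have h2 : p * (cutCount R S fun _ => True) ≤ ∫ x, g x ∂ν := by
    rw [hg, integral_finsetSum _ fun i _ => integrable_finsetSum _ fun j _ => hint i j]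
    have e1 : (cutCount R S fun _ => True) = ∑ i ∈ S, ∑ j ∈ Sᶜ, if R i j then (1 : ℝ) else 0 := by
      rw [← Finset.sum_product', Finset.sum_boole]
      unfold cutCount
      congr 2
      ext p
      simp
      tauto
    rw [e1, Finset.mul_sum]
    refine Finset.sum_le_sum fun i hi => ?_
    rw [integral_finsetSum _ fun j _ => hint i j, Finset.mul_sum]
    refine Finset.sum_le_sum fun j hj => ?_
    rw [integral_indicator_const _ (measurableSet_adj r i j), smul_eq_mul, mul_one]
    split_ifs with hij
    · rw [mul_one]
      refine hp i j ?_ hij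
      rintro rfl
      exact Finset.mem_compl.1 hj hi
    · rw [mul_zero]; exact measureReal_nonneg
  rw [mul_comm (ν.real B')]
  gcongr

end Flow

/-! ### The lower bound by the mobility capacity -/

section LargeCapacity

/-- Lower bound for the mobile conductance when the home points are evenly spread and crowding is
unlikely. -/
lemma le_mobileConductance_of_uniform {n M : ℕ} [NeZero M] (hn : 2 ≤ n) {r ρ κ d δ : ℝ}
    (hr : 0 < r) (hr1 : r ≤ 1) (hrρ : r ≤ 3 / 4 * ρ) (hM : 16 ≤ M * ρ) (hMκ : M * ρ ≤ κ)
    {h : Fin n → Torus}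
    (hlow : ∀ c : ZMod M × ZMod M,
      (n : ℝ) / (M : ℝ) ^ 2 / 4 ≤ cellCount (fun i => torusCell M (h i)) c)
    (hup : ∀ c : ZMod M × ZMod M,
      cellCount (fun i => torusCell M (h i)) c ≤ 4 * ((n : ℝ) / (M : ℝ) ^ 2))
    {B : Set (Fin n → Torus)} (hd : 0 < d)
    (hdeg : ∀ x ∉ B, ∀ i, (((geomGraph r x).neighborSet i).ncard : ℝ) ≤ d)
    (hB : (areaConstrainedMove ρ h).real B ≤ δ)
    (hδ : δ ≤ r ^ 2 * ρ / (2 * (1024 * 2560 * κ ^ 3))) :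
    n * (r ^ 2 * ρ) / (2 * (1024 * 2560 * κ ^ 3) * d) ≤
      mobileConductance r (areaConstrainedMove ρ h) := by
  have hρ : 0 < ρ := by linarith
  have hκ : 0 < κ := by linarith
  have hM' : (0 : ℝ) < M := by exact_mod_cast NeZero.pos M
  have hn' : (0 : ℝ) < n := by exact_mod_cast (by omega : 0 < n)
  have := isProbabilityMeasure_move hρ h
  refine le_mobileConductance hn r _ fun S hS hS2 => ?_
  have hs : (0 : ℝ) < S.card := by exact_mod_cast hS.card_pos
  set R : Fin n → Fin n → Prop := fun u v =>
    ‖h u 0 - h v 0‖ ≤ ρ / 8 ∧ ‖h u 1 - h v 1‖ ≤ ρ / 8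
  have hcell : ∀ u v (i j : ℤ), |i| ≤ 1 → |j| ≤ 1 →
      torusCell M (h v) = cellShift (torusCell M (h u)) i j → R u v := by
    intro u v i j hi hj huv
    have h1 := norm_sub_le_of_torusCell (NeZero.pos M) huv hi hj
    have h2 : 2 / (M : ℝ) ≤ ρ / 8 := by rw [div_le_iff₀ hM']; linarith
    exact ⟨h1.1.trans h2, h1.2.trans h2⟩
  have hiso := card_mul_le_of_uniform_grid (κ := fun i => torusCell M (h i)) (R := R)
    (fun u v huv => ⟨by rw [norm_sub_rev]; exact huv.1, by rw [norm_sub_rev]; exact huv.2⟩)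
    (fun u v huv => hcell u v 0 0 (by simp) (by simp) (by rw [cellShift_zero]; exact huv))
    (fun u v huv => hcell u v 1 0 (by simp) (by simp) huv)
    (fun u v huv => hcell u v 0 1 (by simp) (by simp) huv)
    (by positivity) hlow hup (S := S) (by simpa using hS2)
  rw [Fintype.card_fin] at hiso
  set e := cutCount R S fun _ => True
  have hN : 0 < (n : ℝ) / (M : ℝ) ^ 2 := by positivity
  set N := (n : ℝ) / (M : ℝ) ^ 2
  -- With counts between `N / 4` and `4 N` the constant is `10 · 4² · 4²`.
  have hiso2 : (S.card : ℝ) * n ≤ 2560 * (M : ℝ) ^ 3 * e := by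
    refine le_of_mul_le_mul_right ?_ (by positivity : 0 < (N / 4) ^ 2)
    refine hiso.trans (le_of_eq ?_)
    ring
  refine le_trans ?_ (le_integral_contactFlow (areaConstrainedMove ρ h) hd hdeg (R := R)
    (p := r ^ 2 / (1024 * ρ ^ 2))
    (fun u v huv hR => le_move_real_adj hr hr1 hrρ huv hR.1 hR.2) hS)
  rw [div_le_div_iff₀ (by positivity) (by positivity)]
  have he : S.card * n * (r ^ 2 * ρ / (1024 * 2560 * κ ^ 3)) ≤ r ^ 2 / (1024 * ρ ^ 2) * e := by
    rw [mul_div_assoc', div_mul_eq_mul_div, div_le_div_iff₀ (by positivity) (by positivity)]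
    calc S.card * n * (r ^ 2 * ρ) * (1024 * ρ ^ 2)
        ≤ 2560 * (M : ℝ) ^ 3 * e * (r ^ 2 * ρ) * (1024 * ρ ^ 2) := by gcongr
      _ = r ^ 2 * e * (1024 * 2560) * (M * ρ) ^ 3 := by ring
      _ ≤ r ^ 2 * e * (1024 * 2560) * κ ^ 3 := by
          have : 0 ≤ e := cutCount_nonneg _ _ _
          gcongr
      _ = _ := by ring
  -- The bound on `δ` is chosen so that crowding costs at most half of the main term `he`.
  have hBδ : n * S.card * (areaConstrainedMove ρ h).real B ≤
      n * S.card * (r ^ 2 * ρ / (2 * (1024 * 2560 * κ ^ 3))) := by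
    gcongr
    exact hB.trans hδ
  have hX : r ^ 2 * ρ / (1024 * 2560 * κ ^ 3) = 2 * (r ^ 2 * ρ / (2 * (1024 * 2560 * κ ^ 3))) := by
    field_simp
  set X := r ^ 2 * ρ / (2 * (1024 * 2560 * κ ^ 3)) with hXdef
  have hdiff : S.card * n * X ≤ r ^ 2 / (1024 * ρ ^ 2) * e -
      n * S.card * (areaConstrainedMove ρ h).real B := by
    rw [hX] at he
    linarith
  have hfac : n * (r ^ 2 * ρ) * (d * S.card) =
      (S.card * n * X) * (2 * (1024 * 2560 * κ ^ 3) * d) := by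
    rw [hXdef]; field_simp
  rw [hfac]
  gcongr

variable {r rc : ℕ → ℝ} {c₁ c₂ : ℝ}

/-- If the mobility capacity is bounded and exceeds the range, then the mobile conductance is at
least of the order of the mobility capacity. -/
theorem LogRange.exists_mul_capacity_le (h : LogRange r c₁ c₂) (hrc : ∀ n, 0 < rc n)
    (hlarge : r =o[atTop] rc) (hbdd : rc =O[atTop] fun _ => (1 : ℝ)) :
    ∃ c : ℝ, 0 < c ∧ Tendsto (fun n => (volume : Measure (Fin n → Torus))
      {x | ¬ c * rc n ≤ mobileConductance (r n) (areaConstrainedMove (rc n) x)}) atTop (𝓝 0) := by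
  have hc₁ := h.c₁_pos
  have hc₂ := h.c₂_pos
  obtain ⟨β, hβ, hbdd⟩ := hbdd.exists_pos
  set κ := 16 + β with hκdef
  have hκ : 0 < κ := by positivity
  set b := 2 * c₂ + 5 with hb
  have hb0 : 0 < b := by positivity
  set k := 2 * (1024 * 2560 * κ ^ 3) with hk
  have hk0 : 0 < k := by positivity
  refine ⟨c₁ / (81 * b * k), by positivity, ?_⟩
  have hlim := ((tendsto_ofReal_mul_exp_neg_mul_log 1 one_pos).add
    (tendsto_ofReal_mul_exp_neg_mul_log 1 one_pos)).add
    (tendsto_ofReal_mul_exp_neg_mul_log 1 two_pos)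
  rw [add_zero, add_zero] at hlim
  refine tendsto_of_tendsto_of_tendsto_of_le_of_le' tendsto_const_nhds hlim
    (Eventually.of_forall fun _ => zero_le) ?_
  have hη : 0 < c₁ / (10 * κ ^ 2) := by positivity
  -- The first entry serves the meeting estimate; the second makes the mean number of homes per cell
  -- at least `10 log n`, so that all cells concentrate.
  set η := min (3 / 4) (Real.sqrt (c₁ / (10 * κ ^ 2))) with hηdef
  have hη0 : 0 < η := lt_min (by norm_num) (Real.sqrt_pos.2 hη)
  filter_upwards [eventually_ge_atTop 2, h.eventually_le one_pos, h.lower, hlarge.def hη0,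
    hbdd.bound, h.volume_crowded_le, tendsto_log_natCast.eventually_ge_atTop 1,
    tendsto_log_natCast.eventually_ge_atTop (k / c₁ ^ 2)]
    with n hn hr1 hlow hsmall hrcβ hcrowd hL1 hLk
  have hr := h.pos n
  have hρ := hrc n
  have hn' : (0 : ℝ) < n := by exact_mod_cast (by omega : 0 < n)
  rw [Real.norm_of_nonneg hr.le, Real.norm_of_nonneg hρ.le] at hsmall
  rw [Real.norm_of_nonneg hρ.le, norm_one, mul_one] at hrcβ
  set L := Real.log n
  have hL0 : 0 < L := by linarith
  have hrρ : r n ≤ 3 / 4 * rc n := hsmall.trans (by gcongr; exact min_le_left _ _)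
  have hrρ2 : 10 * κ ^ 2 * r n ^ 2 ≤ c₁ * rc n ^ 2 := by
    have h1 : r n ≤ Real.sqrt (c₁ / (10 * κ ^ 2)) * rc n :=
      hsmall.trans (by gcongr; exact min_le_right _ _)
    have h2 := pow_le_pow_left₀ hr.le h1 2
    rw [mul_pow, Real.sq_sqrt hη.le, div_mul_eq_mul_div, le_div_iff₀ (by positivity)] at h2
    linarith
  obtain ⟨M, hMdef⟩ : ∃ M : ℕ, M = ⌈16 / rc n⌉₊ := ⟨_, rfl⟩
  have hMpos : 0 < M := by rw [hMdef]; exact Nat.ceil_pos.2 (by positivity)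
  have : NeZero M := ⟨hMpos.ne'⟩
  have hM' : (0 : ℝ) < M := by exact_mod_cast hMpos
  have hM1 : 16 ≤ M * rc n := by
    rw [← div_le_iff₀ hρ, hMdef]; exact Nat.le_ceil _
  -- Boundedness of the capacity is used here: rounding up costs at most `rc n ≤ β`.
  have hM2 : M * rc n ≤ κ := by
    have h1 : (M : ℝ) < 16 / rc n + 1 := by rw [hMdef]; exact Nat.ceil_lt_add_one (by positivity)
    have h2 := mul_le_mul_of_nonneg_right h1.le hρ.le
    rw [add_mul, div_mul_cancel₀ _ hρ.ne'] at h2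
    linarith
  have hN : 10 * L ≤ n / (M : ℝ) ^ 2 := by
    rw [le_div_iff₀ (by positivity)]
    refine le_of_mul_le_mul_right ?_ (by positivity : 0 < c₁ * rc n ^ 2)
    calc 10 * L * (M : ℝ) ^ 2 * (c₁ * rc n ^ 2) = 10 * (M * rc n) ^ 2 * (c₁ * L) := by ring
      _ ≤ 10 * κ ^ 2 * (n * r n ^ 2) := by gcongr
      _ = n * (10 * κ ^ 2 * r n ^ 2) := by ring
      _ ≤ n * (c₁ * rc n ^ 2) := by gcongr
  have hMn : (M : ℝ) ^ 2 ≤ n := by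
    have : 1 ≤ n / (M : ℝ) ^ 2 := by linarith
    rwa [le_div_iff₀ (by positivity), one_mul] at this
  set N := (n : ℝ) / (M : ℝ) ^ 2
  have hexp : ∀ y : ℝ, y ≤ -(2 * L) → (M : ℝ) ^ 2 * Real.exp y ≤ 1 * Real.exp (-(1 * L)) := by
    intro y hy
    calc (M : ℝ) ^ 2 * Real.exp y ≤ n * Real.exp (-(2 * L)) := by gcongr
      _ = Real.exp L * Real.exp (-(2 * L)) := by rw [Real.exp_log hn']
      _ = _ := by rw [← Real.exp_add, one_mul]; congr 1; ring
  have b1 : (volume : Measure (Fin n → Torus))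
      {x | ∃ c : ZMod M × ZMod M, cellCount (fun i => torusCell M (x i)) c ≤ N / 4} ≤
      ENNReal.ofReal (1 * Real.exp (-(1 * L))) :=
    (volume_exists_cellCount_le _).trans (ENNReal.ofReal_le_ofReal (hexp _ (by linarith)))
  have b2 : (volume : Measure (Fin n → Torus))
      {x | ∃ c : ZMod M × ZMod M, 4 * N ≤ cellCount (fun i => torusCell M (x i)) c} ≤
      ENNReal.ofReal (1 * Real.exp (-(1 * L))) :=
    (volume_exists_le_cellCount _).trans (ENNReal.ofReal_le_ofReal (hexp _ (by linarith)))
  set B := {x : Fin n → Torus | ∃ c : ZMod (fineGrid (r n)) × ZMod (fineGrid (r n)),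
    b * L ≤ cellCount (fun i => torusCell (fineGrid (r n)) (x i)) c}
  -- Crowding has probability at most `n⁻⁴`, so by Markov its conditional probability given the
  -- homes is below `n⁻²` except with probability `n⁻²`.
  have b3 : (volume : Measure (Fin n → Torus))
      {x | ENNReal.ofReal (Real.exp (-(2 * L))) ≤ areaConstrainedMove (rc n) x B} ≤
      ENNReal.ofReal (1 * Real.exp (-(2 * L))) := by
    refine (volume_le_move_apply hρ B (by simp [Real.exp_pos]) ENNReal.ofReal_ne_top).trans ?_
    refine (ENNReal.div_le_div_right hcrowd _).trans ?_
    rw [← ENNReal.ofReal_div_of_pos (Real.exp_pos _), one_mul, one_mul, ← Real.exp_sub]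
    refine ENNReal.ofReal_le_ofReal (le_of_eq ?_)
    congr 1; ring
  refine le_trans ?_ (add_le_add (add_le_add b1 b2) b3)
  refine le_trans (measure_mono ?_) ((measure_union_le _ _).trans
    (add_le_add (measure_union_le _ _) le_rfl))
  intro x hx
  by_contra hcon
  rw [Set.mem_union, Set.mem_union, not_or, not_or] at hcon
  refine hx ?_
  obtain ⟨hm, hm3, hm4⟩ := fineGrid_bounds hr hr1
  have hm' : (0 : ℝ) < fineGrid (r n) := by exact_mod_cast hm
  have := isProbabilityMeasure_move hρ x
  have hBx : (areaConstrainedMove (rc n) x).real B ≤ Real.exp (-(2 * L)) :=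
    ENNReal.toReal_le_of_le_ofReal (Real.exp_pos _).le (le_of_not_ge hcon.2)
  -- Since `r² ≤ rc`, the quantity `n² r² rc` is at least `(n r²)² ≥ (c₁ log n)²`, which eventually
  -- exceeds `k`.
  have hδ : Real.exp (-(2 * L)) ≤ r n ^ 2 * rc n / k := by
    have hL2 : k ≤ c₁ ^ 2 * L := by rwa [div_le_iff₀' (by positivity)] at hLk
    have h2 : k ≤ (c₁ * L) ^ 2 := by
      have : c₁ ^ 2 * L * 1 ≤ c₁ ^ 2 * L * L := by gcongr
      nlinarith
    have h3 : (c₁ * L) ^ 2 ≤ (n * r n ^ 2) ^ 2 := by gcongr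
    have h4 : (n * r n ^ 2) ^ 2 ≤ n ^ 2 * (r n ^ 2 * rc n) := by
      have : r n * r n ≤ 1 * rc n := by gcongr; linarith
      calc (n * r n ^ 2) ^ 2 = n ^ 2 * (r n ^ 2 * (r n * r n)) := by ring
        _ ≤ n ^ 2 * (r n ^ 2 * (1 * rc n)) := by gcongr
        _ = _ := by ring
    have h5 : Real.exp (-(2 * L)) = ((n : ℝ) ^ 2)⁻¹ := by
      rw [Real.exp_neg, two_mul, Real.exp_add, Real.exp_log hn', sq]
    rw [h5, inv_eq_one_div, div_le_div_iff₀ (by positivity) hk0, one_mul]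
    linarith
  refine le_trans ?_ (le_mobileConductance_of_uniform hn hr hr1 hrρ hM1 hM2
    (fun c => le_of_not_ge fun hc => hcon.1.1 ⟨c, hc⟩)
    (fun c => le_of_not_ge fun hc => hcon.1.2 ⟨c, hc⟩)
    (B := B) (d := 81 * (b * L)) (by positivity)
    (fun y hy => ncard_neighborSet_le hm (by rw [le_div_iff₀ hm']; linarith)
      fun c => le_of_not_ge fun hc => hy ⟨c, hc⟩) hBx hδ)
  rw [← hk, div_mul_eq_mul_div, div_le_div_iff₀ (by positivity) (by positivity)]
  calc c₁ * rc n * (k * (81 * (b * L))) = (c₁ * L) * (rc n * (81 * b * k)) := by ring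
    _ ≤ (n * r n ^ 2) * (rc n * (81 * b * k)) := by gcongr
    _ = _ := by ring

end LargeCapacity

/-! ### Assembly of the three regimes -/

lemma thetaWHP_of_bounds {Φ : (n : ℕ) → (Fin n → Torus) → ℝ} {f a A : ℕ → ℝ} {c C : ℝ}
    (hc : 0 < c) (hC : 0 < C)
    (hlow : Tendsto (fun n => (volume : Measure (Fin n → Torus)) {h | ¬ a n ≤ Φ n h}) atTop (𝓝 0))
    (hup : Tendsto (fun n => (volume : Measure (Fin n → Torus)) {h | ¬ Φ n h ≤ A n}) atTop (𝓝 0))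
    (hfa : ∀ᶠ n in atTop, c * f n ≤ a n) (hAf : ∀ᶠ n in atTop, A n ≤ C * f n) :
    ThetaWHP Φ f := by
  refine ⟨c, C, hc, hC, ?_⟩
  have hlim := hlow.add hup
  rw [add_zero] at hlim
  refine tendsto_of_tendsto_of_tendsto_of_le_of_le' tendsto_const_nhds hlim
    (Eventually.of_forall fun _ => zero_le) ?_
  filter_upwards [hfa, hAf] with n h1 h2
  refine (measure_mono fun h hh => ?_).trans (measure_union_le _ _)
  by_contra hcon
  rw [Set.mem_union, not_or] at hcon
  exact hh ⟨h1.trans (not_not.1 hcon.1), (not_not.1 hcon.2).trans h2⟩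

theorem theorem6 (r rc : ℕ → ℝ) (hr : ∀ n, 0 < r n) (hrc : ∀ n, 0 < rc n)
    (hr_order : r =Θ[atTop] fun n : ℕ => Real.sqrt (Real.log n / n))
    (hr_connected : Tendsto
      (fun n => (volume : Measure (Fin n → Torus)) {x | ¬ (geomGraph (r n) x).Connected})
      atTop (𝓝 0)) :
    (r =o[atTop] rc → rc =O[atTop] (fun _ => (1 : ℝ)) →
      ThetaWHP (fun n h => mobileConductance (r n) (areaConstrainedMove (rc n) h)) rc) ∧
    (rc =o[atTop] r →
      ThetaWHP (fun n h => mobileConductance (r n) (areaConstrainedMove (rc n) h)) r) ∧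
    (rc =Θ[atTop] r →
      ThetaWHP (fun n h => mobileConductance (r n) (areaConstrainedMove (rc n) h)) rc ∧
      ThetaWHP (fun n h => mobileConductance (r n) (areaConstrainedMove (rc n) h)) r) := by

  obtain ⟨c₁, c₂, h⟩ := exists_logRange hr hr_order
  obtain ⟨c, hc, hlow⟩ := h.exists_le_mobileConductance hr_connected hrc
  have hup := h.mobileConductance_le hrc
  have hbound : ∀ {f g : ℕ → ℝ} (_ : ∀ n, 0 < f n) (_ : ∀ n, 0 < g n) {K : ℝ},
      (∀ᶠ n in atTop, ‖f n‖ ≤ K * ‖g n‖) → ∀ᶠ n in atTop, f n ≤ K * g n := by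
    intro f g hf hg K hfg
    filter_upwards [hfg] with n hn
    rwa [Real.norm_of_nonneg (hf n).le, Real.norm_of_nonneg (hg n).le] at hn
  refine ⟨fun hlarge hbdd => ?_, fun hsmall => ?_, fun hθ => ?_⟩
  -- Only this regime needs the bound by the capacity; the other two use the bound by the range.
  -- Here and in the next case `384 = 128 · 3`, since `r + 2 r_c` is at most three times the larger
  -- of the two.
  · obtain ⟨c', hc', hlow'⟩ := h.exists_mul_capacity_le hrc hlarge hbdd
    refine thetaWHP_of_bounds hc' (C := 384) (by norm_num) hlow' hup
      (Eventually.of_forall fun _ => le_rfl) ?_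
    filter_upwards [hbound hr hrc (hlarge.def one_pos)] with n hn
    linarith
  · refine thetaWHP_of_bounds hc (C := 384) (by norm_num) hlow hup
      (Eventually.of_forall fun _ => le_rfl) ?_
    filter_upwards [hbound hrc hr (hsmall.def one_pos)] with n hn
    linarith
  · obtain ⟨K, hK, h1⟩ := hθ.1.exists_pos
    obtain ⟨K', hK', h2⟩ := hθ.2.exists_pos
    constructor
    · refine thetaWHP_of_bounds (c := c / K) (C := 128 * (K' + 2)) (by positivity) (by positivity)
        hlow hup ?_ ?_
      · filter_upwards [hbound hrc hr h1.bound] with n hn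
        rw [div_mul_eq_mul_div, div_le_iff₀ hK, mul_assoc, mul_comm (r n)]
        gcongr
      · filter_upwards [hbound hr hrc h2.bound] with n hn
        linarith
    · refine thetaWHP_of_bounds hc (C := 128 * (1 + 2 * K)) (by positivity) hlow hup
        (Eventually.of_forall fun _ => le_rfl) ?_
      filter_upwards [hbound hrc hr h1.bound] with n hn
      linarith
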